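/- **Setting.** Let $0<\theta<1$. A $\theta$-tube is the $\theta$-neighbourhood of a unit line segment in $\mathbb{R}^4$; its direction $v(T)\in S^3$ is determined up to sign. Two $\theta$-tubes are essentially distinct if the 2-fold dilate (about its centre) of neither contains the other. A $\theta$-cube is a set $[0,\theta)^4+v$ with $v\in(\theta\mathbb{Z})^4$; the letter $Q$ always denotes a $\theta$-cube. Let $\mathbb{T}$ be a finite set of pairwise essentially distinct $\theta$-tubes, and for each $T\in\mathbb{T}$ let $Y(T)$ be a shading of $T$, i.e. a union of $\theta$-cubes each of which intersects $T$. Put $\mathbb{T}_Y(Q)=\{T\in\mathbb{T}: Q\subset Y(T)\}$, let $\mathcal{Q}(Y)$ be the set of cubes contained in some $Y(T)$, and set $$\lambda_Y=\frac1{|\mathbb{T}|}\sum_{T\in\mathbb{T}}\frac{|Y(T)|}{|T|},\qquad \mu_Y=\frac1{|\mathcal{Q}(Y)|}\sum_{Q\in\mathcal{Q}(Y)}|\mathbb{T}_Y(Q)| .$$ Let $\Omega\subset S^3$ be a finite $\theta$-separated set and let $A\ge 1$. Suppose that every tube of $\mathbb{T}$ points in a direction of $\Omega$ and that for every $v\in\Omega$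 the number of tubes of $\mathbb{T}$ pointing in direction $v$ lies between $A^{-1}|\mathbb{T}|/|\Omega|$ and $A|\mathbb{T}|/|\Omega|$. Suppose also that $(\mathbb{T},Y)$ is $(\varepsilon_1,C_1)$-two-ends, where $0<\varepsilon_1<1$ and $C_1>0$: for all $T\in\mathbb{T}$, all $\theta\le r\le1$ and all balls $B(x,r)$, $$|\{Q: Q\subset Y(T)\cap B(x,r)\}|\le r^{\varepsilon_1}C_1\lambda_Y\theta^{-1}.$$ Write $M=\lambda_Y^{4/3}\,\theta^{2/3}\,(\theta^3|\Omega|)^{1/3}(\theta^3|\mathbb{T}|)^{2/3}$. Planes are two-dimensional. Then for every $\varepsilon>0$ the following hold. **(1) Weakly plany tubes.** Suppose that there are a real number $B$ and integers $B_1\ge B_2\ge 1$ with $B_1/B_2\le B$ such that for each $Q\in\mathcal{Q}(Y)$ there are planes $\Pi_1(Q),\dots,\Pi_{B_1}(Q)$ and collections $\mathbb{T}_1(Q),\dots,\mathbb{T}_{B_1}(Q)\subset\mathbb{T}_Y(Q)$ with $\angle(v(T),\Pi_i(Q))\le\theta$ for all $T\in\mathbb{T}_i(Q)$, with $A^{-1}\mu_Y/B\le|\mathbb{T}_i(Q)|\le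 A\mu_Y/B$ for all $i$, and such that each $T\in\mathbb{T}_Y(Q)$ is contained in exactly $B_2$ of the sets $\mathbb{T}_i(Q)$. Then $$\Big|\bigcup_{T\in\mathbb{T}}Y(T)\Big|\ \ge\ c\,C_1^{-C/\varepsilon_1}\,\theta^{\varepsilon}\,B^{-4/3}\,M,$$ where $C>0$ is an absolute constant and $c>0$ depends only on $\varepsilon,\varepsilon_1,A$. **(2) Strongly plany tubes.** Suppose that for each $Q\in\mathcal{Q}(Y)$ there is a plane $\Pi(Q)$ with $\angle(v(T),\Pi(Q))\le\theta$ for all $T\in\mathbb{T}_Y(Q)$. Then $$\Big|\bigcup_{T\in\mathbb{T}}Y(T)\Big|\ \ge\ c\,C_1^{-C/\varepsilon_1}\,\theta^{\varepsilon}\,M,$$ where $C>0$ is an absolute constant and $c>0$ depends only on $\varepsilon,\varepsilon_1,A$. **(3) Plany and robustly transverse tubes.** Let $0<\varepsilon_2<\varepsilon_1$, $C_2>0$, $K\ge1$. Suppose that for each $Q$ there is a plane $\Pi(Q)$ with $\angle(v(T),\Pi(Q))\le K\theta$ for all $T\in\mathbb{T}_Y(Q)$, and that $(\mathbb{T},Y)$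 is $(\varepsilon_2,C_2)$-robustly transverse: for all cubes $Q$, all vectors $v$ and all $\theta<r<1$, $$|\{T\in\mathbb{T}_Y(Q):\angle(v(T),v)\le r\}|\le r^{\varepsilon_2}C_2\mu_Y,$$ where $\angle(v(T),v)$ is the angle between the lines spanned by the two vectors. Then $$\Big|\bigcup_{T\in\mathbb{T}}Y(T)\Big|\ \ge\ c\,C_1^{-1/\varepsilon_1}\,C_2^{-2/\varepsilon_2}\,\theta^{\varepsilon}\,M,$$ where $c>0$ depends only on $\varepsilon,\varepsilon_1,\varepsilon_2,A,K$. -/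

import Mathlib

open MeasureTheory

noncomputable section

namespace Planebrush

/-- Four-dimensional Euclidean space. -/
abbrev E4 : Type := EuclideanSpace ℝ (Fin 4)

/-- The unit line segment `[start, start + dir]` in `ℝ⁴`, the core of a tube. The unit vector `dir`
is a direction of the tube; it is determined by the tube up to sign. -/
structure Tube where
  start : E4
  dir : E4
  norm_dir : ‖dir‖ = 1

/-- The `θ`-tube: the `θ`-neighbourhood of the unit segment. -/
def Tube.carrier (θ : ℝ) (T : Tube) : Set E4 :=
  Metric.thickening θ (segment ℝ T.start (T.start + T.dir))

def Tube.center (T : Tube) : E4 := T.start + (1 / 2 : ℝ) • T.dir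

/-- The 2-fold dilate of the `θ`-tube about its centre. -/
def Tube.dilate (θ : ℝ) (T : Tube) : Set E4 :=
  AffineMap.homothety T.center (2 : ℝ) '' T.carrier θ

def EssentiallyIdentical (θ : ℝ) (S T : Tube) : Prop :=
  T.carrier θ ⊆ S.dilate θ ∨ S.carrier θ ⊆ T.dilate θ

def EssentiallyDistinct (θ : ℝ) (𝕋 : Finset Tube) : Prop :=
  ∀ S ∈ 𝕋, ∀ T ∈ 𝕋, S ≠ T → ¬ EssentiallyIdentical θ S T

/-- The index `k` of the `θ`-cube `[0, θ)⁴ + θ k`. -/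
abbrev CubeIdx : Type := Fin 4 → ℤ

/-- The `θ`-cube `[0, θ)⁴ + θ k`. -/
def cube (θ : ℝ) (k : CubeIdx) : Set E4 :=
  {x | ∀ i, θ * (k i : ℝ) ≤ x i ∧ x i < θ * ((k i : ℝ) + 1)}

/-- The union of the `θ`-cubes with index in `S`. Since the cubes tile space, a union of cubes and
the set of (indices of) the cubes that it contains determine each other. -/
def region (θ : ℝ) (S : Finset CubeIdx) : Set E4 := ⋃ k ∈ S, cube θ k

/-- `Y` is a shading of the tubes of `𝕋`: `Y(T)`, given by its finite set of cubes, is a union of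
`θ`-cubes each of which intersects `T`. -/
def IsShading (θ : ℝ) (𝕋 : Finset Tube) (Y : Tube → Finset CubeIdx) : Prop :=
  ∀ T ∈ 𝕋, ∀ k ∈ Y T, (cube θ k ∩ T.carrier θ).Nonempty

/-- `𝕋_Y(Q)`: the tubes of `𝕋` whose shading contains the cube `Q`. -/
def tubesThrough (𝕋 : Finset Tube) (Y : Tube → Finset CubeIdx) (Q : CubeIdx) : Finset Tube :=
  𝕋.filter fun T => Q ∈ Y T

/-- `𝒬(Y)`: the cubes contained in at least one shading. -/
def cubesOf (𝕋 : Finset Tube) (Y : Tube → Finset CubeIdx) : Finset CubeIdx := 𝕋.biUnion Y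

/-- The union of the shadings `⋃_{T ∈ 𝕋} Y(T)`. -/
def shadedSet (θ : ℝ) (𝕋 : Finset Tube) (Y : Tube → Finset CubeIdx) : Set E4 :=
  ⋃ T ∈ 𝕋, region θ (Y T)

/-- `λ_Y`, the average of `|Y(T)| / |T|` over `T ∈ 𝕋`. -/
def avgDensity (θ : ℝ) (𝕋 : Finset Tube) (Y : Tube → Finset CubeIdx) : ℝ :=
  (∑ T ∈ 𝕋, volume.real (region θ (Y T)) / volume.real (T.carrier θ)) / (𝕋.card : ℝ)

/-- `μ_Y`, the average of `|𝕋_Y(Q)|` over `Q ∈ 𝒬(Y)`. -/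
def avgMult (𝕋 : Finset Tube) (Y : Tube → Finset CubeIdx) : ℝ :=
  (∑ Q ∈ cubesOf 𝕋 Y, ((tubesThrough 𝕋 Y Q).card : ℝ)) / ((cubesOf 𝕋 Y).card : ℝ)

/-- The angle in `[0, π/2]` between the lines spanned by two nonzero vectors. -/
def lineAngle (v w : E4) : ℝ :=
  min (InnerProductGeometry.angle v w) (InnerProductGeometry.angle v (-w))

/-- The angle in `[0, π/2]` between a nonzero vector `v` and a linear subspace: the angle between
`v` and its orthogonal projection (`π/2` if the projection vanishes). -/
def planeAngle (v : E4) (P : Submodule ℝ E4) : ℝ :=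
  InnerProductGeometry.angle v (P.starProjection v)

open Classical in
/-- `(𝕋, Y)` is `(ε₁, C₁)`-two-ends: every ball of radius `r ∈ [θ, 1]` contains at most
`r^ε₁ C₁ λ_Y θ⁻¹` of the cubes of each `Y(T)`. -/
def TwoEnds (θ : ℝ) (𝕋 : Finset Tube) (Y : Tube → Finset CubeIdx) (ε₁ C₁ : ℝ) : Prop :=
  ∀ T ∈ 𝕋, ∀ r : ℝ, θ ≤ r → r ≤ 1 → ∀ x : E4,
    (((Y T).filter fun k => cube θ k ⊆ Metric.ball x r).card : ℝ)
      ≤ r ^ ε₁ * C₁ * avgDensity θ 𝕋 Y * θ⁻¹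

open Classical in
/-- `(𝕋, Y)` is `(ε₂, C₂)`-robustly transverse: for every cube `Q`, every vector `v` and every
`r ∈ (θ, 1)`, at most `r^ε₂ C₂ μ_Y` tubes of `𝕋_Y(Q)` make an angle at most `r` with `v`. -/
def RobustlyTransverse (θ : ℝ) (𝕋 : Finset Tube) (Y : Tube → Finset CubeIdx) (ε₂ C₂ : ℝ) : Prop :=
  ∀ Q : CubeIdx, ∀ v : E4, ∀ r : ℝ, θ < r → r < 1 →
    (((tubesThrough 𝕋 Y Q).filter fun T => lineAngle T.dir v ≤ r).card : ℝ)
      ≤ r ^ ε₂ * C₂ * avgMult 𝕋 Y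

/-- Planyness with implicit constant `K`: for each cube `Q` there is a plane making an angle at most
`K θ` with all the tubes of `𝕋_Y(Q)`. -/
def Plany (K θ : ℝ) (𝕋 : Finset Tube) (Y : Tube → Finset CubeIdx) : Prop :=
  ∀ Q : CubeIdx, ∃ P : Submodule ℝ E4, Module.finrank ℝ P = 2 ∧
    ∀ T ∈ tubesThrough 𝕋 Y Q, planeAngle T.dir P ≤ K * θ

open Classical in
/-- Weak planyness with parameters `B, B₁, B₂`, up to the constant `A`: for each `Q ∈ 𝒬(Y)` there
are planes `Π₁(Q), …, Π_{B₁}(Q)` and collections `𝕋₁(Q), …, 𝕋_{B₁}(Q) ⊆ 𝕋_Y(Q)`, each of size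
`∼ μ_Y / B`, so that the tubes of `𝕋ᵢ(Q)` make an angle at most `θ` with `Πᵢ(Q)`, and every tube of
`𝕋_Y(Q)` is contained in exactly `B₂` of the collections. -/
def WeaklyPlany (A θ : ℝ) (𝕋 : Finset Tube) (Y : Tube → Finset CubeIdx)
    (B : ℝ) (B₁ B₂ : ℕ) : Prop :=
  ∀ Q ∈ cubesOf 𝕋 Y, ∃ (P : Fin B₁ → Submodule ℝ E4) (S : Fin B₁ → Finset Tube),
    (∀ i, Module.finrank ℝ (P i) = 2) ∧
    (∀ i, S i ⊆ tubesThrough 𝕋 Y Q) ∧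
    (∀ i, ∀ T ∈ S i, planeAngle T.dir (P i) ≤ θ) ∧
    (∀ i, A⁻¹ * (avgMult 𝕋 Y / B) ≤ ((S i).card : ℝ) ∧
      ((S i).card : ℝ) ≤ A * (avgMult 𝕋 Y / B)) ∧
    (∀ T ∈ tubesThrough 𝕋 Y Q, (Finset.univ.filter fun i => T ∈ S i).card = B₂)

/-- `Ω` is a `θ`-separated set of points of the unit sphere. -/
def SeparatedDirections (θ : ℝ) (Ω : Finset E4) : Prop :=
  (∀ v ∈ Ω, ‖v‖ = 1) ∧ ∀ v ∈ Ω, ∀ w ∈ Ω, v ≠ w → θ ≤ InnerProductGeometry.angle v w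

/-- The tube points in direction `v` (directions of tubes are determined up to sign). -/
def Tube.PointsIn (T : Tube) (v : E4) : Prop := T.dir = v ∨ T.dir = -v

open Classical in
/-- Every tube of `𝕋` points in a direction of `Ω`, and the number of tubes pointing in each
direction of `Ω` is `|𝕋| / |Ω|` up to the factor `A`. -/
def UniformDirections (A : ℝ) (Ω : Finset E4) (𝕋 : Finset Tube) : Prop :=
  (∀ T ∈ 𝕋, ∃ v ∈ Ω, T.PointsIn v) ∧
  ∀ v ∈ Ω, A⁻¹ * ((𝕋.card : ℝ) / (Ω.card : ℝ)) ≤ ((𝕋.filter fun T => T.PointsIn v).card : ℝ) ∧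
    ((𝕋.filter fun T => T.PointsIn v).card : ℝ) ≤ A * ((𝕋.card : ℝ) / (Ω.card : ℝ))

/-- `λ_Y^{4/3} θ^{2/3} (θ³|Ω|)^{1/3} (θ³|𝕋|)^{2/3}`. -/
def mainTerm (θ : ℝ) (Ω : Finset E4) (𝕋 : Finset Tube) (Y : Tube → Finset CubeIdx) : ℝ :=
  avgDensity θ 𝕋 Y ^ (4 / 3 : ℝ) * θ ^ (2 / 3 : ℝ) *
    (θ ^ 3 * (Ω.card : ℝ)) ^ (1 / 3 : ℝ) * (θ ^ 3 * (𝕋.card : ℝ)) ^ (2 / 3 : ℝ)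

end Planebrush

end

/-!
Let `𝒬` be the set of cubes, `N` the number of tubes and `E` the number of incidences between cubes
and tubes. All three estimates follow from one upper bound for `(E / N)² (E / |𝒬|)³`, obtained by
counting *chains* of incidences
`q₀ – T₁ – q₁ – T₂ – q₂ – T₃ – q₃ – T₄`,
where a vertex `q = (Q, i)` is a cube together with one of its planes and `qᵢ` lies on `Tᵢ` and on
`Tᵢ₊₁`. The incidences are first refined (`exists_refinement`), with losses `θ ^ κ` for arbitrarily
small `κ > 0`, so that the planes of two vertices on a common tube are typically at distance `β`,
two tubes at a common vertex typically make an angle `α`, and no tube and no vertex has few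
incidences. This replaces transversality assumptions: the tubes of a vertex may be concentrated in a
small cap, and all powers of `α` and `β` cancel in the end.

Fix `q₀, T₁, q₁`. The planes of `q₀` and `q₁` nearly share the direction of `T₁` and span a
three-space. For two planes, let `s` be the smallest deviation of a common unit vector from both
(`commonDev`). The notion of a chain is symmetric under reversal, which exchanges the pairs `q₀, q₂`
and `q₁, q₃`. Hence at least half of the chains `q₀ – … – q₃` satisfy `s(q₀, q₂) ≤ s(q₁, q₃)`
(`exists_start_many_chains`). For these, with `s = s(q₁, q₃)`:

* the direction of `T₄` lies in a box of dimensions `α × (αβ + θ) × s`: it stays within `αβ + θ` of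
  the plane of `q₁` (`ChainData.dev_last_le`), and the smallness of `s` for both pairs of alternate
  planes forces it to stay within `s` of the three-space (`ChainData.abs_inner_last_le`);
* given `T₄` and `q₃`, the cube of `q₂` lies near the planes of `q₁` and `q₃`, which meet in a
  rectangle of dimensions `θ / (αβ + θ)` and `θ / (s + θ)` (`card_cubes_two_planes_le`);
* given the cubes of `q₁, q₂, q₃`, which are well separated by the two-ends condition, there are
  boundedly many choices of `T₂` and of `T₃`, up to the separation (`card_tubes_two_cubes_le`).

The number of directions is thus proportional to `(αβ + θ) (s + θ)` and the number of cubes to its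
inverse, so that the geometric parameters cancel (`card_chains_le`). Comparison with the lower bound
`(E / N)² (E / |𝒬|)³` for the number of continuations is `incidence_inequality`, and
`volume_shadedSet_bound` expresses it through the densities. The argument loses a factor `B` at
most, and it does not use robust transversality; the factor `C₂ ^ (-2 / ε₂)` of the third estimate
is bounded because finitely many caps cover the sphere (`exists_le_of_robustlyTransverse`).
-/

noncomputable section

namespace Planebrush

open scoped InnerProductSpace

/-! ### Pairs of planes -/

/-- The distance from the vector `x` to the subspace `P`. -/
def dev (P : Submodule ℝ E4) (x : E4) : ℝ := ‖x - P.starProjection x‖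

/-- The distance between two subspaces: the operator norm of the difference of the orthogonal
projections. -/
def planeDist (P Q : Submodule ℝ E4) : ℝ := ‖P.starProjection - Q.starProjection‖

lemma dev_nonneg (P : Submodule ℝ E4) (x : E4) : 0 ≤ dev P x := norm_nonneg _

lemma dev_add_le (P : Submodule ℝ E4) (x y : E4) : dev P (x + y) ≤ dev P x + dev P y := by
  unfold dev
  rw [map_add, show x + y - (P.starProjection x + P.starProjection y)
    = (x - P.starProjection x) + (y - P.starProjection y) by abel]
  exact norm_add_le _ _

lemma dev_smul (P : Submodule ℝ E4) (a : ℝ) (x : E4) : dev P (a • x) = |a| * dev P x := by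
  unfold dev
  rw [map_smul, ← smul_sub, norm_smul, Real.norm_eq_abs]

lemma dev_neg (P : Submodule ℝ E4) (x : E4) : dev P (-x) = dev P x := by
  have := dev_smul P (-1) x
  simpa using this

lemma dev_of_mem {P : Submodule ℝ E4} {x : E4} (hx : x ∈ P) : dev P x = 0 := by
  simp [dev, Submodule.starProjection_eq_self_iff.2 hx]

lemma inner_sub_starProjection {P : Submodule ℝ E4} {x y : E4} (hy : y ∈ P) :
    ⟪y, x - P.starProjection x⟫_ℝ = 0 :=
  (Submodule.mem_orthogonal P _).1 (P.sub_starProjection_mem_orthogonal x) y hy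

lemma sq_norm_eq (P : Submodule ℝ E4) (x : E4) :
    ‖x‖ ^ 2 = ‖P.starProjection x‖ ^ 2 + dev P x ^ 2 := by
  have h := inner_sub_starProjection (x := x) (P.starProjection_apply_mem x)
  have h2 := norm_add_sq_real (P.starProjection x) (x - P.starProjection x)
  rw [h, add_sub_cancel] at h2
  rw [h2, dev]; ring

lemma norm_starProjection_le (P : Submodule ℝ E4) (x : E4) : ‖P.starProjection x‖ ≤ ‖x‖ := by
  have := sq_norm_eq P x
  exact abs_le_of_sq_le_sq' (by nlinarith [sq_nonneg (dev P x)]) (norm_nonneg _) |>.2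

lemma dev_le_norm (P : Submodule ℝ E4) (x : E4) : dev P x ≤ ‖x‖ := by
  have := sq_norm_eq P x
  exact abs_le_of_sq_le_sq' (by nlinarith [sq_nonneg ‖P.starProjection x‖]) (norm_nonneg _) |>.2

lemma dev_le_add (P : Submodule ℝ E4) (x y : E4) : dev P x ≤ dev P y + ‖x - y‖ := by
  have h := dev_add_le P y (x - y)
  rw [add_sub_cancel] at h
  linarith [dev_le_norm P (x - y)]

lemma dev_le_norm_sub {P : Submodule ℝ E4} {y : E4} (hy : y ∈ P) (x : E4) :
    dev P x ≤ ‖x - y‖ := by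
  have := dev_le_add P x y
  rwa [dev_of_mem hy, zero_add] at this

lemma abs_inner_le_dev {P : Submodule ℝ E4} {ν : E4} (hν : ν ∈ Pᗮ) (h1 : ‖ν‖ = 1) (x : E4) :
    |⟪ν, x⟫_ℝ| ≤ dev P x := by
  have h : ⟪ν, x⟫_ℝ = ⟪ν, x - P.starProjection x⟫_ℝ := by
    rw [inner_sub_right, (Submodule.mem_orthogonal' P _).1 hν _ (P.starProjection_apply_mem x),
      sub_zero]
  rw [h]
  have := abs_real_inner_le_norm ν (x - P.starProjection x)
  rwa [h1, one_mul] at this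

lemma planeDist_comm (P Q : Submodule ℝ E4) : planeDist P Q = planeDist Q P := norm_sub_rev _ _

lemma planeDist_nonneg (P Q : Submodule ℝ E4) : 0 ≤ planeDist P Q := norm_nonneg _

lemma planeDist_triangle (P Q R : Submodule ℝ E4) :
    planeDist P R ≤ planeDist P Q + planeDist Q R := norm_sub_le_norm_sub_add_norm_sub _ _ _

lemma planeDist_le_two (P Q : Submodule ℝ E4) : planeDist P Q ≤ 2 := by
  refine ContinuousLinearMap.opNorm_le_bound _ (by norm_num) fun x => ?_
  have h := norm_sub_le (P.starProjection x) (Q.starProjection x)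
  rw [sub_apply]
  linarith [norm_starProjection_le P x, norm_starProjection_le Q x]

lemma dev_le_planeDist {P : Submodule ℝ E4} (Q : Submodule ℝ E4) {x : E4} (hx : x ∈ P) :
    dev Q x ≤ planeDist P Q * ‖x‖ := by
  have h : x - Q.starProjection x = (P.starProjection - Q.starProjection) x := by
    rw [sub_apply, Submodule.starProjection_eq_self_iff.2 hx]
  rw [dev, h]
  exact ContinuousLinearMap.le_opNorm _ _

/-- In a plane there is a unit vector orthogonal to any given vector. -/
lemma exists_unit_orthogonal {P : Submodule ℝ E4} (hP : Module.finrank ℝ P = 2) (w : E4) :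
    ∃ f ∈ P, ‖f‖ = 1 ∧ ⟪w, f⟫_ℝ = 0 := by
  let φ : P →ₗ[ℝ] ℝ := (innerₛₗ ℝ w).comp P.subtype
  have hlt : Module.finrank ℝ ℝ < Module.finrank ℝ P := by rw [hP]; simp
  obtain ⟨x, hx, hx0⟩ :=
    (Submodule.ne_bot_iff _).1 (LinearMap.ker_ne_bot_of_finrank_lt (f := φ) hlt)
  have hxφ : ⟪w, (x : E4)⟫_ℝ = 0 := by simpa [φ] using hx
  have hn : ‖(x : E4)‖ ≠ 0 := by simpa using hx0
  refine ⟨‖(x : E4)‖⁻¹ • (x : E4), P.smul_mem _ x.2, ?_, ?_⟩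
  · rw [norm_smul, norm_inv, norm_norm, inv_mul_cancel₀ hn]
  · rw [inner_smul_right, hxφ, mul_zero]

/-- A unit vector `e` of a plane is completed to an orthonormal frame `e, f`. -/
lemma exists_frame {P : Submodule ℝ E4} (hP : Module.finrank ℝ P = 2) {e : E4} (he : e ∈ P)
    (h1 : ‖e‖ = 1) : ∃ f ∈ P, ‖f‖ = 1 ∧ ⟪e, f⟫_ℝ = 0 ∧
      ∀ x ∈ P, x = ⟪e, x⟫_ℝ • e + ⟪f, x⟫_ℝ • f := by
  obtain ⟨f, hf, hf1, hef⟩ := exists_unit_orthogonal hP e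
  refine ⟨f, hf, hf1, hef, fun x hx => ?_⟩
  let v : Fin 2 → P := ![⟨e, he⟩, ⟨f, hf⟩]
  have hv : Orthonormal ℝ v := by
    rw [orthonormal_iff_ite]
    intro i j
    fin_cases i <;> fin_cases j <;>
      simp [v, h1, hf1, hef, real_inner_comm]
  let b := (basisOfOrthonormalOfCardEqFinrank hv (by simp [hP]))
  have hb : (b : Fin 2 → P) = v := coe_basisOfOrthonormalOfCardEqFinrank hv (by simp [hP])
  let B := b.toOrthonormalBasis (by rw [hb]; exact hv)
  have hB : ∀ i, B i = v i := fun i => by simp [B, hb]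
  have h := B.sum_repr' ⟨x, hx⟩
  rw [Fin.sum_univ_two, hB, hB] at h
  have h' := congrArg (Subtype.val) h
  simpa [v] using h'.symm

lemma frame_sq {e f x : E4} (he : ‖e‖ = 1) (hf : ‖f‖ = 1) (hef : ⟪e, f⟫_ℝ = 0)
    (hx : x = ⟪e, x⟫_ℝ • e + ⟪f, x⟫_ℝ • f) : ‖x‖ ^ 2 = ⟪e, x⟫_ℝ ^ 2 + ⟪f, x⟫_ℝ ^ 2 := by
  have h := norm_add_sq_real (⟪e, x⟫_ℝ • e) (⟪f, x⟫_ℝ • f)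
  rw [← hx, norm_smul, norm_smul, he, hf, inner_smul_left, inner_smul_right, hef] at h
  simpa [sq_abs] using h

lemma exists_unit_near {P : Submodule ℝ E4} (hP : Module.finrank ℝ P = 2) {t : E4} {δ : ℝ}
    (ht : ‖t‖ = 1) (hδ : dev P t ≤ δ) : ∃ e ∈ P, ‖e‖ = 1 ∧ ‖t - e‖ ≤ 2 * δ := by
  by_cases h0 : P.starProjection t = 0
  · obtain ⟨e, he, he1, -⟩ := exists_unit_orthogonal hP 0
    refine ⟨e, he, he1, ?_⟩
    have : (1 : ℝ) ≤ δ := by rw [← ht]; simpa [dev, h0] using hδ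
    linarith [norm_sub_le t e]
  · have hn : ‖P.starProjection t‖ ≠ 0 := by simpa using h0
    set p := P.starProjection t with hp
    refine ⟨‖p‖⁻¹ • p, P.smul_mem _ (P.starProjection_apply_mem t), ?_, ?_⟩
    · rw [norm_smul, norm_inv, norm_norm, inv_mul_cancel₀ hn]
    · have h1 : ‖p‖ ≤ 1 := ht ▸ norm_starProjection_le P t
      have h2 : 1 - ‖p‖ ≤ δ := by
        have := norm_sub_norm_le t p
        rw [ht] at this
        exact this.trans hδ
      have h3 : ‖p - ‖p‖⁻¹ • p‖ = 1 - ‖p‖ := by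
        have : p - ‖p‖⁻¹ • p = (1 - ‖p‖⁻¹) • p := by rw [sub_smul, one_smul]
        rw [this, norm_smul, Real.norm_eq_abs]
        have hpos : 0 < ‖p‖ := lt_of_le_of_ne (norm_nonneg _) (Ne.symm hn)
        have : 1 ≤ ‖p‖⁻¹ := (one_le_inv₀ hpos).2 h1
        rw [abs_of_nonpos (by linarith)]
        field_simp
        ring
      have h4 : ‖t - p‖ ≤ δ := hδ
      calc ‖t - ‖p‖⁻¹ • p‖ ≤ ‖t - p‖ + ‖p - ‖p‖⁻¹ • p‖ := norm_sub_le_norm_sub_add_norm_sub _ _ _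
        _ ≤ 2 * δ := by rw [h3]; linarith

lemma finrank_orthogonal_eq_two {P : Submodule ℝ E4} (hP : Module.finrank ℝ P = 2) :
    Module.finrank ℝ Pᗮ = 2 := by
  have h := Submodule.finrank_add_finrank_orthogonal P
  rw [hP, finrank_euclideanSpace_fin] at h
  omega

/-- One-sided closeness of two planes controls the distance of the projections, because the
projection of one plane to the other is then onto. -/
lemma planeDist_le {P Q : Submodule ℝ E4} (hP : Module.finrank ℝ P = 2)
    (hQ : Module.finrank ℝ Q = 2) {η : ℝ} (h : ∀ x ∈ P, dev Q x ≤ η * ‖x‖) :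
    planeDist P Q ≤ 4 * η := by
  obtain ⟨e, heP, he1, -⟩ := exists_unit_orthogonal hP 0
  have hη : 0 ≤ η := by
    have := h e heP
    rw [he1, mul_one] at this
    exact (dev_nonneg _ _).trans this
  by_cases hη2 : 1 / 2 ≤ η
  · linarith [planeDist_le_two P Q]
  push Not at hη2
  let φ : P →ₗ[ℝ] Q := (Q.orthogonalProjectionOnto : E4 →ₗ[ℝ] Q).comp P.subtype
  have hφ : ∀ x : P, ((φ x : Q) : E4) = Q.starProjection x := fun x => rfl
  have hinj : Function.Injective φ := by
    rw [← LinearMap.ker_eq_bot, Submodule.eq_bot_iff]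
    intro x hx
    have h0 : Q.starProjection (x : E4) = 0 := by
      rw [← hφ, LinearMap.mem_ker.1 hx]; rfl
    have h1 := h x x.2
    rw [dev, h0, sub_zero] at h1
    have : ‖(x : E4)‖ = 0 := by nlinarith [norm_nonneg (x : E4)]
    simpa using this
  have hsurj : Function.Surjective φ :=
    (LinearMap.injective_iff_surjective_of_finrank_eq_finrank (by rw [hP, hQ])).1 hinj
  have hback : ∀ z ∈ Q, dev P z ≤ 2 * η * ‖z‖ := by
    intro z hz
    obtain ⟨x, hx⟩ := hsurj ⟨z, hz⟩
    have hxz : Q.starProjection (x : E4) = z := by rw [← hφ, hx]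
    have h1 := h x x.2
    rw [dev, hxz] at h1
    have h2 : ‖(x : E4)‖ ≤ ‖z‖ + ‖(x : E4) - z‖ := by
      have := norm_add_le z ((x : E4) - z); rwa [add_sub_cancel] at this
    have h3 := dev_le_norm_sub x.2 z
    rw [norm_sub_rev] at h3
    have : ‖(x : E4)‖ ≤ 2 * ‖z‖ := by nlinarith [norm_nonneg (x : E4)]
    nlinarith
  refine ContinuousLinearMap.opNorm_le_bound _ (by positivity) fun w => ?_
  rw [sub_apply]
  set u := w - Q.starProjection w with hu
  have hdec : P.starProjection w - Q.starProjection w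
      = P.starProjection u - (Q.starProjection w - P.starProjection (Q.starProjection w)) := by
    rw [hu, map_sub]; abel
  have h1 : ‖Q.starProjection w - P.starProjection (Q.starProjection w)‖ ≤ 2 * η * ‖w‖ := by
    have := hback _ (Q.starProjection_apply_mem w)
    refine this.trans ?_
    gcongr
    exact norm_starProjection_le Q w
  have h2 : ‖P.starProjection u‖ ≤ η * ‖w‖ := by
    set p := P.starProjection u with hp
    have hpu : ‖p‖ ^ 2 = ⟪p, u⟫_ℝ := by
      have := inner_sub_starProjection (x := u) (P.starProjection_apply_mem u)
      rw [inner_sub_right, ← hp, real_inner_self_eq_norm_sq] at this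
      linarith
    have hqu : ⟪Q.starProjection p, u⟫_ℝ = 0 :=
      inner_sub_starProjection (x := w) (Q.starProjection_apply_mem p)
    have h3 : ‖p‖ ^ 2 ≤ (η * ‖p‖) * ‖u‖ := by
      rw [hpu, show ⟪p, u⟫_ℝ = ⟪p - Q.starProjection p, u⟫_ℝ by rw [inner_sub_left, hqu, sub_zero]]
      refine (real_inner_le_norm _ _).trans ?_
      gcongr
      exact h p (P.starProjection_apply_mem u)
    have h4 : ‖u‖ ≤ ‖w‖ := dev_le_norm Q w
    by_cases hp0 : ‖p‖ = 0
    · rw [hp0]; positivity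
    · have hpos : 0 < ‖p‖ := lt_of_le_of_ne (norm_nonneg _) (Ne.symm hp0)
      have : ‖p‖ ≤ η * ‖u‖ := by
        by_contra hcon
        push Not at hcon
        nlinarith
      exact this.trans (by gcongr)
  rw [hdec]
  refine (norm_sub_le _ _).trans ?_
  nlinarith [norm_nonneg w]

/-- If two planes share the direction `e₁` up to `η`, then a direction `e₂` of the second plane
that is transverse to `e₁` leaves the first plane at a rate given by the distance of the planes. -/
lemma transverse_dev {P Q : Submodule ℝ E4} (hP : Module.finrank ℝ P = 2)
    (hQ : Module.finrank ℝ Q = 2) {e₁ e₂ : E4} (h1 : e₁ ∈ Q) (n1 : ‖e₁‖ = 1) (h2 : e₂ ∈ Q)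
    (n2 : ‖e₂‖ = 1) {m η : ℝ} (hm0 : 0 ≤ m) (hm : m ≤ ‖e₁ - e₂‖) (hm' : m ≤ ‖e₁ + e₂‖)
    (hη : dev P e₁ ≤ η) : m * planeDist P Q ≤ 8 * dev P e₂ + 16 * η := by
  obtain ⟨f, hf, nf, hef, hexp⟩ := exists_frame hQ h1 n1
  have hη0 : 0 ≤ η := (dev_nonneg _ _).trans hη
  have hd : planeDist P Q ≤ 4 * (η + dev P f) := by
    rw [planeDist_comm]
    refine planeDist_le hQ hP fun x hx => ?_
    have hsq := frame_sq n1 nf hef (hexp x hx)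
    have ha : |⟪e₁, x⟫_ℝ| ≤ ‖x‖ := by
      have := abs_real_inner_le_norm e₁ x; rwa [n1, one_mul] at this
    have hb : |⟪f, x⟫_ℝ| ≤ ‖x‖ := by
      have := abs_real_inner_le_norm f x; rwa [nf, one_mul] at this
    have h3 := dev_add_le P (⟪e₁, x⟫_ℝ • e₁) (⟪f, x⟫_ℝ • f)
    rw [← hexp x hx, dev_smul, dev_smul] at h3
    nlinarith [dev_nonneg P f, dev_nonneg P e₁, norm_nonneg x, abs_nonneg ⟪e₁, x⟫_ℝ]
  have hx := hexp e₂ h2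
  have hsq := frame_sq n1 nf hef hx
  set a := ⟪e₁, e₂⟫_ℝ with ha
  set b := ⟪f, e₂⟫_ℝ with hb
  rw [n2] at hsq
  have hs1 := norm_sub_sq_real e₁ e₂
  have hs2 := norm_add_sq_real e₁ e₂
  rw [n1, n2, ← ha] at hs1 hs2
  have hm1 : m ^ 2 ≤ ‖e₁ - e₂‖ ^ 2 := by gcongr
  have hm2 : m ^ 2 ≤ ‖e₁ + e₂‖ ^ 2 := by gcongr
  have ha1 : |a| ≤ 1 := by
    rw [ha]; have := abs_real_inner_le_norm e₁ e₂; rwa [n1, n2, one_mul] at this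
  have hma : m ^ 2 ≤ 2 - 2 * |a| := by
    rcases abs_cases a with ⟨h, _⟩ | ⟨h, _⟩ <;> rw [h] <;> nlinarith
  have hm2' : m ≤ 2 := by nlinarith [abs_nonneg a]
  have hbm : m / 2 ≤ |b| := by
    refine abs_le_of_sq_le_sq' ?_ (abs_nonneg b) |>.2
    rw [sq_abs]
    nlinarith [sq_abs a, abs_nonneg a]
  have h4 : dev P (b • f) ≤ dev P e₂ + dev P ((-a) • e₁) := by
    have := dev_add_le P e₂ ((-a) • e₁)
    rwa [show e₂ + (-a) • e₁ = b • f by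
      have : e₂ = a • e₁ + b • f := hx
      rw [neg_smul]; nth_rewrite 1 [this]; abel] at this
  rw [dev_smul, dev_smul, abs_neg] at h4
  have h5 : |a| * dev P e₁ ≤ 1 * η := mul_le_mul ha1 hη (dev_nonneg _ _) (by norm_num)
  have h6 : m / 2 * dev P f ≤ |b| * dev P f := mul_le_mul_of_nonneg_right hbm (dev_nonneg _ _)
  have h7 : m * planeDist P Q ≤ m * (4 * (η + dev P f)) := mul_le_mul_of_nonneg_left hd hm0
  nlinarith

/-- The common deviation of two subspaces: the least `s` for which some unit vector is within `s` of
both. For two planes in general position it is the size of the smaller principal angle, and it is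
symmetric in the two planes. -/
def commonDev (P Q : Submodule ℝ E4) : ℝ :=
  sInf ((fun y => max (dev P y) (dev Q y)) '' Metric.sphere (0 : E4) 1)

lemma commonDev_comm (P Q : Submodule ℝ E4) : commonDev P Q = commonDev Q P := by
  simp only [commonDev, max_comm]

lemma commonDev_bddBelow (P Q : Submodule ℝ E4) :
    BddBelow ((fun y => max (dev P y) (dev Q y)) '' Metric.sphere (0 : E4) 1) :=
  ⟨0, by rintro _ ⟨y, -, rfl⟩; exact le_max_of_le_left (dev_nonneg _ _)⟩

lemma exists_unit_E4 : ∃ y : E4, ‖y‖ = 1 := ⟨EuclideanSpace.single 0 1, by simp⟩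

lemma commonDev_le {P Q : Submodule ℝ E4} {y : E4} (hy : ‖y‖ = 1) :
    commonDev P Q ≤ max (dev P y) (dev Q y) :=
  csInf_le (commonDev_bddBelow P Q) ⟨y, by simpa using hy, rfl⟩

lemma commonDev_nonneg (P Q : Submodule ℝ E4) : 0 ≤ commonDev P Q := by
  refine Real.sInf_nonneg ?_
  rintro _ ⟨y, -, rfl⟩
  exact le_max_of_le_left (dev_nonneg _ _)

lemma commonDev_le_one (P Q : Submodule ℝ E4) : commonDev P Q ≤ 1 := by
  obtain ⟨y, hy⟩ := exists_unit_E4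
  exact (commonDev_le hy).trans (max_le (hy ▸ dev_le_norm P y) (hy ▸ dev_le_norm Q y))

lemma exists_dev_lt {P Q : Submodule ℝ E4} {s : ℝ} (hs : commonDev P Q < s) :
    ∃ y : E4, ‖y‖ = 1 ∧ dev P y < s ∧ dev Q y < s := by
  obtain ⟨y0, hy0⟩ := exists_unit_E4
  obtain ⟨_, ⟨y, hy, rfl⟩, h⟩ := exists_lt_of_csInf_lt
    (Set.Nonempty.image _ ⟨y0, by simpa using hy0⟩) hs
  exact ⟨y, by simpa using hy, (le_max_left _ _).trans_lt h, (le_max_right _ _).trans_lt h⟩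

lemma norm_mul_commonDev_le (P Q : Submodule ℝ E4) (w : E4) :
    ‖w‖ * commonDev P Q ≤ max (dev P w) (dev Q w) := by
  by_cases h0 : ‖w‖ = 0
  · rw [h0, zero_mul]; exact le_max_of_le_left (dev_nonneg _ _)
  have hpos : 0 < ‖w‖ := lt_of_le_of_ne (norm_nonneg _) (Ne.symm h0)
  have h := commonDev_le (P := P) (Q := Q) (y := ‖w‖⁻¹ • w)
    (by rw [norm_smul, norm_inv, norm_norm, inv_mul_cancel₀ h0])
  rw [dev_smul, dev_smul, abs_of_nonneg (by positivity),
    ← mul_max_of_nonneg _ _ (by positivity)] at h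
  calc ‖w‖ * commonDev P Q ≤ ‖w‖ * (‖w‖⁻¹ * max (dev P w) (dev Q w)) := by gcongr
    _ = _ := by rw [← mul_assoc, mul_inv_cancel₀ h0, one_mul]

/-! ### Four planes along a chain of three lines -/

/-- A functional `ν` that is small on one vector `e` of an orthonormal frame `e, f` of `P`, and on a
vector `y` close to both `P` and `Q`, is small on `f`, provided that `e` leaves `Q` at rate `g β`
while all of `P` stays within `2 β` of `Q`. -/
lemma inner_frame_le {P Q : Submodule ℝ E4} {ν e f y : E4} (he : ‖e‖ = 1) (hf : ‖f‖ = 1)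
    (hef : ⟪e, f⟫_ℝ = 0) (hexp : ∀ x ∈ P, x = ⟪e, x⟫_ℝ • e + ⟪f, x⟫_ℝ • f) (hν : ‖ν‖ = 1)
    (hy : ‖y‖ = 1) {s w h g β A : ℝ} (hs : 0 < s) (hw : 0 ≤ w) (hA : 0 ≤ A) (hg : 0 < g)
    (hg1 : g ≤ 1) (hyP : dev P y ≤ s) (hyQ : dev Q y ≤ s)
    (hνy : |⟪ν, y⟫_ℝ| ≤ w) (hνe : |⟪ν, e⟫_ℝ| ≤ h) (hfQ : dev Q f ≤ 2 * β)
    (hνf : |⟪ν, f⟫_ℝ| ≤ 2 * β) (hlow : g * β ≤ dev Q e + A * s) :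
    g * |⟪ν, f⟫_ℝ| ≤ 16 * (w + s + h) + 4 * (4 + A) * s := by
  have hh : 0 ≤ h := (abs_nonneg _).trans hνe
  have hAs : 0 ≤ A * s := by positivity
  have hνf1 : |⟪ν, f⟫_ℝ| ≤ 1 := by
    have := abs_real_inner_le_norm ν f; rwa [hν, hf, one_mul] at this
  set p := P.starProjection y with hp
  have hx := hexp p (P.starProjection_apply_mem y)
  have hsq := frame_sq he hf hef hx
  set a := ⟪e, p⟫_ℝ with ha
  set b := ⟪f, p⟫_ℝ with hb
  have hp1 : ‖p‖ ≤ 1 := hy ▸ norm_starProjection_le P y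
  have hyp : ‖y - p‖ ≤ s := hyP
  have ha1 : |a| ≤ 1 := by
    refine abs_le_of_sq_le_sq' ?_ zero_le_one |>.2
    rw [sq_abs]; nlinarith [norm_nonneg p, sq_nonneg b]
  -- either `y` has a component along `f`, or it is close to `e`, and then `g * β` is at most
  -- about `s`
  by_cases hcase : g / 16 ≤ |b|
  · have h1 : b * ⟪ν, f⟫_ℝ = ⟪ν, y⟫_ℝ - ⟪ν, y - p⟫_ℝ - a * ⟪ν, e⟫_ℝ := by
      have h2 : ⟪ν, p⟫_ℝ = a * ⟪ν, e⟫_ℝ + b * ⟪ν, f⟫_ℝ := by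
        nth_rewrite 1 [hx]
        rw [inner_add_right, inner_smul_right, inner_smul_right]
      rw [inner_sub_right, h2]; ring
    have h3 : |⟪ν, y - p⟫_ℝ| ≤ s := by
      have := abs_real_inner_le_norm ν (y - p); rw [hν, one_mul] at this; exact this.trans hyp
    have h4 : |a * ⟪ν, e⟫_ℝ| ≤ h := by
      rw [abs_mul]; nlinarith [abs_nonneg a, abs_nonneg ⟪ν, e⟫_ℝ]
    have h5 : |b| * |⟪ν, f⟫_ℝ| ≤ w + s + h := by
      rw [← abs_mul, h1]
      have := abs_sub (⟪ν, y⟫_ℝ - ⟪ν, y - p⟫_ℝ) (a * ⟪ν, e⟫_ℝ)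
      have := abs_sub (⟪ν, y⟫_ℝ) (⟪ν, y - p⟫_ℝ)
      linarith
    have h6 : g / 16 * |⟪ν, f⟫_ℝ| ≤ |b| * |⟪ν, f⟫_ℝ| := by gcongr
    linarith
  · push Not at hcase
    have hgs : g * |⟪ν, f⟫_ℝ| ≤ 4 * (4 + A) * s := by
      by_cases hs4 : 1 / 4 ≤ s
      · have : g * |⟪ν, f⟫_ℝ| ≤ 1 * 1 := by gcongr
        nlinarith
      push Not at hs4
      have hp34 : 3 / 4 ≤ ‖p‖ := by
        have := norm_sub_norm_le y p; rw [hy] at this; linarith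
      have ha2 : 1 / 2 ≤ |a| := by
        refine abs_le_of_sq_le_sq' ?_ (abs_nonneg a) |>.2
        rw [sq_abs]
        have : b ^ 2 ≤ (1 / 16) ^ 2 := by
          rw [← sq_abs]; gcongr; linarith
        nlinarith
      have h1 : dev Q (a • e) ≤ dev Q p + dev Q ((-b) • f) := by
        have := dev_add_le Q p ((-b) • f)
        rwa [show p + (-b) • f = a • e by
          rw [neg_smul]; nth_rewrite 1 [hx]; abel] at this
      rw [dev_smul, dev_smul, abs_neg] at h1
      have h2 : dev Q p ≤ 2 * s := by
        have := dev_le_add Q p y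
        rw [norm_sub_rev] at this; linarith
      have h3 : |b| * dev Q f ≤ g / 16 * (2 * β) :=
        mul_le_mul hcase.le hfQ (dev_nonneg _ _) (by positivity)
      have h4 : 1 / 2 * dev Q e ≤ |a| * dev Q e :=
        mul_le_mul_of_nonneg_right ha2 (dev_nonneg _ _)
      have h5 : g * |⟪ν, f⟫_ℝ| ≤ g * (2 * β) := by gcongr
      linarith
    linarith

/-- The transversality lower bound `c² α β ≲ dev P t + δ` for a chain `P, Q` of planes with
consecutive lines `t₁ ⊂ P ∩ Q` and `t₂ ⊂ Q`. -/
lemma chain_transverse {P Q : Submodule ℝ E4} (hP : Module.finrank ℝ P = 2)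
    (hQ : Module.finrank ℝ Q = 2) {t₁ t₂ : E4} (n1 : ‖t₁‖ = 1) (n2 : ‖t₂‖ = 1)
    {δ α β c : ℝ} (hδ : 0 < δ) (hc : 0 < c) (hcα : c * α ≤ 1)
    (h1P : dev P t₁ ≤ δ) (h1Q : dev Q t₁ ≤ δ) (h2Q : dev Q t₂ ≤ δ)
    (hPQ : c * β ≤ planeDist P Q + δ) (hα0 : 0 < α)
    (hm : c * α ≤ ‖t₁ - t₂‖ + δ) (hm' : c * α ≤ ‖t₁ + t₂‖ + δ) :
    c ^ 2 * α * β ≤ 8 * dev P t₂ + 91 * δ := by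
  obtain ⟨e₁, m1, l1, d1⟩ := exists_unit_near hQ n1 h1Q
  obtain ⟨e₂, m2, l2, d2⟩ := exists_unit_near hQ n2 h2Q
  set m := max 0 (c * α - 5 * δ) with hmdef
  have hA : ‖t₁ - t₂‖ ≤ ‖e₁ - e₂‖ + 4 * δ := by
    have h := norm_add₃_le (a := t₁ - e₁) (b := e₁ - e₂) (c := e₂ - t₂)
    rw [show t₁ - e₁ + (e₁ - e₂) + (e₂ - t₂) = t₁ - t₂ by abel, norm_sub_rev e₂ t₂] at h
    linarith
  have hB : ‖t₁ + t₂‖ ≤ ‖e₁ + e₂‖ + 4 * δ := by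
    have h := norm_add₃_le (a := t₁ - e₁) (b := e₁ + e₂) (c := t₂ - e₂)
    rw [show t₁ - e₁ + (e₁ + e₂) + (t₂ - e₂) = t₁ + t₂ by abel] at h
    linarith
  have h := transverse_dev hP hQ m1 l1 m2 l2 (m := m) (η := 3 * δ) (le_max_left _ _)
    (max_le (norm_nonneg _) (by linarith)) (max_le (norm_nonneg _) (by linarith)) (by
      have := dev_le_add P e₁ t₁; rw [norm_sub_rev] at this; linarith)
  have h2 : dev P e₂ ≤ dev P t₂ + 2 * δ := by
    have := dev_le_add P e₂ t₂; rw [norm_sub_rev] at this; linarith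
  have h3 : (c * α - 5 * δ) * planeDist P Q ≤ m * planeDist P Q :=
    mul_le_mul_of_nonneg_right (le_max_right _ _) (planeDist_nonneg _ _)
  have h4 : c ^ 2 * α * β ≤ c * α * (planeDist P Q + δ) := by
    have : c ^ 2 * α * β = c * α * (c * β) := by ring
    rw [this]; gcongr
  nlinarith [planeDist_le_two P Q, planeDist_nonneg P Q]

/-- The data of a chain of four planes `P i` and three lines `t₁, t₂, t₃` with `tᵢ` in
`P (i - 1) ∩ P i` up to `δ`, together with a fourth line `t₄` in the last plane. Consecutive planes
are at distance about `β` and consecutive lines at angle about `α`, up to the factor `c`; the two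
pairs of alternate planes have common deviation less than `s`. -/
structure ChainData (P₀ P₁ P₂ P₃ : Submodule ℝ E4) (t₁ t₂ t₃ t₄ : E4) (δ α β c s : ℝ) : Prop where
  r0 : Module.finrank ℝ P₀ = 2
  r1 : Module.finrank ℝ P₁ = 2
  r2 : Module.finrank ℝ P₂ = 2
  r3 : Module.finrank ℝ P₃ = 2
  n1 : ‖t₁‖ = 1
  n2 : ‖t₂‖ = 1
  n3 : ‖t₃‖ = 1
  n4 : ‖t₄‖ = 1
  δpos : 0 < δ
  δα : δ ≤ α
  δβ : δ ≤ β
  δs : δ ≤ s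
  cpos : 0 < c
  cle : c ≤ 1
  cα : c * α ≤ 1
  d01 : planeDist P₀ P₁ ≤ β
  d12 : planeDist P₁ P₂ ≤ β
  d23 : planeDist P₂ P₃ ≤ β
  l01 : c * β ≤ planeDist P₀ P₁ + δ
  l12 : c * β ≤ planeDist P₁ P₂ + δ
  a12 : ‖t₁ - t₂‖ ≤ α
  a23 : ‖t₂ - t₃‖ ≤ α
  a34 : ‖t₃ - t₄‖ ≤ α
  m12 : c * α ≤ ‖t₁ - t₂‖ + δ
  p12 : c * α ≤ ‖t₁ + t₂‖ + δ
  m23 : c * α ≤ ‖t₂ - t₃‖ + δ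
  p23 : c * α ≤ ‖t₂ + t₃‖ + δ
  i10 : dev P₀ t₁ ≤ δ
  i11 : dev P₁ t₁ ≤ δ
  i21 : dev P₁ t₂ ≤ δ
  i22 : dev P₂ t₂ ≤ δ
  i32 : dev P₂ t₃ ≤ δ
  i33 : dev P₃ t₃ ≤ δ
  i43 : dev P₃ t₄ ≤ δ
  s02 : commonDev P₀ P₂ < s
  s13 : commonDev P₁ P₃ < s

lemma coeff_frame_le {e f x : E4} (hf : ‖f‖ = 1) (hef : ⟪e, f⟫_ℝ = 0) {a : ℝ}
    (h : ‖x - e‖ ≤ a) : |⟪f, x⟫_ℝ| ≤ a := by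
  have h1 : ⟪f, x⟫_ℝ = ⟪f, x - e⟫_ℝ := by
    rw [inner_sub_right, real_inner_comm e f] at *
    rw [hef]; ring
  rw [h1]
  have := abs_real_inner_le_norm f (x - e)
  rw [hf, one_mul] at this
  exact this.trans h

/-- The deviation of a unit vector of a plane framed by `e, f`, when its second coordinate is
small. -/
lemma dev_frame_le {P Q : Submodule ℝ E4} {e f x : E4}
    (he : ‖e‖ = 1) (hexp : ∀ x ∈ P, x = ⟪e, x⟫_ℝ • e + ⟪f, x⟫_ℝ • f) (hx : x ∈ P)
    (nx : ‖x‖ = 1) {b : ℝ} (hb : |⟪f, x⟫_ℝ| ≤ b) :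
    dev Q x ≤ dev Q e + b * dev Q f := by
  have h := dev_add_le Q (⟪e, x⟫_ℝ • e) (⟪f, x⟫_ℝ • f)
  rw [← hexp x hx, dev_smul, dev_smul] at h
  have ha : |⟪e, x⟫_ℝ| ≤ 1 := by
    have := abs_real_inner_le_norm e x; rwa [he, nx, one_mul] at this
  nlinarith [dev_nonneg Q e, dev_nonneg Q f]

lemma abs_inner_frame_le {P : Submodule ℝ E4} {e f x ν : E4}
    (he : ‖e‖ = 1) (hexp : ∀ x ∈ P, x = ⟪e, x⟫_ℝ • e + ⟪f, x⟫_ℝ • f) (hx : x ∈ P)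
    (nx : ‖x‖ = 1) {b : ℝ} (hb : |⟪f, x⟫_ℝ| ≤ b) :
    |⟪ν, x⟫_ℝ| ≤ |⟪ν, e⟫_ℝ| + b * |⟪ν, f⟫_ℝ| := by
  have ha : |⟪e, x⟫_ℝ| ≤ 1 := by
    have := abs_real_inner_le_norm e x; rwa [he, nx, one_mul] at this
  have h : ⟪ν, x⟫_ℝ = ⟪e, x⟫_ℝ * ⟪ν, e⟫_ℝ + ⟪f, x⟫_ℝ * ⟪ν, f⟫_ℝ := by
    nth_rewrite 1 [hexp x hx]
    rw [inner_add_right, inner_smul_right, inner_smul_right]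
  rw [h]
  refine (abs_add_le _ _).trans ?_
  rw [abs_mul, abs_mul]
  nlinarith [abs_nonneg ⟪ν, e⟫_ℝ, abs_nonneg ⟪ν, f⟫_ℝ]

lemma abs_inner_le_add {ν x y : E4} (hν : ‖ν‖ = 1) : |⟪ν, x⟫_ℝ| ≤ |⟪ν, y⟫_ℝ| + ‖x - y‖ := by
  have h : ⟪ν, x⟫_ℝ = ⟪ν, y⟫_ℝ + ⟪ν, x - y⟫_ℝ := by rw [inner_sub_right]; ring
  rw [h]
  have := abs_real_inner_le_norm ν (x - y)
  rw [hν, one_mul] at this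
  exact (abs_add_le _ _).trans (by linarith)

namespace ChainData
variable {P₀ P₁ P₂ P₃ : Submodule ℝ E4} {t₁ t₂ t₃ t₄ : E4} {δ α β c s : ℝ}

/-- The last line stays within `α β + δ` of the second plane. -/
lemma dev_last_le (D : ChainData P₀ P₁ P₂ P₃ t₁ t₂ t₃ t₄ δ α β c s) :
    dev P₁ t₄ ≤ 9 * δ + 15 * (α * β) := by
  obtain ⟨e₂, m2, l2, d2⟩ := exists_unit_near D.r2 D.n2 D.i22
  obtain ⟨e₃', m3', l3', d3'⟩ := exists_unit_near D.r2 D.n3 D.i32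
  obtain ⟨e₃, m3, l3, d3⟩ := exists_unit_near D.r3 D.n3 D.i33
  obtain ⟨e₄, m4, l4, d4⟩ := exists_unit_near D.r3 D.n4 D.i43
  obtain ⟨f₂, mf2, lf2, o2, x2⟩ := exists_frame D.r2 m2 l2
  obtain ⟨f₃, mf3, lf3, o3, x3⟩ := exists_frame D.r3 m3 l3
  have hδα := D.δα
  have b2 : |⟪f₂, e₃'⟫_ℝ| ≤ 5 * α := coeff_frame_le lf2 o2 (by
    have h := norm_add₃_le (a := e₃' - t₃) (b := t₃ - t₂) (c := t₂ - e₂)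
    rw [show e₃' - t₃ + (t₃ - t₂) + (t₂ - e₂) = e₃' - e₂ by abel, norm_sub_rev e₃' t₃,
      norm_sub_rev t₃ t₂] at h
    linarith [D.a23])
  have b3 : |⟪f₃, e₄⟫_ℝ| ≤ 5 * α := coeff_frame_le lf3 o3 (by
    have h := norm_add₃_le (a := e₄ - t₄) (b := t₄ - t₃) (c := t₃ - e₃)
    rw [show e₄ - t₄ + (t₄ - t₃) + (t₃ - e₃) = e₄ - e₃ by abel, norm_sub_rev e₄ t₄,
      norm_sub_rev t₄ t₃] at h
    linarith [D.a34])
  have k2 := dev_frame_le (Q := P₁) l2 x2 m3' l3' b2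
  have k3 := dev_frame_le (Q := P₁) l3 x3 m4 l4 b3
  have q1 : dev P₁ e₂ ≤ 3 * δ := by
    have := dev_le_add P₁ e₂ t₂; rw [norm_sub_rev] at this; linarith [D.i21]
  have q2 : dev P₁ f₂ ≤ β := by
    have := dev_le_planeDist P₁ mf2; rw [lf2, mul_one, planeDist_comm] at this
    linarith [D.d12]
  have q3 : dev P₁ f₃ ≤ 2 * β := by
    have := dev_le_planeDist P₁ mf3; rw [lf3, mul_one, planeDist_comm] at this
    linarith [D.d12, D.d23, planeDist_triangle P₁ P₂ P₃]
  have q4 : dev P₁ e₃ ≤ dev P₁ e₃' + 4 * δ := by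
    have := dev_le_add P₁ e₃ e₃'
    have h := norm_sub_le_norm_sub_add_norm_sub e₃ t₃ e₃'
    rw [norm_sub_rev e₃ t₃] at h
    linarith
  have q5 := dev_le_add P₁ t₄ e₄
  have hα : 0 < α := D.δpos.trans_le D.δα
  nlinarith

set_option maxHeartbeats 800000 in
/-- The bound for the last line in the normal direction `ν` of the three-space spanned by the first
two planes: up to powers of `c`, it is at most the common deviation `s` of the alternate planes.
Indeed `ν` is small on `P₀` and `P₁`, hence on common directions of `P₀, P₂` and of `P₁, P₃`;
through these it is controlled first on `P₂`, which contains `t₃`, and then on `P₃`, which contains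
`t₄`. -/
lemma abs_inner_last_le (D : ChainData P₀ P₁ P₂ P₃ t₁ t₂ t₃ t₄ δ α β c s) {ν : E4}
    (hν : ‖ν‖ = 1) (hνP : ν ∈ P₁ᗮ) (hν0 : ∀ z ∈ P₀, |⟪ν, z⟫_ℝ| ≤ 3 * δ * ‖z‖) :
    c ^ 4 * |⟪ν, t₄⟫_ℝ| ≤ 10 ^ 7 * s := by
  obtain ⟨e₂, m2, l2, d2⟩ := exists_unit_near D.r2 D.n2 D.i22
  obtain ⟨e₃', m3', l3', d3'⟩ := exists_unit_near D.r2 D.n3 D.i32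
  obtain ⟨e₃, m3, l3, d3⟩ := exists_unit_near D.r3 D.n3 D.i33
  obtain ⟨e₄, m4, l4, d4⟩ := exists_unit_near D.r3 D.n4 D.i43
  obtain ⟨f₂, mf2, lf2, o2, x2⟩ := exists_frame D.r2 m2 l2
  obtain ⟨f₃, mf3, lf3, o3, x3⟩ := exists_frame D.r3 m3 l3
  obtain ⟨y, ny, y0, y2⟩ := exists_dev_lt D.s02
  obtain ⟨z, nz, z1, z3⟩ := exists_dev_lt D.s13
  have hδ := D.δpos
  have hδα := D.δα
  have hδβ := D.δβ
  have hδs := D.δs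
  have hc := D.cpos
  have hc1 := D.cle
  have hcα := D.cα
  have hα : 0 < α := hδ.trans_le hδα
  have hβ : 0 < β := hδ.trans_le hδβ
  have hs : 0 < s := hδ.trans_le hδs
  have b2 : |⟪f₂, e₃'⟫_ℝ| ≤ 5 * α := coeff_frame_le lf2 o2 (by
    have h := norm_add₃_le (a := e₃' - t₃) (b := t₃ - t₂) (c := t₂ - e₂)
    rw [show e₃' - t₃ + (t₃ - t₂) + (t₂ - e₂) = e₃' - e₂ by abel, norm_sub_rev e₃' t₃,
      norm_sub_rev t₃ t₂] at h
    linarith [D.a23])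
  have b3 : |⟪f₃, e₄⟫_ℝ| ≤ 5 * α := coeff_frame_le lf3 o3 (by
    have h := norm_add₃_le (a := e₄ - t₄) (b := t₄ - t₃) (c := t₃ - e₃)
    rw [show e₄ - t₄ + (t₄ - t₃) + (t₃ - e₃) = e₄ - e₃ by abel, norm_sub_rev e₄ t₄,
      norm_sub_rev t₄ t₃] at h
    linarith [D.a34])
  have T1 := chain_transverse D.r0 D.r1 D.n1 D.n2 hδ hc hcα D.i10 D.i11 D.i21 D.l01 hα
    D.m12 D.p12
  have T2 := chain_transverse D.r1 D.r2 D.n2 D.n3 hδ hc hcα D.i21 D.i22 D.i32 D.l12 hα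
    D.m23 D.p23
  set g := c ^ 2 * α / 8 with hg
  have hgpos : 0 < g := by positivity
  have hg1 : g ≤ 1 := by
    have : c * (c * α) ≤ 1 * 1 := by gcongr
    rw [hg]; linarith
  -- the functional `ν` on `P₂`
  have E2 : g * |⟪ν, f₂⟫_ℝ| ≤ 16 * (4 * s + s + 3 * s) + 4 * (4 + 14) * s := by
    refine inner_frame_le (P := P₂) (Q := P₀) (y := y) (β := β) l2 lf2 o2 x2 hν ny hs
      (by positivity) (by norm_num) hgpos hg1 y2.le y0.le ?_ ?_ ?_ ?_ ?_
    · have h1 := abs_inner_le_add (x := y) (y := P₀.starProjection y) hν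
      have h2 := hν0 _ (P₀.starProjection_apply_mem y)
      have h3 : ‖P₀.starProjection y‖ ≤ 1 := ny ▸ norm_starProjection_le P₀ y
      have h4 : ‖y - P₀.starProjection y‖ < s := y0
      have h5 : 3 * δ * ‖P₀.starProjection y‖ ≤ 3 * δ * 1 := by gcongr
      linarith
    · have h1 := abs_inner_le_add (x := e₂) (y := t₂) hν
      have h2 := abs_inner_le_dev hνP hν t₂
      rw [norm_sub_rev] at h1
      linarith [D.i21]
    · have := dev_le_planeDist P₀ mf2; rw [lf2, mul_one, planeDist_comm] at this
      linarith [D.d12, D.d01, planeDist_triangle P₀ P₁ P₂]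
    · have := dev_le_planeDist P₁ mf2; rw [lf2, mul_one, planeDist_comm] at this
      linarith [D.d12, abs_inner_le_dev hνP hν f₂]
    · have := dev_le_add P₀ t₂ e₂
      rw [hg]; linarith
  -- the functional `ν` on `t₃`, from the plane `P₂`
  have H3 : c ^ 2 * |⟪ν, e₃⟫_ℝ| ≤ 10000 * s := by
    have h1 := abs_inner_frame_le (ν := ν) l2 x2 m3' l3' b2
    have h2 : |⟪ν, e₂⟫_ℝ| ≤ 3 * s := by
      have h1 := abs_inner_le_add (x := e₂) (y := t₂) hν
      have h2 := abs_inner_le_dev hνP hν t₂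
      rw [norm_sub_rev] at h1
      linarith [D.i21]
    have h3 := abs_inner_le_add (x := e₃) (y := e₃') hν
    have h4 := norm_sub_le_norm_sub_add_norm_sub e₃ t₃ e₃'
    rw [norm_sub_rev e₃ t₃] at h4
    have h5 : c ^ 2 * α * |⟪ν, f₂⟫_ℝ| ≤ 1600 * s := by rw [hg] at E2; linarith
    have h6 : c ^ 2 ≤ 1 := pow_le_one₀ hc.le hc1
    have h7 : |⟪ν, e₃⟫_ℝ| ≤ 7 * s + 5 * α * |⟪ν, f₂⟫_ℝ| := by linarith
    have h8 : c ^ 2 * |⟪ν, e₃⟫_ℝ| ≤ c ^ 2 * (7 * s + 5 * α * |⟪ν, f₂⟫_ℝ|) := by gcongr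
    have h9 : c ^ 2 * (7 * s) ≤ 1 * (7 * s) := by gcongr
    linarith
  -- the functional `ν` on `P₃`
  have E3 : g * |⟪ν, f₃⟫_ℝ| ≤ 16 * (s + s + 10000 * s / c ^ 2) + 4 * (4 + 14) * s := by
    refine inner_frame_le (P := P₃) (Q := P₁) (y := z) (β := β) l3 lf3 o3 x3 hν nz hs
      hs.le (by norm_num) hgpos hg1 z3.le z1.le ?_ ?_ ?_ ?_ ?_
    · exact (abs_inner_le_dev hνP hν z).trans z1.le
    · rw [le_div_iff₀ (by positivity)]; linarith
    · have := dev_le_planeDist P₁ mf3; rw [lf3, mul_one, planeDist_comm] at this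
      linarith [D.d12, D.d23, planeDist_triangle P₁ P₂ P₃]
    · have := dev_le_planeDist P₁ mf3; rw [lf3, mul_one, planeDist_comm] at this
      linarith [D.d12, D.d23, planeDist_triangle P₁ P₂ P₃, abs_inner_le_dev hνP hν f₃]
    · have := dev_le_add P₁ t₃ e₃
      rw [hg]; linarith
  have F3 : c ^ 4 * (α * |⟪ν, f₃⟫_ℝ|) ≤ 1500000 * s := by
    have h6 : c ^ 2 ≤ 1 := pow_le_one₀ hc.le hc1
    have h1 : c ^ 2 * (g * |⟪ν, f₃⟫_ℝ|) ≤ c ^ 2 * (104 * s) + 160000 * s := by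
      have := mul_le_mul_of_nonneg_left E3 (by positivity : 0 ≤ c ^ 2)
      refine this.trans (le_of_eq ?_)
      field_simp; ring
    have h2 : c ^ 2 * (104 * s) ≤ 1 * (104 * s) := by gcongr
    rw [hg] at h1
    linarith
  have h1 := abs_inner_frame_le (ν := ν) l3 x3 m4 l4 b3
  have h2 := abs_inner_le_add (x := t₄) (y := e₄) hν
  have h3 : |⟪ν, t₄⟫_ℝ| ≤ |⟪ν, e₃⟫_ℝ| + 5 * (α * |⟪ν, f₃⟫_ℝ|) + 2 * s := by linarith
  have h6 : c ^ 2 ≤ 1 := pow_le_one₀ hc.le hc1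
  have h7 : c ^ 4 ≤ c ^ 2 := pow_le_pow_of_le_one hc.le hc1 (by norm_num)
  have h8 := mul_le_mul_of_nonneg_left h3 (by positivity : 0 ≤ c ^ 4)
  have h9 : c ^ 4 * |⟪ν, e₃⟫_ℝ| ≤ c ^ 2 * |⟪ν, e₃⟫_ℝ| := by gcongr
  have h10 : c ^ 4 * (2 * s) ≤ 1 * (2 * s) := by gcongr; linarith
  linarith

/-- The third line leaves the second plane at rate `c² α β`. -/
lemma transverse_third (D : ChainData P₀ P₁ P₂ P₃ t₁ t₂ t₃ t₄ δ α β c s) :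
    c ^ 2 * α * β ≤ 8 * dev P₁ t₃ + 91 * δ :=
  chain_transverse D.r1 D.r2 D.n2 D.n3 D.δpos D.cpos D.cα D.i21 D.i22 D.i32
    D.l12 (D.δpos.trans_le D.δα) D.m23 D.p23

end ChainData

lemma exists_orthonormalBasis {P : Submodule ℝ E4} {e f g ν : E4} (he : e ∈ P) (hf : f ∈ P)
    (hg : g ∈ Pᗮ) (hν : ν ∈ Pᗮ) (n1 : ‖e‖ = 1) (n2 : ‖f‖ = 1) (n3 : ‖g‖ = 1) (n4 : ‖ν‖ = 1)
    (o1 : ⟪e, f⟫_ℝ = 0) (o2 : ⟪g, ν⟫_ℝ = 0) :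
    ∃ b : OrthonormalBasis (Fin 4) ℝ E4, b 0 = e ∧ b 1 = f ∧ b 2 = g ∧ b 3 = ν := by
  have hz : ∀ x ∈ P, ∀ y ∈ Pᗮ, ⟪x, y⟫_ℝ = 0 := fun x hx y hy =>
    (Submodule.mem_orthogonal P y).1 hy x hx
  have hz' : ∀ x ∈ P, ∀ y ∈ Pᗮ, ⟪y, x⟫_ℝ = 0 := fun x hx y hy =>
    (Submodule.mem_orthogonal' P y).1 hy x hx
  let v : Fin 4 → E4 := ![e, f, g, ν]
  have o1' : ⟪f, e⟫_ℝ = 0 := by rw [real_inner_comm]; exact o1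
  have o2' : ⟪ν, g⟫_ℝ = 0 := by rw [real_inner_comm]; exact o2
  have hv : Orthonormal ℝ v := by
    rw [orthonormal_iff_ite]
    intro i j
    fin_cases i <;> fin_cases j <;>
      simp [v, n1, n2, n3, n4, o1, o2, o1', o2', hz _ he _ hg, hz _ he _ hν, hz _ hf _ hg,
        hz _ hf _ hν, hz' _ he _ hg, hz' _ he _ hν, hz' _ hf _ hg, hz' _ hf _ hν]
  let b := basisOfOrthonormalOfCardEqFinrank hv (by simp)
  have hb : (b : Fin 4 → E4) = v := coe_basisOfOrthonormalOfCardEqFinrank hv (by simp)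
  let B := b.toOrthonormalBasis (by rw [hb]; exact hv)
  have hB : ∀ i, B i = v i := fun i => by simp [B, hb]
  exact ⟨B, by simp [hB, v], by simp [hB, v], by simp [hB, v], by simp [hB, v]⟩

/-- An orthonormal basis adapted to two planes `P, Q` that share the direction `t` up to `δ`: the
first two vectors lie in `Q` with the first close to `t`, and the last one is normal to `Q` and
nearly normal to `P`. -/
lemma exists_adapted_basis {P Q : Submodule ℝ E4} (hP : Module.finrank ℝ P = 2)
    (hQ : Module.finrank ℝ Q = 2) {t : E4} (ht : ‖t‖ = 1) {δ : ℝ} (htP : dev P t ≤ δ)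
    (htQ : dev Q t ≤ δ) : ∃ b : OrthonormalBasis (Fin 4) ℝ E4, ‖t - b 0‖ ≤ 2 * δ ∧ b 0 ∈ Q ∧
      b 1 ∈ Q ∧ b 2 ∈ Qᗮ ∧ b 3 ∈ Qᗮ ∧ ∀ z ∈ P, |⟪b 3, z⟫_ℝ| ≤ 3 * δ * ‖z‖ := by
  obtain ⟨e', me', le', de'⟩ := exists_unit_near hP ht htP
  obtain ⟨f', mf', lf', o', x'⟩ := exists_frame hP me' le'
  obtain ⟨e, me, le, de⟩ := exists_unit_near hQ ht htQ
  obtain ⟨f, mf, lf, o, -⟩ := exists_frame hQ me le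
  have hQ' := finrank_orthogonal_eq_two hQ
  obtain ⟨ν, mν, lν, oν⟩ := exists_unit_orthogonal hQ' f'
  obtain ⟨g, mg, lg, og, -⟩ := exists_frame hQ' mν lν
  obtain ⟨b, b0, b1, b2, b3⟩ := exists_orthonormalBasis me mf mg mν le lf lg lν o
    (by rw [real_inner_comm]; exact og)
  refine ⟨b, by rw [b0]; exact de, b0 ▸ me, b1 ▸ mf, b2 ▸ mg, b3 ▸ mν, fun z hz => ?_⟩
  rw [b3]
  have h1 : ⟪ν, z⟫_ℝ = ⟪e', z⟫_ℝ * ⟪ν, e'⟫_ℝ := by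
    nth_rewrite 1 [x' z hz]
    rw [inner_add_right, inner_smul_right, inner_smul_right, real_inner_comm f' ν, oν]; ring
  have h2 : |⟪ν, e'⟫_ℝ| ≤ 3 * δ := by
    have h1 := abs_inner_le_add (x := e') (y := t) lν
    rw [norm_sub_rev] at h1
    linarith [abs_inner_le_dev mν lν t]
  have h3 : |⟪e', z⟫_ℝ| ≤ ‖z‖ := by
    have := abs_real_inner_le_norm e' z; rwa [le', one_mul] at this
  rw [h1, abs_mul, mul_comm]
  exact mul_le_mul h2 h3 (abs_nonneg _) ((abs_nonneg _).trans h2)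

/-! ### Refinement of incidences -/

section Refinement
open Classical in
/-- A ball on which a finite set is most concentrated, in the sense of maximising
`u ^ j * #(P ∩ B (x, 2⁻ʲ))`; every smaller ball then contains only a small part of it. -/
lemma exists_cluster {Ω : Type*} (P : Finset Ω) (D : Ω → Ω → ℝ) (hD1 : ∀ x y, D x y ≤ 1)
    (hDt : ∀ x y z, D y z ≤ D x y + D x z) (u : ℝ) (n : ℕ) :
    ∃ j ≤ n, ∃ Q ⊆ P, (P.card : ℝ) ≤ u ^ j * Q.card ∧
      (∀ x ∈ Q, ∀ y ∈ Q, D x y ≤ 2 * (1 / 2) ^ j) ∧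
      ∀ y ∈ P, ∀ i ≤ n, u ^ i * ((P.filter fun z => D y z ≤ (1 / 2) ^ i).card : ℝ) ≤
        u ^ j * Q.card := by
  rcases P.eq_empty_or_nonempty with rfl | hP
  · exact ⟨0, n.zero_le, ∅, by simp⟩
  let F : Ω × ℕ → ℝ := fun p => u ^ p.2 * ((P.filter fun z => D p.1 z ≤ (1 / 2) ^ p.2).card : ℝ)
  obtain ⟨⟨x, j⟩, hxj, hmax⟩ := Finset.exists_max_image (P ×ˢ Finset.range (n + 1)) F
    (hP.product ⟨0, by simp⟩)
  rw [Finset.mem_product, Finset.mem_range] at hxj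
  refine ⟨j, by omega, P.filter fun z => D x z ≤ (1 / 2) ^ j, Finset.filter_subset _ _, ?_, ?_, ?_⟩
  · have h := hmax (x, 0) (by simp [hxj.1])
    have h0 : P.filter (fun z => D x z ≤ 1) = P :=
      Finset.filter_true_of_mem fun z _ => hD1 x z
    simp only [F, pow_zero, one_mul] at h
    rwa [h0] at h
  · intro a ha b hb
    rw [Finset.mem_filter] at ha hb
    linarith [hDt x a b, ha.2, hb.2]
  · intro y hy i hi
    exact hmax (y, i) (by simp [hy]; omega)

open Classical in
/-- Each fibre of `f` is replaced by a cluster, and one radius `2⁻ʲ` is selected. -/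
lemma exists_cluster_fibers {Ω K : Type*} (I : Finset Ω) (f : Ω → K) (D : Ω → Ω → ℝ)
    (hD1 : ∀ x y, D x y ≤ 1) (hDt : ∀ x y z, D y z ≤ D x y + D x z) {u : ℝ} (hu : 1 ≤ u) (n : ℕ) :
    ∃ j ≤ n, ∃ J ⊆ I, (I.card : ℝ) ≤ (n + 1) * u ^ n * J.card ∧
      (∀ x ∈ J, ∀ y ∈ J, f x = f y → D x y ≤ 2 * (1 / 2) ^ j) ∧
      ∀ y ∈ J, ∀ i ≤ n, u ^ i * ((I.filter fun z => f z = f y ∧ D y z ≤ (1 / 2) ^ i).card : ℝ) ≤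
        u ^ j * ((J.filter fun z => f z = f y).card : ℝ) := by
  have H := fun k : K => exists_cluster (I.filter fun z => f z = k) D hD1 hDt u n
  choose jj hjj Q hQ hcard hdiam hball using H
  let S : ℕ → Finset Ω := fun j => I.filter fun x => x ∈ Q (f x) ∧ jj (f x) = j
  have hu0 : (0 : ℝ) ≤ u := by linarith
  -- the clusters together contain a large part of `I`
  have hsum : (I.card : ℝ) ≤ u ^ n * ∑ j ∈ Finset.range (n + 1), ((S j).card : ℝ) := by
    have h1 : (I.card : ℝ) = ∑ k ∈ I.image f, ((I.filter fun z => f z = k).card : ℝ) := by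
      exact_mod_cast Finset.card_eq_sum_card_fiberwise (fun x hx => Finset.mem_image_of_mem f hx)
    have h2 : ∀ k ∈ I.image f, ((I.filter fun z => f z = k).card : ℝ) ≤ u ^ n * (Q k).card := by
      intro k _
      refine (hcard k).trans ?_
      gcongr
      exact hjj k
    have h3 : ∑ j ∈ Finset.range (n + 1), ((S j).card : ℝ)
        = ((I.filter fun x => x ∈ Q (f x)).card : ℝ) := by
      have := Finset.card_eq_sum_card_fiberwise (s := I.filter fun x => x ∈ Q (f x))
        (t := Finset.range (n + 1)) (f := fun x => jj (f x))
        (fun x _ => by simpa [Nat.lt_succ_iff] using hjj (f x))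
      rw [this, Nat.cast_sum]
      refine Finset.sum_congr rfl fun j _ => ?_
      rw [Finset.filter_filter]
    have h4 : ((I.filter fun x => x ∈ Q (f x)).card : ℝ) = ∑ k ∈ I.image f, ((Q k).card : ℝ) := by
      have := Finset.card_eq_sum_card_fiberwise (s := I.filter fun x => x ∈ Q (f x))
        (t := I.image f) (f := f)
        (fun x hx => Finset.mem_image_of_mem f (Finset.mem_filter.1 hx).1)
      rw [this, Nat.cast_sum]
      refine Finset.sum_congr rfl fun k _ => ?_
      congr 2
      ext x
      simp only [Finset.mem_filter]
      constructor
      · rintro ⟨⟨_, h⟩, rfl⟩; exact h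
      · intro h
        have := Finset.mem_filter.1 (hQ k h)
        exact ⟨⟨this.1, by rw [this.2]; exact h⟩, this.2⟩
    rw [h3, h4, h1, Finset.mul_sum]
    exact Finset.sum_le_sum h2
  obtain ⟨j, hj, hmax⟩ := Finset.exists_max_image (Finset.range (n + 1))
    (fun j => ((S j).card : ℝ)) ⟨0, by simp⟩
  have hS : ∀ k, jj k = j → (S j).filter (fun z => f z = k) = Q k := by
    intro k hk
    ext x
    simp only [S, Finset.mem_filter]
    constructor
    · rintro ⟨⟨_, h, _⟩, rfl⟩; exact h
    · intro h
      have := Finset.mem_filter.1 (hQ k h)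
      exact ⟨⟨this.1, by rw [this.2]; exact h, by rw [this.2]; exact hk⟩, this.2⟩
  refine ⟨j, by simpa [Nat.lt_succ_iff] using hj, S j, Finset.filter_subset _ _, ?_, ?_, ?_⟩
  · have h5 : ∑ i ∈ Finset.range (n + 1), ((S i).card : ℝ) ≤ (n + 1) * (S j).card := by
      have := Finset.sum_le_card_nsmul _ _ _ hmax
      simpa using this
    calc (I.card : ℝ) ≤ _ := hsum
      _ ≤ u ^ n * ((n + 1) * (S j).card) := by gcongr
      _ = _ := by ring
  · intro x hx y hy hxy
    have hx' := Finset.mem_filter.1 hx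
    have hy' := Finset.mem_filter.1 hy
    have := hdiam (f x) x hx'.2.1 y (hxy ▸ hy'.2.1)
    rwa [hx'.2.2] at this
  · intro y hy i hi
    have hy' := Finset.mem_filter.1 hy
    have := hball (f y) y (Finset.mem_filter.2 ⟨hy'.1, rfl⟩) i hi
    rw [Finset.filter_filter, hy'.2.2] at this
    rwa [hS _ hy'.2.2]

open Classical in
/-- Pruning: if the prescribed minimal degrees sum to less than the number of incidences, some
nonempty set of incidences has all these minimal degrees. The extremal set maximises the number of
incidences minus the prescribed degrees of the fibres that occur. -/
lemma exists_prune {Ω K L : Type*} (I : Finset Ω) (f : Ω → K) (g : Ω → L) (a : K → ℝ) (b : L → ℝ)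
    (ha : ∀ k, 0 ≤ a k) (hb : ∀ l, 0 ≤ b l)
    (h : ∑ k ∈ I.image f, a k + ∑ l ∈ I.image g, b l < I.card) :
    ∃ J ⊆ I, J.Nonempty ∧ ∀ x ∈ J, a (f x) ≤ ((J.filter fun z => f z = f x).card : ℝ) ∧
      b (g x) ≤ ((J.filter fun z => g z = g x).card : ℝ) := by
  let Φ : Finset Ω → ℝ := fun J => J.card - ∑ k ∈ J.image f, a k - ∑ l ∈ J.image g, b l
  obtain ⟨J, hJ, hmax⟩ := Finset.exists_max_image I.powerset Φ ⟨I, by simp⟩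
  rw [Finset.mem_powerset] at hJ
  have hpos : 0 < Φ J := lt_of_lt_of_le (by simp only [Φ]; linarith) (hmax I (by simp))
  have hsplit : ∀ p : Ω → Prop, ((J.filter p).card : ℝ) + ((J.filter fun z => ¬ p z).card : ℝ)
      = J.card := fun p => by exact_mod_cast Finset.card_filter_add_card_filter_not (s := J) p
  refine ⟨J, hJ, ?_, fun x hx => ⟨?_, ?_⟩⟩
  · rw [Finset.nonempty_iff_ne_empty]
    rintro rfl
    simp [Φ] at hpos
  · by_contra hcon
    push Not at hcon
    have h1 := hmax (J.filter fun z => ¬ f z = f x)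
      (Finset.mem_powerset.2 ((Finset.filter_subset _ _).trans hJ))
    have h2 : ∑ k ∈ (J.filter fun z => ¬ f z = f x).image f, a k + a (f x)
        ≤ ∑ k ∈ J.image f, a k := by
      rw [← Finset.sum_erase_add _ _ (Finset.mem_image_of_mem f hx)]
      gcongr
      · intro k _ _; exact ha k
      · intro k hk
        obtain ⟨z, hz, rfl⟩ := Finset.mem_image.1 hk
        rw [Finset.mem_filter] at hz
        exact Finset.mem_erase.2 ⟨hz.2, Finset.mem_image_of_mem f hz.1⟩
    have h3 : ∑ l ∈ (J.filter fun z => ¬ f z = f x).image g, b l ≤ ∑ l ∈ J.image g, b l :=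
      Finset.sum_le_sum_of_subset_of_nonneg (Finset.image_subset_image (Finset.filter_subset _ _))
        fun l _ _ => hb l
    have h4 := hsplit fun z => f z = f x
    simp only [Φ] at h1
    linarith
  · by_contra hcon
    push Not at hcon
    have h1 := hmax (J.filter fun z => ¬ g z = g x)
      (Finset.mem_powerset.2 ((Finset.filter_subset _ _).trans hJ))
    have h2 : ∑ k ∈ (J.filter fun z => ¬ g z = g x).image g, b k + b (g x)
        ≤ ∑ k ∈ J.image g, b k := by
      rw [← Finset.sum_erase_add _ _ (Finset.mem_image_of_mem g hx)]
      gcongr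
      · intro k _ _; exact hb k
      · intro k hk
        obtain ⟨z, hz, rfl⟩ := Finset.mem_image.1 hk
        rw [Finset.mem_filter] at hz
        exact Finset.mem_erase.2 ⟨hz.2, Finset.mem_image_of_mem g hz.1⟩
    have h3 : ∑ l ∈ (J.filter fun z => ¬ g z = g x).image f, a l ≤ ∑ l ∈ J.image f, a l :=
      Finset.sum_le_sum_of_subset_of_nonneg (Finset.image_subset_image (Finset.filter_subset _ _))
        fun l _ _ => ha l
    have h4 := hsplit fun z => g z = g x
    simp only [Φ] at h1
    linarith

open Classical in
/-- The cluster bound passes to dense subsets: at most a quarter of a subset of density `τ` of a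
cluster lies in a ball that is smaller by the factor `2⁻ʰ`. -/
lemma card_near_le {Ω : Type*} {A : Finset Ω} {D : Ω → Ω → ℝ} (hD0 : ∀ x y, 0 ≤ D x y) {u : ℝ}
    (hu : 1 ≤ u) {n j h : ℕ} {q τ c θ : ℝ} {y : Ω}
    (hball : ∀ i ≤ n, u ^ i * ((A.filter fun z => D y z ≤ (1 / 2) ^ i).card : ℝ) ≤ u ^ j * q)
    {B : Finset Ω} (hBA : B ⊆ A) (hB : τ * q ≤ B.card)
    (hh : 4 ≤ τ * u ^ h) (hc : c ≤ (1 / 2) ^ h) (hn : (1 / 2) ^ n ≤ θ) :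
    ((B.filter fun z => D y z + θ ≤ c * (1 / 2) ^ j).card : ℝ) ≤ B.card / 4 := by
  have hu0 : 0 < u := by linarith
  by_cases hjh : j + h ≤ n
  · have h1 := hball (j + h) hjh
    have h2 : ((B.filter fun z => D y z + θ ≤ c * (1 / 2) ^ j).card : ℝ)
        ≤ ((A.filter fun z => D y z ≤ (1 / 2) ^ (j + h)).card : ℝ) := by
      refine Nat.cast_le.2 (Finset.card_le_card fun z hz => ?_)
      rw [Finset.mem_filter] at hz ⊢
      refine ⟨hBA hz.1, ?_⟩
      have h3 : c * (1 / 2 : ℝ) ^ j ≤ (1 / 2) ^ h * (1 / 2) ^ j := by gcongr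
      rw [pow_add]
      have h4 : (0 : ℝ) < (1 / 2) ^ n := by positivity
      nlinarith [hz.2]
    refine h2.trans ?_
    set N := ((A.filter fun z => D y z ≤ (1 / 2) ^ (j + h)).card : ℝ)
    rw [pow_add, mul_assoc] at h1
    have h3 : u ^ h * N ≤ q := le_of_mul_le_mul_left h1 (by positivity)
    have hτ : 0 ≤ τ := by
      by_contra hcon
      push Not at hcon
      have : τ * u ^ h < 0 := mul_neg_of_neg_of_pos hcon (by positivity)
      linarith
    have h4 : 4 * N ≤ τ * u ^ h * N := by gcongr
    have h5 : τ * (u ^ h * N) ≤ τ * q := by gcongr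
    nlinarith
  · have : B.filter (fun z => D y z + θ ≤ c * (1 / 2) ^ j) = ∅ := by
      refine Finset.filter_false_of_mem fun z _ hz => ?_
      have h3 : c * (1 / 2 : ℝ) ^ j ≤ (1 / 2) ^ h * (1 / 2) ^ j := by gcongr
      rw [← pow_add] at h3
      have h4 : (1 / 2 : ℝ) ^ (h + j) ≤ (1 / 2) ^ (n + 1) :=
        pow_le_pow_of_le_one (by norm_num) (by norm_num) (by omega)
      have h5 : (0 : ℝ) < (1 / 2) ^ n := by positivity
      rw [pow_succ] at h4
      linarith [hD0 y z]
    rw [this]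
    simp only [Finset.card_empty, Nat.cast_zero]
    positivity

open Classical in
/-- Two-sided refinement of a set of incidences `I ⊆ ι × κ` for distances `d` on `ι` and `d'` on
`κ`: after the refinement, in every fibre the points have mutual distance at most `2 · 2⁻ʲ`, few of
them are much closer than `2⁻ʲ` to a given one, and no fibre is small. -/
lemma exists_refinement_aux {ι κ : Type*} (I : Finset (ι × κ)) (hI : I.Nonempty) (V : Finset ι)
    (N : Finset κ) (hIV : ∀ x ∈ I, x.1 ∈ V ∧ x.2 ∈ N) (d : ι → ι → ℝ) (d' : κ → κ → ℝ)
    (hd0 : ∀ x y, 0 ≤ d x y) (hd1 : ∀ x y, d x y ≤ 1) (hdt : ∀ x y z, d y z ≤ d x y + d x z)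
    (hd0' : ∀ x y, 0 ≤ d' x y) (hd1' : ∀ x y, d' x y ≤ 1) (hdt' : ∀ x y z, d' y z ≤ d' x y + d' x z)
    {u u' : ℝ} (hu : 1 ≤ u) (hu' : 1 ≤ u') {n h h' : ℕ} {θ c δ : ℝ} (hn : (1 / 2) ^ n ≤ θ)
    (hh : 16 * ((n + 1) * u' ^ n) ≤ u ^ h) (hh' : 16 ≤ u' ^ h') (hc : c ≤ (1 / 2) ^ h)
    (hc' : c ≤ (1 / 2) ^ h') (hδ : δ * (8 * ((n + 1) * u ^ n * ((n + 1) * u' ^ n))) ≤ 1) :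
    ∃ j ≤ n, ∃ k ≤ n, ∃ J ⊆ I, J.Nonempty ∧
      (∀ x ∈ J, ∀ y ∈ J, x.2 = y.2 → d x.1 y.1 ≤ 2 * (1 / 2) ^ j) ∧
      (∀ x ∈ J, ∀ y ∈ J, x.1 = y.1 → d' x.2 y.2 ≤ 2 * (1 / 2) ^ k) ∧
      (∀ x ∈ J, (((J.filter fun z => z.2 = x.2).filter
          fun z => d x.1 z.1 + θ ≤ c * (1 / 2) ^ j).card : ℝ)
          ≤ ((J.filter fun z => z.2 = x.2).card : ℝ) / 4) ∧
      (∀ x ∈ J, (((J.filter fun z => z.1 = x.1).filter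
          fun z => d' x.2 z.2 + θ ≤ c * (1 / 2) ^ k).card : ℝ)
          ≤ ((J.filter fun z => z.1 = x.1).card : ℝ) / 4) ∧
      (∀ x ∈ J, δ * (I.card / N.card) ≤ ((J.filter fun z => z.2 = x.2).card : ℝ)) ∧
      (∀ x ∈ J, δ * (I.card / V.card) ≤ ((J.filter fun z => z.1 = x.1).card : ℝ)) := by
  have hu0 : 0 < u := by linarith
  have hu0' : 0 < u' := by linarith
  obtain ⟨j, hj, J1, hJ1, c1, diam1, ball1⟩ := exists_cluster_fibers I Prod.snd
    (fun x y => d x.1 y.1) (fun _ _ => hd1 _ _) (fun _ _ _ => hdt _ _ _) hu n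
  obtain ⟨k, hk, J2, hJ2, c2, diam2, ball2⟩ := exists_cluster_fibers J1 Prod.fst
    (fun x y => d' x.2 y.2) (fun _ _ => hd1' _ _) (fun _ _ _ => hdt' _ _ _) hu' n
  set w := (n + 1) * u ^ n with hw
  set w' := (n + 1) * u' ^ n with hw'
  have hwpos : 0 < w := by positivity
  have hwpos' : 0 < w' := by positivity
  have hIc : (0 : ℝ) < I.card := by exact_mod_cast hI.card_pos
  have hJ1c : (0 : ℝ) < J1.card := by
    by_contra hcon
    have : (J1.card : ℝ) = 0 := le_antisymm (not_lt.1 hcon) (Nat.cast_nonneg _)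
    rw [this] at c1; linarith
  have hJ2c : (0 : ℝ) < J2.card := by
    by_contra hcon
    have : (J2.card : ℝ) = 0 := le_antisymm (not_lt.1 hcon) (Nat.cast_nonneg _)
    rw [this] at c2; linarith
  obtain ⟨x0, hx0⟩ := hI
  have hV : (0 : ℝ) < V.card := by exact_mod_cast Finset.card_pos.2 ⟨_, (hIV x0 hx0).1⟩
  have hN : (0 : ℝ) < N.card := by exact_mod_cast Finset.card_pos.2 ⟨_, (hIV x0 hx0).2⟩
  let τ : ℝ := 1 / (4 * w')
  let a : ι → ℝ := fun q => 1 / 4 * ((J2.filter fun z => z.1 = q).card : ℝ) + J2.card / 8 / V.card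
  let b : κ → ℝ := fun T => τ * ((J1.filter fun z => z.2 = T).card : ℝ) + J2.card / 8 / N.card
  have hsa : ∑ q ∈ J2.image Prod.fst, a q ≤ 3 / 8 * J2.card := by
    simp only [a]
    rw [Finset.sum_add_distrib, ← Finset.mul_sum, Finset.sum_const, nsmul_eq_mul]
    have h1 : (J2.card : ℝ) = ∑ q ∈ J2.image Prod.fst, ((J2.filter fun z => z.1 = q).card : ℝ) := by
      exact_mod_cast Finset.card_eq_sum_card_fiberwise
        (fun x hx => Finset.mem_image_of_mem Prod.fst hx)
    have h2 : ((J2.image Prod.fst).card : ℝ) ≤ V.card := by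
      refine Nat.cast_le.2 (Finset.card_le_card fun q hq => ?_)
      obtain ⟨z, hz, rfl⟩ := Finset.mem_image.1 hq
      exact (hIV z (hJ1 (hJ2 hz))).1
    have h3 : ((J2.image Prod.fst).card : ℝ) * (J2.card / 8 / V.card) ≤ J2.card / 8 := by
      calc _ ≤ (V.card : ℝ) * (J2.card / 8 / V.card) := by gcongr
        _ = _ := by field_simp
    rw [← h1]; linarith
  have hsb : ∑ T ∈ J2.image Prod.snd, b T ≤ 3 / 8 * J2.card := by
    simp only [b]
    rw [Finset.sum_add_distrib, ← Finset.mul_sum, Finset.sum_const, nsmul_eq_mul]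
    have h1 : ∑ T ∈ J2.image Prod.snd, ((J1.filter fun z => z.2 = T).card : ℝ) ≤ J1.card := by
      have h : (J1.card : ℝ) =
          ∑ q ∈ J1.image Prod.snd, ((J1.filter fun z => z.2 = q).card : ℝ) := by
        exact_mod_cast Finset.card_eq_sum_card_fiberwise
          (fun x hx => Finset.mem_image_of_mem Prod.snd hx)
      rw [h]
      exact Finset.sum_le_sum_of_subset_of_nonneg (Finset.image_subset_image hJ2)
        fun _ _ _ => Nat.cast_nonneg _
    have h2 : ((J2.image Prod.snd).card : ℝ) ≤ N.card := by
      refine Nat.cast_le.2 (Finset.card_le_card fun q hq => ?_)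
      obtain ⟨z, hz, rfl⟩ := Finset.mem_image.1 hq
      exact (hIV z (hJ1 (hJ2 hz))).2
    have h3 : ((J2.image Prod.snd).card : ℝ) * (J2.card / 8 / N.card) ≤ J2.card / 8 := by
      calc _ ≤ (N.card : ℝ) * (J2.card / 8 / N.card) := by gcongr
        _ = _ := by field_simp
    have h4 : τ * ∑ T ∈ J2.image Prod.snd, ((J1.filter fun z => z.2 = T).card : ℝ)
        ≤ 1 / 4 * J2.card := by
      calc _ ≤ τ * (w' * J2.card) := by
            have : 0 ≤ τ := by positivity
            gcongr
            exact h1.trans c2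
        _ = _ := by simp only [τ]; field_simp
    linarith
  obtain ⟨J, hJ, hJne, hdeg⟩ := exists_prune J2 Prod.fst Prod.snd a b (fun _ => by positivity)
    (fun _ => by positivity) (by linarith)
  have hδ' : δ * I.card ≤ J2.card / 8 := by
    have h1 : (I.card : ℝ) ≤ w * (w' * J2.card) := c1.trans (by gcongr)
    by_cases hδ0 : δ ≤ 0
    · have : δ * I.card ≤ 0 := mul_nonpos_of_nonpos_of_nonneg hδ0 hIc.le
      linarith
    · push Not at hδ0
      calc δ * I.card ≤ δ * (w * (w' * J2.card)) := by gcongr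
        _ = (δ * (8 * (w * w'))) * (J2.card / 8) := by ring
        _ ≤ 1 * (J2.card / 8) := by gcongr
        _ = _ := one_mul _
  refine ⟨j, hj, k, hk, J, hJ.trans (hJ2.trans hJ1), hJne, ?_, ?_, ?_, ?_, ?_, ?_⟩
  · exact fun x hx y hy hxy => diam1 x (hJ2 (hJ hx)) y (hJ2 (hJ hy)) hxy
  · exact fun x hx y hy hxy => diam2 x (hJ hx) y (hJ hy) hxy
  · intro x hx
    refine card_near_le (A := I.filter fun z => z.2 = x.2) (D := fun x y => d x.1 y.1)
      (u := u) (n := n) (h := h) (τ := τ)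
      (q := ((J1.filter fun z => z.2 = x.2).card : ℝ)) (fun _ _ => hd0 _ _) hu ?_
      ?_ ?_ ?_ hc hn
    · intro i hi
      rw [Finset.filter_filter]
      exact ball1 x (hJ2 (hJ hx)) i hi
    · exact Finset.filter_subset_filter _ (hJ.trans (hJ2.trans hJ1))
    · refine le_trans ?_ (hdeg x hx).2
      simp only [b]
      have : (0 : ℝ) ≤ J2.card / 8 / N.card := by positivity
      linarith
    · simp only [τ]
      rw [one_div, inv_mul_eq_div, le_div_iff₀ (by positivity)]
      linarith
  · intro x hx
    refine card_near_le (A := J1.filter fun z => z.1 = x.1) (D := fun x y => d' x.2 y.2)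
      (u := u') (n := n) (h := h') (τ := 1 / 4)
      (q := ((J2.filter fun z => z.1 = x.1).card : ℝ)) (fun _ _ => hd0' _ _) hu' ?_
      ?_ ?_ ?_ hc' hn
    · intro i hi
      rw [Finset.filter_filter]
      exact ball2 x (hJ hx) i hi
    · exact Finset.filter_subset_filter _ (hJ.trans hJ2)
    · refine le_trans ?_ (hdeg x hx).1
      simp only [a]
      have : (0 : ℝ) ≤ J2.card / 8 / V.card := by positivity
      linarith
    · linarith
  · intro x hx
    refine le_trans ?_ (hdeg x hx).2
    have h1 : δ * (I.card / N.card) ≤ J2.card / 8 / N.card := by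
      rw [← mul_div_assoc]; gcongr
    have : 0 ≤ τ * ((J1.filter fun z => z.2 = x.2).card : ℝ) := by positivity
    simp only [b]; linarith
  · intro x hx
    refine le_trans ?_ (hdeg x hx).1
    have h1 : δ * (I.card / V.card) ≤ J2.card / 8 / V.card := by
      rw [← mul_div_assoc]; gcongr
    have : 0 ≤ 1 / 4 * ((J2.filter fun z => z.1 = x.1).card : ℝ) := by positivity
    simp only [a]; linarith

end Refinement

/-! ### Counting chains -/

section Chains

open Classical in
lemma mul_card_le_card_filter_product {α β : Type*} (X : Finset α) (J : Finset β)
    (p : α → β → Prop) {d : ℝ} (h : ∀ a ∈ X, d ≤ ((J.filter fun z => p a z).card : ℝ)) :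
    d * X.card ≤ (((X ×ˢ J).filter fun z => p z.1 z.2).card : ℝ) := by
  have h1 : (((X ×ˢ J).filter fun z => p z.1 z.2).card : ℝ)
      = ∑ a ∈ X, ((J.filter fun z => p a z).card : ℝ) := by
    rw [Finset.card_filter, Finset.sum_product, Nat.cast_sum]
    refine Finset.sum_congr rfl fun a _ => ?_
    rw [Finset.card_filter]
  rw [h1]
  have := Finset.card_nsmul_le_sum X _ d h
  rw [nsmul_eq_mul] at this
  linarith

open Classical in
/-- Chains `x₁ R y₁ S x₂ R y₂ S x₃ R y₃` can be read in both directions, so at least half of them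
satisfy `w (q x₁) (q y₂) ≤ w (q y₁) (q y₃)`. Hence some start `x₁, y₁` has many continuations with
this property. -/
lemma exists_start_many_chains {Ω ι : Type*} (J : Finset Ω) (hJ : J.Nonempty) (R S : Ω → Ω → Prop)
    (hR : ∀ x y, R x y → R y x) (hS : ∀ x y, S x y → S y x) (q : Ω → ι)
    (hSq : ∀ x y, S x y → q x = q y) (w : ι → ι → ℝ) (hw : ∀ i j, w i j = w j i) {a b : ℝ}
    (ha : 0 < a) (hb : 0 ≤ b) (hRa : ∀ x ∈ J, a ≤ ((J.filter fun y => R x y).card : ℝ))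
    (hSb : ∀ x ∈ J, b ≤ ((J.filter fun y => S x y).card : ℝ)) :
    ∃ x₁ ∈ J, ∃ y₁ ∈ J, R x₁ y₁ ∧
      1 / 2 * (a * b) ^ 2 * b ≤ (((((((J ×ˢ J) ×ˢ J) ×ˢ J) ×ˢ J).filter fun z =>
        S y₁ z.1.1.1.1 ∧ R z.1.1.1.1 z.1.1.1.2 ∧ S z.1.1.1.2 z.1.1.2 ∧ R z.1.1.2 z.1.2 ∧
        S z.1.2 z.2 ∧ w (q x₁) (q z.1.1.1.2) ≤ w (q y₁) (q z.1.2)).card : ℝ)) := by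
  let X2 := (J ×ˢ J).filter fun z => R z.1 z.2
  let X3 := (X2 ×ˢ J).filter fun z => S z.1.2 z.2
  let X4 := (X3 ×ˢ J).filter fun z => R z.1.2 z.2
  let X5 := (X4 ×ˢ J).filter fun z => S z.1.2 z.2
  let X6 := (X5 ×ˢ J).filter fun z => R z.1.2 z.2
  let W : (((((Ω × Ω) × Ω) × Ω) × Ω) × Ω) → Prop := fun z =>
    w (q z.1.1.1.1.1) (q z.1.1.2) ≤ w (q z.1.1.1.1.2) (q z.2)
  let X7 := ((X6.filter W) ×ˢ J).filter fun z => S z.1.2 z.2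
  have m2 : ∀ z ∈ X2, z.1 ∈ J ∧ z.2 ∈ J ∧ R z.1 z.2 := fun z hz => by
    simp only [X2, Finset.mem_filter, Finset.mem_product] at hz; tauto
  have h2 : 0 < (X2.card : ℝ) := by
    have := mul_card_le_card_filter_product J J R hRa
    have hJ' : (0 : ℝ) < J.card := by exact_mod_cast hJ.card_pos
    exact (mul_pos ha hJ').trans_le this
  have h3 : b * X2.card ≤ X3.card := mul_card_le_card_filter_product X2 J (fun z => S z.2)
    fun z hz => hSb _ (m2 z hz).2.1
  have h4 : a * X3.card ≤ X4.card := mul_card_le_card_filter_product X3 J (fun z => R z.2)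
    fun z hz => hRa _ (Finset.mem_product.1 (Finset.mem_filter.1 hz).1).2
  have h5 : b * X4.card ≤ X5.card := mul_card_le_card_filter_product X4 J (fun z => S z.2)
    fun z hz => hSb _ (Finset.mem_product.1 (Finset.mem_filter.1 hz).1).2
  have h6 : a * X5.card ≤ X6.card := mul_card_le_card_filter_product X5 J (fun z => R z.2)
    fun z hz => hRa _ (Finset.mem_product.1 (Finset.mem_filter.1 hz).1).2
  have h7 : b * (X6.filter W).card ≤ X7.card :=
    mul_card_le_card_filter_product (X6.filter W) J (fun z => S z.2)
    fun z hz => hSb _ (Finset.mem_product.1 (Finset.mem_filter.1 (Finset.mem_filter.1 hz).1).1).2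
  have m6 : ∀ z, z ∈ X6 ↔ z.1.1.1.1.1 ∈ J ∧ z.1.1.1.1.2 ∈ J ∧ z.1.1.1.2 ∈ J ∧ z.1.1.2 ∈ J ∧
      z.1.2 ∈ J ∧ z.2 ∈ J ∧ R z.1.1.1.1.1 z.1.1.1.1.2 ∧ S z.1.1.1.1.2 z.1.1.1.2 ∧
      R z.1.1.1.2 z.1.1.2 ∧ S z.1.1.2 z.1.2 ∧ R z.1.2 z.2 := by
    intro z
    simp only [X6, X5, X4, X3, X2, Finset.mem_filter, Finset.mem_product]
    tauto
  -- reversal maps the chains violating `W` into those satisfying it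
  have hrev : (X6.filter fun z => ¬ W z).card ≤ (X6.filter W).card := by
    refine Finset.card_le_card_of_injOn
      (fun z => (((((z.2, z.1.2), z.1.1.2), z.1.1.1.2), z.1.1.1.1.2), z.1.1.1.1.1)) ?_ ?_
    · intro z hz
      simp only [Finset.coe_filter, Set.mem_ofPred_eq, m6] at hz ⊢
      obtain ⟨⟨j1, j2, j3, j4, j5, j6, r1, s1, r2, s2, r3⟩, hW⟩ := hz
      refine ⟨⟨j6, j5, j4, j3, j2, j1, hR _ _ r3, hS _ _ s2, hR _ _ r2, hS _ _ s1, hR _ _ r1⟩, ?_⟩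
      simp only [W, not_le] at hW ⊢
      rw [← hSq _ _ s1, ← hSq _ _ s2, hw, hw (q z.1.1.2)]
      exact hW.le
    · rintro ⟨⟨⟨⟨⟨a1, a2⟩, a3⟩, a4⟩, a5⟩, a6⟩ _ ⟨⟨⟨⟨⟨b1, b2⟩, b3⟩, b4⟩, b5⟩, b6⟩ _ h
      simp only [Prod.mk.injEq] at h ⊢
      tauto
  have hhalf : (X6.card : ℝ) / 2 ≤ (X6.filter W).card := by
    have := Finset.card_filter_add_card_filter_not (s := X6) W
    have h1 : (X6.card : ℝ) = (X6.filter W).card + (X6.filter fun z => ¬ W z).card := by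
      exact_mod_cast this.symm
    have h2 : ((X6.filter fun z => ¬ W z).card : ℝ) ≤ (X6.filter W).card := by exact_mod_cast hrev
    linarith
  have htot : 1 / 2 * (a * b) ^ 2 * b * X2.card ≤ X7.card := by
    calc 1 / 2 * (a * b) ^ 2 * b * X2.card
        = b * (a * (b * (a * (b * X2.card))) / 2) := by ring
      _ ≤ b * (a * (b * (a * X3.card)) / 2) := by gcongr
      _ ≤ b * (a * (b * X4.card) / 2) := by gcongr
      _ ≤ b * (a * X5.card / 2) := by gcongr
      _ ≤ b * (X6.card / 2) := by gcongr
      _ ≤ b * (X6.filter W).card := by gcongr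
      _ ≤ X7.card := h7
  -- pigeonhole over the start of the chain
  have hfib : (X7.card : ℝ) = ∑ p ∈ X2, ((X7.filter fun z => z.1.1.1.1.1 = p).card : ℝ) := by
    exact_mod_cast Finset.card_eq_sum_card_fiberwise (fun z hz => by
      have h := (Finset.mem_filter.1 (Finset.mem_product.1 (Finset.mem_filter.1 hz).1).1).1
      rw [m6] at h
      simp only [X2, Finset.coe_filter, Set.mem_ofPred_eq, Finset.mem_product]
      tauto)
  obtain ⟨p, hp, hple⟩ : ∃ p ∈ X2, 1 / 2 * (a * b) ^ 2 * b
      ≤ ((X7.filter fun z => z.1.1.1.1.1 = p).card : ℝ) := by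
    refine Finset.exists_le_of_sum_le (s := X2) (f := fun _ => 1 / 2 * (a * b) ^ 2 * b)
      (by
        rw [Finset.nonempty_iff_ne_empty]
        rintro h0
        rw [h0] at h2; simp at h2) ?_
    rw [← hfib, Finset.sum_const, nsmul_eq_mul]
    linarith
  obtain ⟨hp1, hp2, hp3⟩ := m2 p hp
  refine ⟨p.1, hp1, p.2, hp2, hp3, hple.trans ?_⟩
  refine Nat.cast_le.2 (Finset.card_le_card_of_injOn
    (fun z => ((((z.1.1.1.1.2, z.1.1.1.2), z.1.1.2), z.1.2), z.2)) ?_ ?_)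
  · intro z hz
    simp only [X7, Finset.coe_filter, Set.mem_ofPred_eq, Finset.mem_filter, Finset.mem_product,
      m6, W] at hz ⊢
    obtain ⟨⟨⟨⟨⟨j1, j2, j3, j4, j5, j6, r1, s1, r2, s2, r3⟩, hW⟩, j7⟩, s3⟩, rfl⟩ := hz
    tauto
  · rintro ⟨⟨⟨⟨⟨⟨a1, a2⟩, a3⟩, a4⟩, a5⟩, a6⟩, a7⟩ h1 ⟨⟨⟨⟨⟨⟨b1, b2⟩, b3⟩, b4⟩, b5⟩, b6⟩, b7⟩ h2 h
    simp only [Finset.coe_filter, Set.mem_ofPred_eq] at h1 h2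
    simp only [Prod.mk.injEq] at h ⊢
    have := h1.2.trans h2.2.symm
    simp only [Prod.mk.injEq] at this
    tauto

end Chains

/-! ### The losses of the refinement are small powers of the scale -/

lemma exists_dyadic {θ : ℝ} (h0 : 0 < θ) (h1 : θ < 1) :
    ∃ n : ℕ, (1 / 2 : ℝ) ^ n ≤ θ ∧ θ ≤ 2 * (1 / 2) ^ n := by
  obtain ⟨n, hn, hn'⟩ := exists_nat_pow_near_of_lt_one h0 h1.le (by norm_num : (0 : ℝ) < 1 / 2)
    (by norm_num)
  exact ⟨n + 1, hn.le, by rw [pow_succ]; linarith⟩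

/-- The parameters of the two-sided refinement at scale `θ` can be chosen with losses `θ ^ κ`. -/
lemma exists_refinement_parameters {κ : ℝ} (hκ : 0 < κ) :
    ∃ c : ℝ, 0 < c ∧ c ≤ 1 ∧ ∃ u u' : ℝ, 1 ≤ u ∧ 1 ≤ u' ∧ ∃ h' : ℕ, 16 ≤ u' ^ h' ∧
      c ≤ (1 / 2) ^ h' ∧ ∀ θ : ℝ, 0 < θ → θ < 1 → ∃ n h : ℕ, (1 / 2 : ℝ) ^ n ≤ θ ∧
        θ ≤ 2 * (1 / 2) ^ n ∧ 16 * ((n + 1) * u' ^ n) ≤ u ^ h ∧ c * θ ^ κ ≤ (1 / 2) ^ h ∧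
        c * θ ^ κ * (8 * ((n + 1) * u ^ n * ((n + 1) * u' ^ n))) ≤ 1 := by
  set η : ℝ := min 1 (κ / 4) with hη
  have hη0 : 0 < η := lt_min one_pos (by linarith)
  have hη1 : η ≤ 1 := min_le_left _ _
  have hηκ : 4 * η ≤ κ := by have := min_le_right 1 (κ / 4); linarith
  set u : ℝ := (2 : ℝ) ^ η with hu
  set u' : ℝ := (2 : ℝ) ^ (η ^ 2) with hu'
  have hu1 : 1 < u := Real.one_lt_rpow (by norm_num) hη0
  have hu1' : 1 < u' := Real.one_lt_rpow (by norm_num) (by positivity)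
  obtain ⟨h', hh'⟩ := pow_unbounded_of_one_lt 16 hu1'
  -- the number of dyadic scales is at most `C x ^ η²` with `x = 2ⁿ`
  have hlog : 0 < Real.log 2 := Real.log_pos (by norm_num)
  set C : ℝ := 1 / (η ^ 2 * Real.log 2) + 1 with hC
  have hC1 : 1 ≤ C := by rw [hC]; have : 0 < 1 / (η ^ 2 * Real.log 2) := by positivity
                         linarith
  have hnC : ∀ n : ℕ, (n + 1 : ℝ) ≤ C * u' ^ n := by
    intro n
    have h1 : u' ^ n = Real.exp (η ^ 2 * Real.log 2 * n) := by
      rw [hu', Real.rpow_def_of_pos (by norm_num), ← Real.exp_nat_mul]; ring_nf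
    have h2 := Real.add_one_le_exp (η ^ 2 * Real.log 2 * n)
    rw [← h1] at h2
    have h3 : 1 ≤ u' ^ n := one_le_pow₀ hu1'.le
    have h4 : (n : ℝ) ≤ 1 / (η ^ 2 * Real.log 2) * u' ^ n := by
      rw [one_div, inv_mul_eq_div, le_div_iff₀ (by positivity)]
      linarith
    rw [hC]; linarith
  set K : ℝ := (16 * C) ^ (1 / η) with hK
  have hK1 : 1 ≤ K := Real.one_le_rpow (by linarith) (by positivity)
  set c : ℝ := min ((1 / 2) ^ h') (min (1 / (2 * K * 2 ^ κ)) (1 / (8 * C ^ 2 * 2 ^ κ))) with hc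
  have h2κ : (1 : ℝ) ≤ 2 ^ κ := Real.one_le_rpow (by norm_num) hκ.le
  have hc0 : 0 < c := lt_min (by positivity) (lt_min (by positivity) (by positivity))
  refine ⟨c, hc0, ?_, u, u', hu1.le, hu1'.le, h', hh'.le, min_le_left _ _, fun θ h0 h1 => ?_⟩
  · exact (min_le_left _ _).trans (pow_le_one₀ (by norm_num) (by norm_num))
  obtain ⟨n, hn, hn'⟩ := exists_dyadic h0 h1
  set x : ℝ := (2 : ℝ) ^ n with hx
  have hx1 : 1 ≤ x := one_le_pow₀ (by norm_num)
  have hx0 : 0 < x := by linarith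
  have hxinv : (1 / 2 : ℝ) ^ n = x⁻¹ := by rw [hx, one_div, inv_pow]
  have hxθ : θ * x ≤ 2 := by
    rw [hxinv] at hn'
    have : θ * x ≤ 2 * x⁻¹ * x := by gcongr
    rw [mul_assoc, inv_mul_cancel₀ hx0.ne'] at this
    linarith
  have hswap : ∀ p : ℝ, ((2 : ℝ) ^ p) ^ n = x ^ p := fun p => by
    rw [hx, ← Real.rpow_natCast, ← Real.rpow_natCast, ← Real.rpow_mul (by norm_num),
      ← Real.rpow_mul (by norm_num), mul_comm]
  have hun : u ^ n = x ^ η := hswap η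
  have hun' : u' ^ n = x ^ (η ^ 2) := hswap (η ^ 2)
  have hθx : θ ^ κ * x ^ (4 * η) ≤ 2 ^ κ := by
    calc θ ^ κ * x ^ (4 * η) ≤ θ ^ κ * x ^ κ := by gcongr
      _ = (θ * x) ^ κ := (Real.mul_rpow h0.le hx0.le).symm
      _ ≤ 2 ^ κ := by gcongr
  have hηsq : η ^ 2 ≤ η := by nlinarith
  set Y : ℝ := 16 * ((n + 1) * u' ^ n) with hY
  have hY1 : 1 ≤ Y := by
    have h3 : 1 ≤ u' ^ n := one_le_pow₀ hu1'.le
    have h4 : (0 : ℝ) ≤ n := Nat.cast_nonneg _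
    nlinarith
  have hYle : Y ≤ 16 * C * x ^ (2 * η ^ 2) := by
    have h3 : x ^ (2 * η ^ 2) = x ^ (η ^ 2) * x ^ (η ^ 2) := by
      rw [← Real.rpow_add hx0]; ring_nf
    rw [h3, hY, hun']
    have := hnC n
    rw [hun'] at this
    have h5 : 0 < x ^ (η ^ 2) := by positivity
    nlinarith
  set h : ℕ := ⌈Real.logb 2 (Y ^ (1 / η))⌉₊ with hh
  have hYη1 : 1 ≤ Y ^ (1 / η) := Real.one_le_rpow hY1 (by positivity)
  have hle : Y ^ (1 / η) ≤ 2 ^ h := by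
    have h3 : Real.logb 2 (Y ^ (1 / η)) ≤ h := Nat.le_ceil _
    rw [Real.logb_le_iff_le_rpow (by norm_num) (by positivity), Real.rpow_natCast] at h3
    exact h3
  have hlt : (2 : ℝ) ^ h ≤ 2 * Y ^ (1 / η) := by
    have h3 : (h : ℝ) < Real.logb 2 (Y ^ (1 / η)) + 1 :=
      Nat.ceil_lt_add_one (Real.logb_nonneg (by norm_num) hYη1)
    have h4 : (h : ℝ) - 1 ≤ Real.logb 2 (Y ^ (1 / η)) := by linarith
    rw [Real.le_logb_iff_rpow_le (by norm_num) (by positivity), Real.rpow_sub (by norm_num),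
      Real.rpow_natCast, Real.rpow_one] at h4
    linarith
  refine ⟨n, h, hn, hn', ?_, ?_, ?_⟩
  · have h3 : Y = (Y ^ (1 / η)) ^ η := by
      rw [← Real.rpow_mul (by linarith), one_div_mul_cancel hη0.ne', Real.rpow_one]
    have h4 : u ^ h = ((2 : ℝ) ^ h) ^ η := by
      rw [hu, ← Real.rpow_natCast, ← Real.rpow_natCast, ← Real.rpow_mul (by norm_num),
        ← Real.rpow_mul (by norm_num), mul_comm]
    rw [h4]
    refine h3.le.trans ?_
    gcongr
  · have h3 : Y ^ (1 / η) ≤ K * x ^ (2 * η) := by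
      calc Y ^ (1 / η) ≤ (16 * C * x ^ (2 * η ^ 2)) ^ (1 / η) := by gcongr
        _ = K * x ^ (2 * η) := by
          rw [Real.mul_rpow (by linarith) (by positivity), ← Real.rpow_mul hx0.le]
          congr 2; field_simp
    have h4 : x ^ (2 * η) ≤ x ^ (4 * η) := Real.rpow_le_rpow_of_exponent_le hx1 (by linarith)
    have h5 : c ≤ 1 / (2 * K * 2 ^ κ) := (min_le_right _ _).trans (min_le_left _ _)
    rw [one_div, inv_pow, ← one_div, le_div_iff₀ (by positivity)]
    have h6 : (2 : ℝ) ^ h ≤ 2 * (K * x ^ (4 * η)) := by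
      refine hlt.trans ?_
      gcongr
      exact h3.trans (by gcongr)
    calc c * θ ^ κ * 2 ^ h ≤ 1 / (2 * K * 2 ^ κ) * θ ^ κ * (2 * (K * x ^ (4 * η))) := by gcongr
      _ = (θ ^ κ * x ^ (4 * η)) / 2 ^ κ := by field_simp
      _ ≤ 1 := by rw [div_le_one (by positivity)]; exact hθx
  · have h5 : c ≤ 1 / (8 * C ^ 2 * 2 ^ κ) := (min_le_right _ _).trans (min_le_right _ _)
    have h6 : (n + 1) * u ^ n * ((n + 1) * u' ^ n) ≤ C ^ 2 * x ^ (4 * η) := by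
      calc (n + 1) * u ^ n * ((n + 1) * u' ^ n)
          ≤ (C * u' ^ n) * u ^ n * ((C * u' ^ n) * u' ^ n) := by
            have := hnC n
            gcongr
        _ = C ^ 2 * (x ^ (η ^ 2) * x ^ η * x ^ (η ^ 2) * x ^ (η ^ 2)) := by rw [hun, hun']; ring
        _ ≤ C ^ 2 * (x ^ η * x ^ η * x ^ η * x ^ η) := by
            have : x ^ (η ^ 2) ≤ x ^ η := Real.rpow_le_rpow_of_exponent_le hx1 hηsq
            gcongr
        _ = C ^ 2 * x ^ (4 * η) := by
            rw [← Real.rpow_add hx0, ← Real.rpow_add hx0, ← Real.rpow_add hx0]; ring_nf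
    calc c * θ ^ κ * (8 * ((n + 1) * u ^ n * ((n + 1) * u' ^ n)))
        ≤ 1 / (8 * C ^ 2 * 2 ^ κ) * θ ^ κ * (8 * (C ^ 2 * x ^ (4 * η))) := by gcongr
      _ = (θ ^ κ * x ^ (4 * η)) / 2 ^ κ := by field_simp
      _ ≤ 1 := by rw [div_le_one (by positivity)]; exact hθx

open Classical in
/-- Two-sided refinement of incidences at scale `θ` with losses `c θ ^ κ`. -/
lemma exists_refinement {κ : ℝ} (hκ : 0 < κ) :
    ∃ c : ℝ, 0 < c ∧ c ≤ 1 ∧ ∀ θ : ℝ, 0 < θ → θ < 1 → ∃ n : ℕ, (1 / 2 : ℝ) ^ n ≤ θ ∧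
      θ ≤ 2 * (1 / 2) ^ n ∧ (n + 1) * (c * θ ^ κ) ≤ 1 ∧
      ∀ (ι τ : Type) (I : Finset (ι × τ)) (_ : I.Nonempty) (V : Finset ι)
        (N : Finset τ) (_ : ∀ x ∈ I, x.1 ∈ V ∧ x.2 ∈ N) (d : ι → ι → ℝ) (d' : τ → τ → ℝ)
        (_ : ∀ x y, 0 ≤ d x y) (_ : ∀ x y, d x y ≤ 1) (_ : ∀ x y z, d y z ≤ d x y + d x z)
        (_ : ∀ x y, 0 ≤ d' x y) (_ : ∀ x y, d' x y ≤ 1) (_ : ∀ x y z, d' y z ≤ d' x y + d' x z),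
        ∃ j ≤ n, ∃ k ≤ n, ∃ J ⊆ I, J.Nonempty ∧
          (∀ x ∈ J, ∀ y ∈ J, x.2 = y.2 → d x.1 y.1 ≤ 2 * (1 / 2) ^ j) ∧
          (∀ x ∈ J, ∀ y ∈ J, x.1 = y.1 → d' x.2 y.2 ≤ 2 * (1 / 2) ^ k) ∧
          (∀ x ∈ J, (((J.filter fun z => z.2 = x.2).filter
              fun z => d x.1 z.1 + θ ≤ c * θ ^ κ * (1 / 2) ^ j).card : ℝ)
              ≤ ((J.filter fun z => z.2 = x.2).card : ℝ) / 4) ∧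
          (∀ x ∈ J, (((J.filter fun z => z.1 = x.1).filter
              fun z => d' x.2 z.2 + θ ≤ c * θ ^ κ * (1 / 2) ^ k).card : ℝ)
              ≤ ((J.filter fun z => z.1 = x.1).card : ℝ) / 4) ∧
          (∀ x ∈ J, c * θ ^ κ * (I.card / N.card) ≤ ((J.filter fun z => z.2 = x.2).card : ℝ)) ∧
          (∀ x ∈ J, c * θ ^ κ * (I.card / V.card) ≤ ((J.filter fun z => z.1 = x.1).card : ℝ)) := by
  obtain ⟨c, hc0, hc1, u, u', hu, hu', h', hh', hch', H⟩ := exists_refinement_parameters hκ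
  refine ⟨c, hc0, hc1, fun θ h0 h1 => ?_⟩
  obtain ⟨n, h, hn, hn', hh, hch, hδ⟩ := H θ h0 h1
  refine ⟨n, hn, hn', ?_, ?_⟩
  · refine le_trans ?_ hδ
    have h3 : 1 ≤ u ^ n := one_le_pow₀ hu
    have h4 : 1 ≤ u' ^ n := one_le_pow₀ hu'
    have h5 : (0 : ℝ) ≤ n := Nat.cast_nonneg _
    have h6 : (n + 1 : ℝ) ≤ (n + 1) * u ^ n := by nlinarith
    have h7 : (1 : ℝ) ≤ (n + 1) * u' ^ n := by nlinarith
    have h8 : (n + 1 : ℝ) ≤ (n + 1) * u ^ n * ((n + 1) * u' ^ n) := by nlinarith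
    have h9 : 0 ≤ c * θ ^ κ := by positivity
    nlinarith
  · intro ι τ I hI V N hIV d d' a1 a2 a3 a4 a5 a6
    refine exists_refinement_aux I hI V N hIV d d' a1 a2 a3 a4 a5 a6 hu hu' hn hh hh' hch ?_ hδ
    refine le_trans ?_ hch'
    have : θ ^ κ ≤ 1 := Real.rpow_le_one h0.le h1.le hκ.le
    nlinarith

/-! ### Counting separated points, directions and tubes -/

/-- Points in a box that are determined by the integer parts of their coordinates. -/
lemma card_le_prod_of_abs_sub_lt {X ι : Type*} [Fintype ι] [DecidableEq ι] (F : Finset X)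
    (f : X → ι → ℝ) (A : ι → ℝ)
    (hA0 : ∀ i, 0 ≤ A i) (hA : ∀ x ∈ F, ∀ i, |f x i| ≤ A i)
    (hinj : ∀ x ∈ F, ∀ y ∈ F, (∀ i, |f x i - f y i| < 1) → x = y) :
    (F.card : ℝ) ≤ ∏ i, (2 * A i + 2) := by
  have h1 : F.card ≤ (Fintype.piFinset fun i => Finset.Icc ⌊-A i⌋ ⌊A i⌋).card := by
    refine Finset.card_le_card_of_injOn (fun x i => ⌊f x i⌋) ?_ ?_
    · intro x hx
      simp only [Finset.mem_coe, Fintype.mem_piFinset, Finset.mem_Icc]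
      exact fun i => ⟨Int.floor_le_floor (abs_le.1 (hA x hx i)).1,
        Int.floor_le_floor (abs_le.1 (hA x hx i)).2⟩
    · intro x hx y hy hxy
      exact hinj x hx y hy fun i => Int.abs_sub_lt_one_of_floor_eq_floor (congrFun hxy i)
  refine (Nat.cast_le.2 h1).trans ?_
  rw [Fintype.card_piFinset, Nat.cast_prod]
  refine Finset.prod_le_prod (fun _ _ => Nat.cast_nonneg _) fun i _ => ?_
  rw [Int.card_Icc]
  have h2 : ⌊-A i⌋ ≤ ⌊A i⌋ := Int.floor_le_floor (by linarith [hA0 i])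
  have h3 : ((⌊A i⌋ + 1 - ⌊-A i⌋).toNat : ℝ) = (⌊A i⌋ : ℝ) + 1 - ⌊-A i⌋ := by
    have : ((⌊A i⌋ + 1 - ⌊-A i⌋).toNat : ℤ) = ⌊A i⌋ + 1 - ⌊-A i⌋ := Int.toNat_of_nonneg (by omega)
    exact_mod_cast this
  rw [h3]
  linarith [Int.floor_le (A i), Int.lt_floor_add_one (-A i)]

/-- A separated set inside a box with respect to some orthonormal basis. -/
lemma card_le_of_separated {X : Type*} (F : Finset X) (f : X → E4)
    (b : OrthonormalBasis (Fin 4) ℝ E4) {δ : ℝ} (hδ : 0 < δ)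
    (hsep : ∀ x ∈ F, ∀ y ∈ F, x ≠ y → δ ≤ ‖f x - f y‖) (x₀ : E4) (a : Fin 4 → ℝ)
    (ha : ∀ i, 0 ≤ a i) (hbox : ∀ x ∈ F, ∀ i, |⟪b i, f x - x₀⟫_ℝ| ≤ a i) :
    (F.card : ℝ) ≤ ∏ i, (4 * a i / δ + 2) := by
  have h := card_le_prod_of_abs_sub_lt F (fun x i => 2 / δ * ⟪b i, f x - x₀⟫_ℝ)
    (fun i => 2 / δ * a i) (fun i => mul_nonneg (by positivity) (ha i)) (fun x hx i => ?_)
    fun x hx y hy hxy => ?_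
  · refine h.trans (le_of_eq (Finset.prod_congr rfl fun i _ => by ring))
  · rw [abs_mul, abs_of_pos (by positivity)]
    have := hbox x hx i
    gcongr
  · by_contra hne
    have h1 := hsep x hx y hy hne
    have h2 : ∀ i, ⟪b i, f x - f y⟫_ℝ ^ 2 < (δ / 2) ^ 2 := by
      intro i
      have h3 := hxy i
      rw [← mul_sub, ← inner_sub_right, sub_sub_sub_cancel_right, abs_mul,
        abs_of_pos (by positivity), div_mul_eq_mul_div, div_lt_one hδ] at h3
      exact sq_lt_sq' (by linarith [neg_abs_le ⟪b i, f x - f y⟫_ℝ])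
        (by linarith [le_abs_self ⟪b i, f x - f y⟫_ℝ])
    have h4 : ‖f x - f y‖ ^ 2 = ∑ i, ⟪b i, f x - f y⟫_ℝ ^ 2 := by
      rw [← b.sum_sq_norm_inner_right (f x - f y)]
      simp
    rw [Fin.sum_univ_four] at h4
    nlinarith [h2 0, h2 1, h2 2, h2 3]

lemma half_le_norm_sub {θ : ℝ} {v w : E4} (hv : ‖v‖ = 1) (hw : ‖w‖ = 1)
    (h : θ ≤ InnerProductGeometry.angle v w) : θ / 2 ≤ ‖v - w‖ := by
  set φ := InnerProductGeometry.angle v w with hφ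
  have h0 : 0 ≤ φ := InnerProductGeometry.angle_nonneg _ _
  have hπ : φ ≤ Real.pi := InnerProductGeometry.angle_le_pi _ _
  have h1 : ‖v - w‖ ^ 2 = 2 - 2 * Real.cos φ := by
    rw [norm_sub_sq_real, InnerProductGeometry.cos_angle, hv, hw]; ring
  have h2 : Real.cos φ = 1 - 2 * Real.sin (φ / 2) ^ 2 := by
    have := Real.cos_two_mul (φ / 2)
    rw [mul_div_cancel₀ _ (two_ne_zero)] at this
    rw [this, Real.cos_sq']; ring
  have h3 := Real.mul_le_sin (x := φ / 2) (by linarith) (by linarith)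
  have h4 : φ / 4 ≤ Real.sin (φ / 2) := by
    refine le_trans ?_ h3
    rw [div_mul_div_comm, le_div_iff₀ (by positivity)]
    nlinarith [Real.pi_le_four]
  have h5 : φ / 2 ≤ ‖v - w‖ := by
    refine abs_le_of_sq_le_sq' ?_ (norm_nonneg _) |>.2
    rw [h1, h2]; nlinarith
  linarith

/-- The number of `θ`-separated directions in a box of dimensions `1, a, b, c`. The directions are
thickened to radial sequences of points, which makes the count one of points in a box. -/
lemma card_directions_le {θ : ℝ} (h0 : 0 < θ) (h1 : θ < 1) {Ω : Finset E4}
    (hΩ : SeparatedDirections θ Ω) (b : OrthonormalBasis (Fin 4) ℝ E4) {a₁ a₂ a₃ : ℝ}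
    (ha₁ : θ ≤ a₁) (ha₂ : θ ≤ a₂) (ha₃ : θ ≤ a₃)
    (h : ∀ v ∈ Ω, |⟪b 1, v⟫_ℝ| ≤ a₁ ∧ |⟪b 2, v⟫_ℝ| ≤ a₂ ∧ |⟪b 3, v⟫_ℝ| ≤ a₃) :
    (Ω.card : ℝ) ≤ 209952 * (a₁ * a₂ * a₃ / θ ^ 3) := by
  set m : ℕ := ⌊1 / θ⌋₊ with hm
  have hm1 : (1 : ℝ) ≤ m := by
    have : 1 ≤ m := Nat.le_floor (by rw [Nat.cast_one, le_div_iff₀ h0]; linarith)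
    exact_mod_cast this
  have hm2 : 1 / (2 * θ) ≤ m := by
    have h3 : 1 / θ < m + 1 := Nat.lt_floor_add_one _
    have h4 : 1 / (2 * θ) = 1 / θ / 2 := by field_simp
    rw [h4]; linarith
  have hm3 : (m : ℝ) * θ ≤ 1 := by
    have : (m : ℝ) ≤ 1 / θ := Nat.floor_le (by positivity)
    rwa [le_div_iff₀ h0] at this
  let r : ℕ → ℝ := fun j => 1 / 2 + j * θ / 2
  let a : Fin 4 → ℝ := ![1, a₁, a₂, a₃]
  have hcard := card_le_of_separated (Ω ×ˢ Finset.range m) (fun p => r p.2 • p.1) b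
    (δ := θ / 4) (by positivity) ?_ 0 a ?_ ?_
  · rw [Finset.card_product, Finset.card_range, Nat.cast_mul, Fin.prod_univ_four] at hcard
    simp only [a, Matrix.cons_val] at hcard
    have e : ∀ x : ℝ, θ ≤ x → 4 * x / (θ / 4) + 2 ≤ 18 * (x / θ) := fun x hx => by
      have : 1 ≤ x / θ := by rw [le_div_iff₀ h0]; linarith
      have h3 : 4 * x / (θ / 4) = 16 * (x / θ) := by field_simp; ring
      rw [h3]; linarith
    have h5 : (4 * 1 / (θ / 4) + 2) * (4 * a₁ / (θ / 4) + 2) * (4 * a₂ / (θ / 4) + 2) *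
        (4 * a₃ / (θ / 4) + 2) ≤ (18 * (1 / θ)) * (18 * (a₁ / θ)) * (18 * (a₂ / θ)) *
        (18 * (a₃ / θ)) := by
      have := e 1 h1.le
      have := e a₁ ha₁
      have := e a₂ ha₂
      have := e a₃ ha₃
      have : 0 < a₁ := by linarith
      have : 0 < a₂ := by linarith
      have : 0 < a₃ := by linarith
      gcongr
    have h6 : (Ω.card : ℝ) * (1 / (2 * θ)) ≤ 104976 * (a₁ * a₂ * a₃ / θ ^ 4) := by
      calc (Ω.card : ℝ) * (1 / (2 * θ)) ≤ Ω.card * m := by gcongr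
        _ ≤ _ := hcard.trans h5
        _ = _ := by field_simp; ring
    calc (Ω.card : ℝ) = Ω.card * (1 / (2 * θ)) * (2 * θ) := by field_simp
      _ ≤ 104976 * (a₁ * a₂ * a₃ / θ ^ 4) * (2 * θ) := by gcongr
      _ = _ := by field_simp; ring
  · rintro ⟨v, j⟩ hv ⟨w, k⟩ hw hne
    rw [Finset.mem_product] at hv hw
    have nv := hΩ.1 v hv.1
    have nw := hΩ.1 w hw.1
    have hr : ∀ j, 1 / 2 ≤ r j := fun j => by
      have : (0 : ℝ) ≤ j * θ / 2 := by positivity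
      simp only [r]; linarith
    by_cases hjk : j = k
    · subst hjk
      have hvw : v ≠ w := fun h => hne (by rw [h])
      have h3 := half_le_norm_sub nv nw (hΩ.2 v hv.1 w hw.1 hvw)
      simp only
      rw [← smul_sub, norm_smul, Real.norm_eq_abs, abs_of_nonneg (by linarith [hr j])]
      nlinarith [hr j]
    · have h3 := abs_norm_sub_norm_le (r j • v) (r k • w)
      rw [norm_smul, norm_smul, nv, nw, mul_one, mul_one, Real.norm_eq_abs, Real.norm_eq_abs,
        abs_of_nonneg (show 0 ≤ r j by linarith [hr j]),
        abs_of_nonneg (show 0 ≤ r k by linarith [hr k])] at h3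
      have h4 : (1 : ℝ) ≤ |(j : ℝ) - k| := by
        have : (1 : ℤ) ≤ |(j : ℤ) - k| := Int.one_le_abs (by omega)
        exact_mod_cast this
      have h5 : r j - r k = θ / 2 * ((j : ℝ) - k) := by simp only [r]; ring
      rw [h5, abs_mul, abs_of_pos (by positivity)] at h3
      simp only
      nlinarith
  · intro i
    fin_cases i <;> simp [a] <;> linarith
  · rintro ⟨v, j⟩ hv i
    rw [Finset.mem_product, Finset.mem_range] at hv
    have hr0 : 0 ≤ r j := by simp only [r]; positivity
    have hr1 : r j ≤ 1 := by
      have : (j : ℝ) ≤ m := by exact_mod_cast hv.2.le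
      simp only [r]; nlinarith
    have hv' : |⟪b i, v⟫_ℝ| ≤ a i := by
      have h3 := abs_real_inner_le_norm (b i) v
      rw [b.orthonormal.1 i, hΩ.1 v hv.1, mul_one] at h3
      have h4 := h v hv.1
      fin_cases i
      · simpa [a] using h3
      · simpa [a] using h4.1
      · simpa [a] using h4.2.1
      · simpa [a] using h4.2.2
    simp only [sub_zero, inner_smul_right, abs_mul, abs_of_nonneg hr0]
    nlinarith [abs_nonneg ⟪b i, v⟫_ℝ]

/-- The corner `θ k` of the `θ`-cube with index `k`. -/
def corner (θ : ℝ) (k : CubeIdx) : E4 := WithLp.toLp 2 fun i => θ * (k i : ℝ)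

lemma corner_apply (θ : ℝ) (k : CubeIdx) (i : Fin 4) : corner θ k i = θ * (k i : ℝ) := rfl

lemma norm_le_of_abs_le {x : E4} {a : ℝ} (ha : 0 ≤ a) (h : ∀ i, |x i| ≤ a) : ‖x‖ ≤ 2 * a := by
  refine abs_le_of_sq_le_sq' ?_ (by positivity) |>.2
  rw [EuclideanSpace.real_norm_sq_eq, Fin.sum_univ_four]
  have h2 : ∀ i, x i ^ 2 ≤ a ^ 2 := fun i => sq_le_sq' (by linarith [abs_le.1 (h i)])
    (abs_le.1 (h i)).2
  nlinarith [h2 0, h2 1, h2 2, h2 3]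

lemma norm_lt_of_abs_lt {x : E4} {a : ℝ} (ha : 0 ≤ a) (h : ∀ i, |x i| < a) : ‖x‖ < 2 * a := by
  refine abs_lt_of_sq_lt_sq' ?_ (by positivity) |>.2
  rw [EuclideanSpace.real_norm_sq_eq, Fin.sum_univ_four]
  have h2 : ∀ i, x i ^ 2 < a ^ 2 := fun i => sq_lt_sq' (by linarith [abs_lt.1 (h i)])
    (abs_lt.1 (h i)).2
  nlinarith [h2 0, h2 1, h2 2, h2 3]

lemma norm_sub_corner_lt {θ : ℝ} (h0 : 0 < θ) {k : CubeIdx} {x : E4} (hx : x ∈ cube θ k) :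
    ‖x - corner θ k‖ < 2 * θ := by
  refine norm_lt_of_abs_lt h0.le fun i => ?_
  rw [PiLp.sub_apply, corner_apply, abs_lt]
  have := hx i
  constructor <;> linarith [this.1, this.2]

lemma le_norm_corner_sub {θ : ℝ} (h0 : 0 < θ) {k l : CubeIdx} (h : k ≠ l) :
    θ ≤ ‖corner θ k - corner θ l‖ := by
  obtain ⟨i, hi⟩ := Function.ne_iff.1 h
  have h1 := PiLp.norm_apply_le (corner θ k - corner θ l) i
  rw [PiLp.sub_apply, corner_apply, corner_apply, ← mul_sub, Real.norm_eq_abs, abs_mul,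
    abs_of_pos h0] at h1
  have h4 : (1 : ℝ) ≤ |(k i : ℝ) - l i| := by
    have : (1 : ℤ) ≤ |k i - l i| := Int.one_le_abs (sub_ne_zero.2 hi)
    exact_mod_cast this
  nlinarith

lemma mem_carrier_iff {θ : ℝ} {T : Tube} {x : E4} :
    x ∈ T.carrier θ ↔ ∃ t : ℝ, 0 ≤ t ∧ t ≤ 1 ∧ ‖x - (T.start + t • T.dir)‖ < θ := by
  rw [Tube.carrier, Metric.mem_thickening_iff, segment_eq_image']
  constructor
  · rintro ⟨_, ⟨t, ht, rfl⟩, h⟩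
    rw [add_sub_cancel_left, dist_eq_norm] at h
    exact ⟨t, ht.1, ht.2, h⟩
  · rintro ⟨t, h0, h1, h⟩
    refine ⟨_, ⟨t, ⟨h0, h1⟩, rfl⟩, ?_⟩
    rw [add_sub_cancel_left, dist_eq_norm]
    exact h

/-- A cube that meets a tube has its corner within `3 θ` of the core of the tube. -/
lemma exists_near_core {θ : ℝ} (h0 : 0 < θ) {k : CubeIdx} {T : Tube}
    (h : (cube θ k ∩ T.carrier θ).Nonempty) :
    ∃ t : ℝ, 0 ≤ t ∧ t ≤ 1 ∧ ‖corner θ k - (T.start + t • T.dir)‖ ≤ 3 * θ := by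
  obtain ⟨x, hx, hxT⟩ := h
  obtain ⟨t, ht0, ht1, ht⟩ := mem_carrier_iff.1 hxT
  refine ⟨t, ht0, ht1, ?_⟩
  have h1 := norm_sub_corner_lt h0 hx
  have h2 := norm_sub_le_norm_sub_add_norm_sub (corner θ k) x (T.start + t • T.dir)
  rw [norm_sub_rev (corner θ k) x] at h2
  linarith

/-- Parallel tubes whose centres differ by at most `1/4` along and `θ/2` across the common
direction are essentially identical. -/
lemma carrier_subset_dilate {θ : ℝ} (h0 : 0 < θ) {S T : Tube} {v w : E4} {ρ : ℝ}
    (hS : S.PointsIn v) (hT : T.PointsIn v) (hc : S.center - T.center = ρ • v + w)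
    (hρ : |ρ| ≤ 1 / 4) (hw : ‖w‖ ≤ θ / 2) : S.carrier θ ⊆ T.dilate θ := by
  intro x hx
  obtain ⟨t, ht0, ht1, ht⟩ := mem_carrier_iff.1 hx
  obtain ⟨σ, hσ, hSd⟩ : ∃ σ : ℝ, |σ| = 1 ∧ S.dir = σ • v := by
    rcases hS with h | h
    · exact ⟨1, by simp, by simp [h]⟩
    · exact ⟨-1, by simp, by simp [h]⟩
  obtain ⟨σ', hσ', hTd⟩ : ∃ σ : ℝ, |σ| = 1 ∧ v = σ • T.dir := by
    rcases hT with h | h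
    · exact ⟨1, by simp, by simp [h]⟩
    · exact ⟨-1, by simp, by simp [h]⟩
  set e := x - (S.start + t • S.dir) with he
  set s : ℝ := (ρ + (t - 1 / 2) * σ) * σ' with hs
  have hsabs : |s| ≤ 3 / 4 := by
    rw [hs, abs_mul, hσ', mul_one]
    refine (abs_add_le _ _).trans ?_
    rw [abs_mul, hσ, mul_one]
    have : |t - 1 / 2| ≤ 1 / 2 := abs_le.2 ⟨by linarith, by linarith⟩
    linarith
  have hx' : x = T.center + s • T.dir + (w + e) := by
    have h1 : x = S.center + (t - 1 / 2) • S.dir + e := by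
      rw [he, Tube.center, sub_smul]; abel
    have h2 : S.center = T.center + ρ • v + w := by
      rw [add_assoc, ← hc]; abel
    rw [h1, h2, hs, mul_smul, ← hTd, add_smul, mul_smul, ← hSd]
    abel
  refine ⟨T.center + (1 / 2 : ℝ) • (x - T.center), ?_, ?_⟩
  · rw [mem_carrier_iff]
    have hs2 := abs_le.1 hsabs
    refine ⟨1 / 2 + s / 2, by linarith, by linarith, ?_⟩
    have h3 : T.center + (1 / 2 : ℝ) • (x - T.center) - (T.start + (1 / 2 + s / 2) • T.dir)
        = (1 / 2 : ℝ) • (w + e) := by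
      have : x - T.center = s • T.dir + (w + e) := by
        nth_rewrite 1 [hx']; abel
      rw [this, Tube.center, smul_add, smul_smul, add_smul, div_eq_inv_mul s 2]
      norm_num
      abel
    rw [h3, norm_smul]
    have := norm_add_le w e
    norm_num
    linarith
  · rw [AffineMap.homothety_apply]
    simp

open Classical in
/-- Boundedly many essentially distinct parallel tubes meet a given cube. -/
lemma card_parallel_le {θ : ℝ} (h0 : 0 < θ) {F : Finset Tube} (hF : EssentiallyDistinct θ F)
    {v : E4} (hv : ∀ T ∈ F, T.PointsIn v) {k : CubeIdx}
    (hk : ∀ T ∈ F, (cube θ k ∩ T.carrier θ).Nonempty) : (F.card : ℝ) ≤ 2741856 := by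
  have H : ∀ T : Tube, ∃ p : ℝ × E4, T ∈ F →
      |p.1| ≤ 1 / 2 ∧ ‖p.2‖ ≤ 3 * θ ∧ T.center = corner θ k + p.1 • v + p.2 := by
    intro T
    by_cases hT : T ∈ F
    swap
    · exact ⟨0, fun h => absurd h hT⟩
    obtain ⟨t, ht0, ht1, ht⟩ := exists_near_core h0 (hk T hT)
    have habs : |1 / 2 - t| ≤ 1 / 2 := abs_le.2 ⟨by linarith, by linarith⟩
    obtain ⟨σ, hσ, hTd⟩ : ∃ σ : ℝ, |σ| = 1 ∧ T.dir = σ • v := by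
      rcases hv T hT with h | h
      · exact ⟨1, by simp, by simp [h]⟩
      · exact ⟨-1, by simp, by simp [h]⟩
    refine ⟨((1 / 2 - t) * σ, T.start + t • T.dir - corner θ k), fun _ => ⟨?_, ?_, ?_⟩⟩
    · rw [abs_mul, hσ, mul_one]; exact habs
    · rw [norm_sub_rev]; exact ht
    · simp only
      rw [mul_smul, ← hTd, Tube.center, sub_smul]; abel
  choose p hp using H
  have h := card_le_prod_of_abs_sub_lt F
    (fun T (i : Option (Fin 4)) => i.elim (4 * (p T).1) fun i => 4 / θ * (p T).2 i)
    (fun i => i.elim 2 fun _ => 12) (by rintro (_ | i) <;> norm_num [Option.elim]) ?_ ?_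
  · rw [Fintype.prod_option] at h
    norm_num at h
    exact_mod_cast h
  · rintro T hT (_ | i)
    · simp only [Option.elim, abs_mul]
      have := (hp T hT).1
      norm_num; linarith
    · simp only [Option.elim, abs_mul, abs_of_pos (show 0 < 4 / θ by positivity)]
      have h1 := PiLp.norm_apply_le (p T).2 i
      rw [Real.norm_eq_abs] at h1
      have h2 := h1.trans (hp T hT).2.1
      calc 4 / θ * |(p T).2 i| ≤ 4 / θ * (3 * θ) := by gcongr
        _ = 12 := by field_simp; norm_num
  · intro S hS T hT hST
    by_contra hne
    refine hF S hS T hT hne (Or.inr ?_)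
    refine carrier_subset_dilate h0 (hv S hS) (hv T hT) (ρ := (p S).1 - (p T).1)
      (w := (p S).2 - (p T).2) ?_ ?_ ?_
    · rw [(hp S hS).2.2, (hp T hT).2.2, sub_smul]; abel
    · have := hST none
      simp only [Option.elim] at this
      rw [← mul_sub, abs_mul] at this
      norm_num at this
      linarith
    · have h3 : ∀ i, |((p S).2 - (p T).2) i| ≤ θ / 4 := by
        intro i
        have := hST (some i)
        simp only [Option.elim] at this
        rw [← mul_sub, abs_mul, abs_of_pos (show 0 < 4 / θ by positivity), div_mul_eq_mul_div,
          div_lt_one h0] at this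
        rw [PiLp.sub_apply]; linarith
      have := norm_le_of_abs_le (by positivity) h3
      linarith

/-! ### Counting tubes and cubes in the configurations of a chain -/

lemma card_le_mul_of_fibers {X Y : Type*} [DecidableEq Y] (F : Finset X) (f : X → Y) {a b : ℝ}
    (hb : 0 ≤ b) (ha : ((F.image f).card : ℝ) ≤ a)
    (h : ∀ y ∈ F.image f, ((F.filter fun x => f x = y).card : ℝ) ≤ b) : (F.card : ℝ) ≤ a * b := by
  have h1 : (F.card : ℝ) = ∑ y ∈ F.image f, ((F.filter fun x => f x = y).card : ℝ) := by
    exact_mod_cast Finset.card_eq_sum_card_fiberwise (fun x hx => Finset.mem_image_of_mem f hx)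
  rw [h1]
  refine (Finset.sum_le_card_nsmul _ _ _ h).trans ?_
  rw [nsmul_eq_mul]
  gcongr

open Classical in
/-- Tubes with directions in a box, when at most `m` of them share a direction. -/
lemma card_tubes_le {θ : ℝ} (h0 : 0 < θ) (h1 : θ < 1) {Ω : Finset E4}
    (hΩ : SeparatedDirections θ Ω) {F : Finset Tube} (hF : ∀ T ∈ F, ∃ v ∈ Ω, T.PointsIn v) {m : ℝ}
    (hm0 : 0 ≤ m) (hm : ∀ v ∈ Ω, ((F.filter fun T => T.PointsIn v).card : ℝ) ≤ m)
    (b : OrthonormalBasis (Fin 4) ℝ E4) {a₁ a₂ a₃ : ℝ}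
    (ha₁ : θ ≤ a₁) (ha₂ : θ ≤ a₂) (ha₃ : θ ≤ a₃)
    (h : ∀ T ∈ F, |⟪b 1, T.dir⟫_ℝ| ≤ a₁ ∧ |⟪b 2, T.dir⟫_ℝ| ≤ a₂ ∧ |⟪b 3, T.dir⟫_ℝ| ≤ a₃) :
    (F.card : ℝ) ≤ 209952 * (a₁ * a₂ * a₃ / θ ^ 3) * m := by
  set Ω' := Ω.filter fun v => |⟪b 1, v⟫_ℝ| ≤ a₁ ∧ |⟪b 2, v⟫_ℝ| ≤ a₂ ∧ |⟪b 3, v⟫_ℝ| ≤ a₃ with hΩ'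
  have hsub : Ω' ⊆ Ω := Finset.filter_subset _ _
  have hc := card_directions_le h0 h1 (Ω := Ω') ⟨fun v hv => hΩ.1 v (hsub hv),
    fun v hv w hw => hΩ.2 v (hsub hv) w (hsub hw)⟩ b ha₁ ha₂ ha₃
    (fun v hv => (Finset.mem_filter.1 hv).2)
  have hcov : F ⊆ Ω'.biUnion fun v => F.filter fun T => T.PointsIn v := by
    intro T hT
    obtain ⟨v, hv, hTv⟩ := hF T hT
    rw [Finset.mem_biUnion]
    refine ⟨v, Finset.mem_filter.2 ⟨hv, ?_⟩, Finset.mem_filter.2 ⟨hT, hTv⟩⟩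
    have h3 := h T hT
    rcases hTv with e | e
    · rwa [e] at h3
    · simpa only [e, inner_neg_right, abs_neg] using h3
  calc (F.card : ℝ) ≤ ∑ v ∈ Ω', ((F.filter fun T => T.PointsIn v).card : ℝ) := by
        exact_mod_cast (Finset.card_le_card hcov).trans Finset.card_biUnion_le
    _ ≤ Ω'.card • m := Finset.sum_le_card_nsmul _ _ _ fun v hv => hm v (hsub hv)
    _ = Ω'.card * m := nsmul_eq_mul _ _
    _ ≤ _ := by gcongr

/-- The displacement of two cubes that meet the same tube. -/
lemma exists_displacement {θ : ℝ} (h0 : 0 < θ) {k l : CubeIdx} {T : Tube}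
    (hk : (cube θ k ∩ T.carrier θ).Nonempty) (hl : (cube θ l ∩ T.carrier θ).Nonempty) :
    ∃ (r : ℝ) (w : E4), |r| ≤ 1 ∧ ‖w‖ ≤ 6 * θ ∧ corner θ l - corner θ k = r • T.dir + w := by
  obtain ⟨t, ht0, ht1, ht⟩ := exists_near_core h0 hk
  obtain ⟨t', ht0', ht1', ht'⟩ := exists_near_core h0 hl
  refine ⟨t' - t, (corner θ l - (T.start + t' • T.dir)) - (corner θ k - (T.start + t • T.dir)),
    abs_le.2 ⟨by linarith, by linarith⟩, ?_, ?_⟩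
  · have := norm_sub_le (corner θ l - (T.start + t' • T.dir)) (corner θ k - (T.start + t • T.dir))
    linarith
  · rw [sub_smul]; abel

lemma dev_displacement_le {θ K : ℝ} (h0 : 0 < θ) (hK : 1 ≤ K) {k l : CubeIdx} {T : Tube}
    (hk : (cube θ k ∩ T.carrier θ).Nonempty) (hl : (cube θ l ∩ T.carrier θ).Nonempty)
    {P : Submodule ℝ E4} (hP : dev P T.dir ≤ K * θ) :
    dev P (corner θ l - corner θ k) ≤ 7 * K * θ := by
  obtain ⟨r, w, hr, hw, h⟩ := exists_displacement h0 hk hl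
  rw [h]
  have h1 := dev_add_le P (r • T.dir) w
  rw [dev_smul] at h1
  have h2 := dev_le_norm P w
  have h3 : |r| * dev P T.dir ≤ 1 * (K * θ) := mul_le_mul hr hP (dev_nonneg _ _) (by norm_num)
  nlinarith

lemma norm_displacement_le {θ : ℝ} (h0 : 0 < θ) (h1 : θ < 1) {k l : CubeIdx} {T : Tube}
    (hk : (cube θ k ∩ T.carrier θ).Nonempty) (hl : (cube θ l ∩ T.carrier θ).Nonempty) :
    ‖corner θ l - corner θ k‖ ≤ 7 := by
  obtain ⟨r, w, hr, hw, h⟩ := exists_displacement h0 hk hl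
  rw [h]
  have h3 := norm_add_le (r • T.dir) w
  rw [norm_smul, T.norm_dir, Real.norm_eq_abs] at h3
  linarith

open Classical in
/-- The tubes through two cubes at distance about `r`, with directions close to a given plane. -/
lemma card_tubes_two_cubes_le {θ K r : ℝ} (h0 : 0 < θ) (h1 : θ < 1) (hK : 1 ≤ K) (hr : 0 < r)
    (hr1 : r ≤ 1) {Ω : Finset E4} (hΩ : SeparatedDirections θ Ω) {F : Finset Tube}
    (hF : ∀ T ∈ F, ∃ v ∈ Ω, T.PointsIn v) (hE : EssentiallyDistinct θ F) {k l : CubeIdx}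
    (hk : ∀ T ∈ F, (cube θ k ∩ T.carrier θ).Nonempty)
    (hl : ∀ T ∈ F, (cube θ l ∩ T.carrier θ).Nonempty) {P : Submodule ℝ E4}
    (hP : Module.finrank ℝ P = 2) (hPF : ∀ T ∈ F, dev P T.dir ≤ K * θ)
    (hkl : r ≤ ‖corner θ k - corner θ l‖ + θ) : (F.card : ℝ) ≤ 10 ^ 13 * K ^ 2 / r := by
  -- the tubes point along the displacement of the cubes, hence are nearly orthogonal to `f`
  obtain ⟨f, hf, nf, of⟩ := exists_unit_orthogonal hP (corner θ l - corner θ k)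
  obtain ⟨e, he, ne, oe, -⟩ := exists_frame hP hf nf
  have hP' := finrank_orthogonal_eq_two hP
  obtain ⟨g, hg, ng, -⟩ := exists_unit_orthogonal hP' 0
  obtain ⟨ν, hν, nν, oν, -⟩ := exists_frame hP' hg ng
  obtain ⟨b, -, b1, b2, b3⟩ := exists_orthonormalBasis he hf hg hν ne nf ng nν
    (by rw [real_inner_comm]; exact oe) oν
  have hKθ : θ ≤ K * θ := by nlinarith
  have h := card_tubes_le h0 h1 hΩ hF (m := 2741856) (by norm_num) ?_ b
    (a₁ := 13 * θ / r) (a₂ := K * θ) (a₃ := K * θ) ?_ hKθ hKθ ?_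
  · refine h.trans ?_
    have : 209952 * (13 * θ / r * (K * θ) * (K * θ) / θ ^ 3) * 2741856
        = 7483555961856 * K ^ 2 / r := by
      field_simp; ring
    rw [this]
    gcongr
    norm_num
  · intro v hv
    refine card_parallel_le h0 (k := k) ?_ (fun T hT => (Finset.mem_filter.1 hT).2)
      (fun T hT => hk T (Finset.mem_filter.1 hT).1)
    exact fun S hS T hT => hE S (Finset.mem_filter.1 hS).1 T (Finset.mem_filter.1 hT).1
  · rw [le_div_iff₀ hr]; nlinarith
  · intro T hT
    refine ⟨?_, ?_, ?_⟩
    · obtain ⟨s, w, hs, hw, hd⟩ := exists_displacement h0 (hk T hT) (hl T hT)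
      have hs' : r ≤ |s| + 7 * θ := by
        have h3 := norm_add_le (s • T.dir) w
        rw [← hd, norm_smul, T.norm_dir, Real.norm_eq_abs, norm_sub_rev] at h3
        linarith
      rw [b1, le_div_iff₀ hr]
      have h4 : s * ⟪f, T.dir⟫_ℝ = - ⟪f, w⟫_ℝ := by
        have h5 : ⟪f, corner θ l - corner θ k⟫_ℝ = 0 := by rw [real_inner_comm]; exact of
        rw [hd, inner_add_right, inner_smul_right] at h5
        linarith
      have h5 : |s| * |⟪f, T.dir⟫_ℝ| ≤ 6 * θ := by
        rw [← abs_mul, h4, abs_neg]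
        have := abs_real_inner_le_norm f w
        rw [nf, one_mul] at this; linarith
      have h6 : |⟪f, T.dir⟫_ℝ| ≤ 1 := by
        have := abs_real_inner_le_norm f T.dir; rwa [nf, T.norm_dir, one_mul] at this
      nlinarith [abs_nonneg ⟪f, T.dir⟫_ℝ]
    · rw [b2]; exact (abs_inner_le_dev hg ng _).trans (hPF T hT)
    · rw [b3]; exact (abs_inner_le_dev hν nν _).trans (hPF T hT)

/-- The cubes near the intersection of (translates of) two planes `P, Q`. In `Q` they lie in a
rectangle whose width is controlled by a direction `t` of `Q` that leaves `P` at rate `g`, and whose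
length is controlled by the common deviation of the planes. -/
lemma card_cubes_two_planes_le {θ K D g : ℝ} (h0 : 0 < θ) (h1 : θ < 1) (hK : 1 ≤ K) (hD : 1 ≤ D)
    (hg0 : 0 ≤ g) (hg1 : g ≤ 1) {P Q : Submodule ℝ E4} (hQ : Module.finrank ℝ Q = 2) {t : E4}
    (nt : ‖t‖ = 1) (htQ : dev Q t ≤ K * θ) (hg : g ≤ 8 * dev P t + 200 * K * θ)
    {F : Finset CubeIdx} {x y : E4} (hFP : ∀ k ∈ F, dev P (corner θ k - x) ≤ D * θ)
    (hFQ : ∀ k ∈ F, dev Q (corner θ k - y) ≤ D * θ) (hF : ∀ k ∈ F, ‖corner θ k - x‖ ≤ D) :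
    (F.card : ℝ) ≤ 10 ^ 8 * K * D ^ 4 / ((g + θ) * (commonDev P Q + θ)) := by
  set s := commonDev P Q with hs
  have hs0 : 0 ≤ s := commonDev_nonneg P Q
  have hs1 : s ≤ 1 := commonDev_le_one P Q
  rcases F.eq_empty_or_nonempty with rfl | ⟨k₀, hk₀⟩
  · simp only [Finset.card_empty, Nat.cast_zero]; positivity
  obtain ⟨e, he, ne, de⟩ := exists_unit_near hQ nt htQ
  set ℓ := dev P e with hℓ
  have hℓ0 : 0 ≤ ℓ := dev_nonneg _ _
  have hgℓ : g + θ ≤ 217 * K * (ℓ + θ) := by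
    have := dev_le_add P t e
    nlinarith
  have hdiff : ∀ k ∈ F, dev P (corner θ k - corner θ k₀) ≤ 2 * D * θ ∧
      dev Q (corner θ k - corner θ k₀) ≤ 2 * D * θ ∧ ‖corner θ k - corner θ k₀‖ ≤ 2 * D := by
    intro k hk
    refine ⟨?_, ?_, ?_⟩
    · have h3 := dev_add_le P (corner θ k - x) (-(corner θ k₀ - x))
      rw [dev_neg,
        show corner θ k - x + -(corner θ k₀ - x) = corner θ k - corner θ k₀ by abel] at h3
      linarith [hFP k hk, hFP k₀ hk₀]
    · have h3 := dev_add_le Q (corner θ k - y) (-(corner θ k₀ - y))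
      rw [dev_neg,
        show corner θ k - y + -(corner θ k₀ - y) = corner θ k - corner θ k₀ by abel] at h3
      linarith [hFQ k hk, hFQ k₀ hk₀]
    · have h3 := norm_sub_le (corner θ k - x) (corner θ k₀ - x)
      rw [sub_sub_sub_cancel_right] at h3
      linarith [hF k hk, hF k₀ hk₀]
  -- the direction `E` in `Q` in which the rectangle is narrow: the projection to `Q` of the
  -- component of `e` normal to `P`
  obtain ⟨E, hE, nE, hEw⟩ : ∃ E ∈ Q, ‖E‖ = 1 ∧ ∀ w : E4, dev P w ≤ 2 * D * θ →
      dev Q w ≤ 2 * D * θ → ℓ * |⟪E, w⟫_ℝ| ≤ 4 * D * θ := by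
    set z := e - P.starProjection e with hz
    set p := Q.starProjection z with hp
    have nz : ‖z‖ = ℓ := rfl
    have hzz : ⟪z, e⟫_ℝ = ℓ ^ 2 := by
      have h3 : ⟪P.starProjection e, z⟫_ℝ = 0 :=
        inner_sub_starProjection (P.starProjection_apply_mem e)
      have h4 : ⟪z, z⟫_ℝ = ⟪e, z⟫_ℝ - ⟪P.starProjection e, z⟫_ℝ := by
        nth_rewrite 1 [hz]; rw [inner_sub_left]
      rw [h3, real_inner_self_eq_norm_sq, nz, sub_zero] at h4
      rw [real_inner_comm, ← h4]
    have hpe : ℓ ^ 2 ≤ ‖p‖ := by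
      have h3 := inner_sub_starProjection (P := Q) (x := z) he
      rw [inner_sub_right, ← hp, real_inner_comm, hzz] at h3
      have h4 := real_inner_le_norm e p
      rw [ne, one_mul] at h4
      linarith
    by_cases hp0 : ‖p‖ = 0
    · refine ⟨e, he, ne, fun w _ _ => ?_⟩
      have : ℓ = 0 := by nlinarith
      rw [this, zero_mul]; positivity
    have hppos : 0 < ‖p‖ := lt_of_le_of_ne (norm_nonneg _) (Ne.symm hp0)
    refine ⟨‖p‖⁻¹ • p, Q.smul_mem _ (Q.starProjection_apply_mem z), ?_, fun w hwP hwQ => ?_⟩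
    · rw [norm_smul, norm_inv, norm_norm, inv_mul_cancel₀ hp0]
    have hzw : |⟪z, w⟫_ℝ| ≤ ℓ * (2 * D * θ) := by
      have h3 : ⟪z, w⟫_ℝ = ⟪z, w - P.starProjection w⟫_ℝ := by
        have := inner_sub_starProjection (P := P) (x := e) (P.starProjection_apply_mem w)
        rw [← hz, real_inner_comm] at this
        rw [inner_sub_right, this, sub_zero]
      rw [h3]
      refine (abs_real_inner_le_norm _ _).trans ?_
      rw [nz]
      exact mul_le_mul_of_nonneg_left hwP hℓ0
    have hpw : |⟪p, w⟫_ℝ| ≤ ℓ * (4 * D * θ) := by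
      have h3 : ⟪p, w⟫_ℝ = ⟪z, w⟫_ℝ - ⟪z, w - Q.starProjection w⟫_ℝ := by
        have h4 := inner_sub_starProjection (P := Q) (x := w) (Q.starProjection_apply_mem z)
        have h5 := inner_sub_starProjection (P := Q) (x := z) (Q.starProjection_apply_mem w)
        rw [inner_sub_right] at h4 h5 ⊢
        rw [real_inner_comm z, real_inner_comm (Q.starProjection z) (Q.starProjection w)] at h5
        linarith
      have h6 := abs_real_inner_le_norm z (w - Q.starProjection w)
      have h7 : ‖z‖ * ‖w - Q.starProjection w‖ ≤ ℓ * (2 * D * θ) := by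
        rw [nz]; exact mul_le_mul_of_nonneg_left hwQ hℓ0
      rw [h3]
      have := abs_sub ⟪z, w⟫_ℝ ⟪z, w - Q.starProjection w⟫_ℝ
      linarith
    rw [inner_smul_left, abs_mul, RCLike.conj_to_real, abs_of_pos (inv_pos.2 hppos)]
    by_cases hℓ00 : ℓ = 0
    · rw [hℓ00, zero_mul]; positivity
    have hℓpos : 0 < ℓ := lt_of_le_of_ne hℓ0 (Ne.symm hℓ00)
    calc ℓ * (‖p‖⁻¹ * |⟪p, w⟫_ℝ|) ≤ ℓ * ((ℓ ^ 2)⁻¹ * (ℓ * (4 * D * θ))) := by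
          gcongr
      _ = 4 * D * θ := by field_simp
  obtain ⟨f, hf, nf, of, -⟩ := exists_frame hQ hE nE
  have hQ' := finrank_orthogonal_eq_two hQ
  obtain ⟨n₁, hn₁, nn₁, -⟩ := exists_unit_orthogonal hQ' 0
  obtain ⟨n₂, hn₂, nn₂, on₂, -⟩ := exists_frame hQ' hn₁ nn₁
  obtain ⟨b, b0, b1, b2, b3⟩ := exists_orthonormalBasis hE hf hn₁ hn₂ nE nf nn₁ nn₂ of on₂
  have hg' : 0 < g + θ := by linarith
  have hs' : 0 < s + θ := by linarith
  let a : Fin 4 → ℝ := ![1302 * K * D * θ / (g + θ), 4 * D * θ / (s + θ), 2 * D * θ, 2 * D * θ]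
  have h := card_le_of_separated F (corner θ) b h0
    (fun k _ l _ hkl => le_norm_corner_sub h0 hkl) (corner θ k₀) a ?_ ?_
  · rw [Fin.prod_univ_four] at h
    simp only [a, Matrix.cons_val] at h
    have e1 : 4 * (1302 * K * D * θ / (g + θ)) / θ + 2 ≤ 5212 * K * D / (g + θ) := by
      have h3 : 4 * (1302 * K * D * θ / (g + θ)) / θ = 5208 * K * D / (g + θ) := by
        field_simp; ring
      have h4 : 2 ≤ 4 * K * D / (g + θ) := by
        rw [le_div_iff₀ hg']; nlinarith
      rw [h3]
      calc _ ≤ 5208 * K * D / (g + θ) + 4 * K * D / (g + θ) := by gcongr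
        _ = _ := by ring
    have e2 : 4 * (4 * D * θ / (s + θ)) / θ + 2 ≤ 20 * D / (s + θ) := by
      have h3 : 4 * (4 * D * θ / (s + θ)) / θ = 16 * D / (s + θ) := by
        field_simp; ring
      have h4 : 2 ≤ 4 * D / (s + θ) := by
        rw [le_div_iff₀ hs']; nlinarith
      rw [h3]
      calc _ ≤ 16 * D / (s + θ) + 4 * D / (s + θ) := by gcongr
        _ = _ := by ring
    have e3 : 4 * (2 * D * θ) / θ + 2 ≤ 10 * D := by
      have h3 : 4 * (2 * D * θ) / θ = 8 * D := by field_simp; ring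
      rw [h3]; linarith
    calc (F.card : ℝ) ≤ _ := h
      _ ≤ (5212 * K * D / (g + θ)) * (20 * D / (s + θ)) * (10 * D) * (10 * D) := by gcongr
      _ = 10424000 * K * D ^ 4 / ((g + θ) * (s + θ)) := by field_simp; ring
      _ ≤ _ := by gcongr; norm_num
  · intro i
    fin_cases i <;> simp only [a] <;> simp <;> positivity
  · intro k hk i
    obtain ⟨wP, wQ, wn⟩ := hdiff k hk
    set w := corner θ k - corner θ k₀ with hw
    have hin : ∀ u : E4, ‖u‖ = 1 → |⟪u, w⟫_ℝ| ≤ ‖w‖ := fun u hu => by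
      have := abs_real_inner_le_norm u w; rwa [hu, one_mul] at this
    fin_cases i
    · simp only [a, Fin.zero_eta, Matrix.cons_val]
      rw [b0, le_div_iff₀ hg']
      have h3 := hEw w wP wQ
      have h4 := hin E nE
      have h5 : (ℓ + θ) * |⟪E, w⟫_ℝ| ≤ 6 * D * θ := by nlinarith
      have h6 : |⟪E, w⟫_ℝ| * (g + θ) ≤ |⟪E, w⟫_ℝ| * (217 * K * (ℓ + θ)) := by gcongr
      have h7 : 217 * K * ((ℓ + θ) * |⟪E, w⟫_ℝ|) ≤ 217 * K * (6 * D * θ) := by gcongr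
      linarith
    · simp only [a, Fin.mk_one, Matrix.cons_val]
      rw [b1, le_div_iff₀ hs']
      have h3 := norm_mul_commonDev_le P Q w
      have h4 := max_le wP wQ
      have h5 : ‖w‖ * θ ≤ 2 * D * θ := by gcongr
      have h6 : |⟪f, w⟫_ℝ| * (s + θ) ≤ ‖w‖ * (s + θ) := by
        have := hin f nf; gcongr
      linarith
    · simp only [a, Fin.reduceFinMk, Matrix.cons_val]
      rw [b2]; exact (abs_inner_le_dev hn₁ nn₁ _).trans wQ
    · simp only [a, Fin.reduceFinMk, Matrix.cons_val]
      rw [b3]; exact (abs_inner_le_dev hn₂ nn₂ _).trans wQ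

/-! ### The number of continuations of a chain -/

/-- The distance between the directions of two tubes, up to sign. -/
def lineDist (S T : Tube) : ℝ := min ‖S.dir - T.dir‖ ‖S.dir + T.dir‖

lemma exists_signed_dir {S T : Tube} {t : E4} (ht : S.PointsIn t) {α : ℝ}
    (h : lineDist S T ≤ α) : ∃ t', T.PointsIn t' ∧ ‖t - t'‖ ≤ α := by
  have hS : ‖t - T.dir‖ = ‖S.dir - T.dir‖ ∧ ‖t + T.dir‖ = ‖S.dir + T.dir‖ ∨
      ‖t - T.dir‖ = ‖S.dir + T.dir‖ ∧ ‖t + T.dir‖ = ‖S.dir - T.dir‖ := by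
    rcases ht with e | e
    · rw [e]; simp
    · right
      have : t = -S.dir := by rw [e, neg_neg]
      rw [this]
      refine ⟨?_, ?_⟩
      · rw [← norm_neg]; congr 1; abel
      · rw [← norm_neg]; congr 1; abel
  have h1 : ‖t - T.dir‖ ≤ α ∨ ‖t + T.dir‖ ≤ α := by
    rcases min_le_iff.1 h with h | h <;> rcases hS with ⟨a, b⟩ | ⟨a, b⟩ <;> rw [a, b] <;> tauto
  rcases h1 with h | h
  · exact ⟨T.dir, Or.inl rfl, h⟩
  · exact ⟨-T.dir, Or.inr (by rw [neg_neg]), by rwa [sub_neg_eq_add]⟩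

lemma lineDist_le_of_pointsIn {S T : Tube} {t t' : E4} (ht : S.PointsIn t) (ht' : T.PointsIn t') :
    lineDist S T ≤ ‖t - t'‖ ∧ lineDist S T ≤ ‖t + t'‖ := by
  unfold lineDist
  rcases ht with e | e <;> rcases ht' with e' | e' <;> rw [e, e']
  · exact ⟨min_le_left _ _, min_le_right _ _⟩
  · rw [← sub_eq_add_neg, sub_neg_eq_add]; exact ⟨min_le_right _ _, min_le_left _ _⟩
  · rw [← norm_neg (-t - t'), ← norm_neg (-t + t'),
      show -(-t - t') = t + t' by abel, show -(-t + t') = t - t' by abel]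
    exact ⟨min_le_right _ _, min_le_left _ _⟩
  · rw [← norm_neg (-t - -t'), ← norm_neg (-t + -t'),
      show -(-t - -t') = t - t' by abel, show -(-t + -t') = t + t' by abel]
    exact ⟨min_le_left _ _, min_le_right _ _⟩

lemma Tube.PointsIn.norm_eq {T : Tube} {t : E4} (h : T.PointsIn t) : ‖t‖ = 1 := by
  have h1 := T.norm_dir
  rcases h with e | e <;> rw [e] at h1 <;> simpa using h1

lemma Tube.PointsIn.dev_eq {T : Tube} {t : E4} (h : T.PointsIn t) (P : Submodule ℝ E4) :
    dev P t = dev P T.dir := by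
  rcases h with e | e <;> rw [e]
  rw [dev_neg]

lemma Tube.PointsIn.abs_inner_eq {T : Tube} {t : E4} (h : T.PointsIn t) (x : E4) :
    |⟪x, t⟫_ℝ| = |⟪x, T.dir⟫_ℝ| := by
  rcases h with e | e <;> rw [e]
  rw [inner_neg_right, abs_neg]

/-- A real number in `[0, 1]` lies in a dyadic class down to the scale `θ`. -/
lemma exists_dyadic_class {θ : ℝ} {n : ℕ} (hn : (1 / 2 : ℝ) ^ n ≤ θ) {s : ℝ} (hs0 : 0 ≤ s)
    (hs1 : s ≤ 1) : ∃ l ≤ n, s ≤ (1 / 2) ^ l ∧ (1 / 2) ^ l ≤ 2 * (s + θ) := by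
  induction n with
  | zero => exact ⟨0, le_rfl, by simpa using hs1, by
      simp only [pow_zero] at hn ⊢; linarith⟩
  | succ n ih =>
    by_cases hs : s ≤ (1 / 2) ^ (n + 1)
    · exact ⟨n + 1, le_rfl, hs, by linarith⟩
    · push Not at hs
      have : ∀ m : ℕ, (1 / 2 : ℝ) ^ (m + 1) < s → ∃ l ≤ m, s ≤ (1 / 2) ^ l ∧
          (1 / 2) ^ l ≤ 2 * (s + θ) := by
        intro m
        induction m with
        | zero =>
          intro h
          refine ⟨0, le_rfl, by simpa using hs1, ?_⟩
          have : (0 : ℝ) < (1 / 2) ^ (n + 1) := by positivity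
          norm_num at h ⊢; linarith
        | succ m ihm =>
          intro h
          by_cases h2 : s ≤ (1 / 2) ^ (m + 1)
          · refine ⟨m + 1, le_rfl, h2, ?_⟩
            have : (0 : ℝ) < (1 / 2) ^ (n + 1) := by positivity
            rw [pow_succ] at h; linarith
          · push Not at h2
            obtain ⟨l, hl, h3⟩ := ihm h2
            exact ⟨l, by omega, h3⟩
      obtain ⟨l, hl, h3⟩ := this n hs
      exact ⟨l, by omega, h3⟩

/-- Incidences `(q, T)` between vertices `q = (Q, i)`, each carrying a plane `P q`, and tubes `T`
through the cube `Q` in directions close to `P q`. The planes of two vertices of a tube are at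
distance at most `β`, and two tubes of a vertex at angle at most `α`. -/
structure IncidenceData {B₁ : ℕ} (θ K α β : ℝ) (𝕋 : Finset Tube)
    (P : CubeIdx × Fin B₁ → Submodule ℝ E4) (J : Finset ((CubeIdx × Fin B₁) × Tube)) : Prop where
  mem : ∀ x ∈ J, x.2 ∈ 𝕋
  meets : ∀ x ∈ J, (cube θ x.1.1 ∩ x.2.carrier θ).Nonempty
  dev_le : ∀ x ∈ J, dev (P x.1) x.2.dir ≤ K * θ
  rank : ∀ x ∈ J, Module.finrank ℝ (P x.1) = 2
  plane_le : ∀ x ∈ J, ∀ y ∈ J, x.2 = y.2 → planeDist (P x.1) (P y.1) ≤ β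
  line_le : ∀ x ∈ J, ∀ y ∈ J, x.1 = y.1 → lineDist x.2 y.2 ≤ α

/-- Two incidences on the same tube whose vertices are far apart and have transverse planes. -/
def TubeStep {B₁ : ℕ} (θ K c β r : ℝ) (P : CubeIdx × Fin B₁ → Submodule ℝ E4)
    (x y : (CubeIdx × Fin B₁) × Tube) : Prop :=
  x.2 = y.2 ∧ c * β ≤ planeDist (P x.1) (P y.1) + 2 * K * θ ∧
    r ≤ ‖corner θ x.1.1 - corner θ y.1.1‖ + θ

/-- Two incidences at the same vertex with transverse tubes. -/
def VertexStep {B₁ : ℕ} (θ K c α : ℝ) (x y : (CubeIdx × Fin B₁) × Tube) : Prop :=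
  x.1 = y.1 ∧ c * α ≤ lineDist x.2 y.2 + 2 * K * θ

section
variable {B₁ : ℕ} {θ K α β c r s : ℝ} {𝕋 : Finset Tube} {P : CubeIdx × Fin B₁ → Submodule ℝ E4}
  {J : Finset ((CubeIdx × Fin B₁) × Tube)}

/-- Six good steps starting with `x₁` satisfy the hypotheses on four planes and four lines, after
the signs of the directions have been chosen. -/
lemma exists_chainData (hJ : IncidenceData θ K α β 𝕋 P J) (h0 : 0 < θ) (hK : 1 ≤ K)
    (hα : 2 * K * θ ≤ α) (hβ : 2 * K * θ ≤ β) (hs : 2 * K * θ ≤ s) (hc0 : 0 < c) (hc1 : c ≤ 1)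
    (hcα : c * α ≤ 1) {x₁ y₁ x₂ y₂ x₃ y₃ x₄ : (CubeIdx × Fin B₁) × Tube}
    (hx₁ : x₁ ∈ J) (hy₁ : y₁ ∈ J) (hx₂ : x₂ ∈ J) (hy₂ : y₂ ∈ J) (hx₃ : x₃ ∈ J) (hy₃ : y₃ ∈ J)
    (hx₄ : x₄ ∈ J) (r₁ : TubeStep θ K c β r P x₁ y₁) (s₁ : VertexStep θ K c α y₁ x₂)
    (r₂ : TubeStep θ K c β r P x₂ y₂) (s₂ : VertexStep θ K c α y₂ x₃)
    (r₃ : TubeStep θ K c β r P x₃ y₃) (s₃ : VertexStep θ K c α y₃ x₄)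
    (hW : commonDev (P x₁.1) (P y₂.1) ≤ commonDev (P y₁.1) (P y₃.1))
    (hsW : commonDev (P y₁.1) (P y₃.1) < s) :
    ∃ t₂ t₃ t₄, x₃.2.PointsIn t₃ ∧ x₄.2.PointsIn t₄ ∧
      ChainData (P x₁.1) (P y₁.1) (P y₂.1) (P y₃.1) x₁.2.dir t₂ t₃ t₄ (2 * K * θ) α β c s := by
  have hp₁ : x₁.2.PointsIn x₁.2.dir := Or.inl rfl
  have l₁ : lineDist x₁.2 x₂.2 ≤ α := by rw [r₁.1]; exact hJ.line_le _ hy₁ _ hx₂ s₁.1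
  obtain ⟨t₂, hp₂, h12⟩ := exists_signed_dir hp₁ l₁
  have l₂ : lineDist x₂.2 x₃.2 ≤ α := by rw [r₂.1]; exact hJ.line_le _ hy₂ _ hx₃ s₂.1
  obtain ⟨t₃, hp₃, h23⟩ := exists_signed_dir hp₂ l₂
  have l₃ : lineDist x₃.2 x₄.2 ≤ α := by rw [r₃.1]; exact hJ.line_le _ hy₃ _ hx₄ s₃.1
  obtain ⟨t₄, hp₄, h34⟩ := exists_signed_dir hp₃ l₃
  have hKθ : K * θ ≤ 2 * K * θ := by nlinarith
  have m₁ := s₁.2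
  have m₂ := s₂.2
  rw [← r₁.1] at m₁
  rw [← r₂.1] at m₂
  have k12 := lineDist_le_of_pointsIn hp₁ hp₂
  have k23 := lineDist_le_of_pointsIn hp₂ hp₃
  have i21 := hJ.dev_le _ hx₂
  have i32 := hJ.dev_le _ hx₃
  have i43 := hJ.dev_le _ hx₄
  have i11 := hJ.dev_le _ hy₁
  have i22 := hJ.dev_le _ hy₂
  have i33 := hJ.dev_le _ hy₃
  rw [← s₁.1] at i21
  rw [← s₂.1] at i32
  rw [← s₃.1] at i43
  rw [← r₁.1] at i11
  rw [← r₂.1] at i22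
  rw [← r₃.1] at i33
  have d12 := hJ.plane_le _ hx₂ _ hy₂ r₂.1
  have d23 := hJ.plane_le _ hx₃ _ hy₃ r₃.1
  have c12 := r₂.2.1
  rw [← s₁.1] at d12 c12
  rw [← s₂.1] at d23
  refine ⟨t₂, t₃, t₄, hp₃, hp₄, ?_⟩
  exact { r0 := hJ.rank _ hx₁, r1 := hJ.rank _ hy₁, r2 := hJ.rank _ hy₂, r3 := hJ.rank _ hy₃
          n1 := hp₁.norm_eq, n2 := hp₂.norm_eq, n3 := hp₃.norm_eq, n4 := hp₄.norm_eq
          δpos := by positivity, δα := hα, δβ := hβ, δs := hs, cpos := hc0, cle := hc1, cα := hcα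
          d01 := hJ.plane_le _ hx₁ _ hy₁ r₁.1, d12 := d12, d23 := d23
          l01 := r₁.2.1, l12 := c12
          a12 := h12, a23 := h23, a34 := h34
          m12 := by linarith [k12.1], p12 := by linarith [k12.2]
          m23 := by linarith [k23.1], p23 := by linarith [k23.2]
          i10 := (hJ.dev_le _ hx₁).trans hKθ, i11 := i11.trans hKθ
          i21 := by rw [hp₂.dev_eq]; exact i21.trans hKθ
          i22 := by rw [hp₂.dev_eq]; exact i22.trans hKθ
          i32 := by rw [hp₃.dev_eq]; exact i32.trans hKθ
          i33 := by rw [hp₃.dev_eq]; exact i33.trans hKθ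
          i43 := by rw [hp₄.dev_eq]; exact i43.trans hKθ
          s02 := hW.trans_lt hsW, s13 := hsW }

/-- The product of the bounds for the successive choices in a chain: in the number of directions the
factor `αβ s`, and in the number of cubes near two planes its inverse. -/
lemma chain_bound_le {m D B₂ : ℝ} (h0 : 0 < θ) (hK : 1 ≤ K) (hα0 : 0 < α) (hα4 : α ≤ 4 * K)
    (hβ0 : 0 < β) (hc0 : 0 < c) (hc1 : c ≤ 1) (hr0 : 0 < r) (hm0 : 0 ≤ m) (hD0 : 0 ≤ D)
    (hB0 : 0 ≤ B₂) (hs0 : 0 < s) :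
    209952 * (5 * α * (18 * K * θ + 15 * (α * β)) * (10 ^ 7 * s / c ^ 4) / θ ^ 3) * m *
      (D * (10 ^ 8 * K * (7 * K) ^ 4 / ((c ^ 2 * α * β + θ) * (s / (8 * K))) *
        (10 ^ 13 * K ^ 2 / r * (B₂ * (10 ^ 13 * K ^ 2 / r))))) ≤
      10 ^ 54 * K ^ 12 * m * D * B₂ / (c ^ 6 * θ ^ 3 * r ^ 2) := by
  have hg0 : 0 < c ^ 2 * α * β := by positivity
  obtain ⟨G, hG⟩ : ∃ G, G = c ^ 2 * α * β + θ := ⟨_, rfl⟩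
  have hG0 : 0 < G := by linarith
  have e1 : 18 * K * θ + 15 * (α * β) ≤ 18 * K * (G / c ^ 2) := by
    have hc2 : c ^ 2 ≤ 1 := pow_le_one₀ hc0.le hc1
    have : θ + α * β ≤ G / c ^ 2 := by
      rw [le_div_iff₀ (by positivity), hG]; nlinarith
    have : 18 * K * (θ + α * β) ≤ 18 * K * (G / c ^ 2) := by gcongr
    have := mul_pos hα0 hβ0
    nlinarith
  rw [← hG]
  have e2 : 5 * α * (18 * K * θ + 15 * (α * β)) ≤ 5 * (4 * K) * (18 * K * (G / c ^ 2)) := by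
    have : 0 < 18 * K * θ + 15 * (α * β) := by positivity
    gcongr
  set X := D * (10 ^ 8 * K * (7 * K) ^ 4 / (G * (s / (8 * K))) *
        (10 ^ 13 * K ^ 2 / r * (B₂ * (10 ^ 13 * K ^ 2 / r)))) with hX
  have hX0 : 0 ≤ X := by positivity
  have e3 : 209952 * (5 * α * (18 * K * θ + 15 * (α * β)) * (10 ^ 7 * s / c ^ 4) / θ ^ 3) * m ≤
      209952 * (5 * (4 * K) * (18 * K * (G / c ^ 2)) * (10 ^ 7 * s / c ^ 4) / θ ^ 3) * m := by
    gcongr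
  have e4 := mul_le_mul_of_nonneg_right e3 hX0
  have e5 : 209952 * (5 * (4 * K) * (18 * K * (G / c ^ 2)) * (10 ^ 7 * s / c ^ 4) / θ ^ 3) * m * X
      = (209952 * 20 * 18 * 10 ^ 7 * 10 ^ 8 * 2401 * 8 * 10 ^ 26) *
          (K ^ 12 * m * D * B₂ / (c ^ 6 * θ ^ 3 * r ^ 2)) := by
    rw [hX]
    field_simp
    ring
  have e6 : (209952 * 20 * 18 * 10 ^ 7 * 10 ^ 8 * 2401 * 8 * 10 ^ 26) *
      (K ^ 12 * m * D * B₂ / (c ^ 6 * θ ^ 3 * r ^ 2)) ≤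
      10 ^ 54 * (K ^ 12 * m * D * B₂ / (c ^ 6 * θ ^ 3 * r ^ 2)) := by
    refine mul_le_mul_of_nonneg_right (by norm_num) (by positivity)
  rw [e5] at e4
  refine e4.trans (e6.trans (le_of_eq ?_))
  ring

set_option maxHeartbeats 1600000 in
open Classical in
/-- Upper bound for the number of continuations of a chain. The last tube lies in a box of
directions determined by the start; given it and its vertex, the middle cube lies near the
intersection of two known planes. The dimensions of the box and of the intersection compensate each
other. -/
lemma card_chains_le (hJ : IncidenceData θ K α β 𝕋 P J) (h0 : 0 < θ) (h1 : θ < 1) (hK : 1 ≤ K)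
    (hα : 2 * K * θ ≤ α) (hβ : 2 * K * θ ≤ β) (hα4 : α ≤ 4 * K) (hc0 : 0 < c) (hc1 : c ≤ 1)
    (hcα : c * α ≤ 1) (hcβ : c * β ≤ 1) (hr0 : 0 < r) (hr1 : r ≤ 1)
    {Ω : Finset E4} (hΩ : SeparatedDirections θ Ω) (h𝕋 : ∀ T ∈ 𝕋, ∃ v ∈ Ω, T.PointsIn v)
    (hE : EssentiallyDistinct θ 𝕋) {m : ℝ} (hm0 : 0 ≤ m)
    (hm : ∀ v ∈ Ω, ((𝕋.filter fun T => T.PointsIn v).card : ℝ) ≤ m) {n : ℕ}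
    (hn : (1 / 2 : ℝ) ^ n ≤ θ) (hn' : θ ≤ 2 * (1 / 2) ^ n) {D : ℝ} (hD0 : 0 ≤ D)
    (hD : ∀ T, ((J.filter fun x => x.2 = T).card : ℝ) ≤ D) {B₂ : ℝ} (hB0 : 0 ≤ B₂)
    (hB : ∀ T Q, ((J.filter fun x => x.2 = T ∧ x.1.1 = Q).card : ℝ) ≤ B₂)
    {x₁ y₁ : (CubeIdx × Fin B₁) × Tube} (hx₁ : x₁ ∈ J) (hy₁ : y₁ ∈ J)
    (r₁ : TubeStep θ K c β r P x₁ y₁) :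
    (((((((J ×ˢ J) ×ˢ J) ×ˢ J) ×ˢ J).filter fun z =>
        VertexStep θ K c α y₁ z.1.1.1.1 ∧ TubeStep θ K c β r P z.1.1.1.1 z.1.1.1.2 ∧
        VertexStep θ K c α z.1.1.1.2 z.1.1.2 ∧ TubeStep θ K c β r P z.1.1.2 z.1.2 ∧
        VertexStep θ K c α z.1.2 z.2 ∧
        commonDev (P x₁.1) (P z.1.1.1.2.1) ≤ commonDev (P y₁.1) (P z.1.2.1)).card : ℝ)) ≤
      (n + 1) * (10 ^ 54 * K ^ 12 * m * D * B₂ / (c ^ 6 * θ ^ 3 * r ^ 2)) := by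
  set F := ((((J ×ˢ J) ×ˢ J) ×ˢ J) ×ˢ J).filter fun z =>
        VertexStep θ K c α y₁ z.1.1.1.1 ∧ TubeStep θ K c β r P z.1.1.1.1 z.1.1.1.2 ∧
        VertexStep θ K c α z.1.1.1.2 z.1.1.2 ∧ TubeStep θ K c β r P z.1.1.2 z.1.2 ∧
        VertexStep θ K c α z.1.2 z.2 ∧
        commonDev (P x₁.1) (P z.1.1.1.2.1) ≤ commonDev (P y₁.1) (P z.1.2.1) with hF
  have hmem : ∀ z ∈ F, z.1.1.1.1 ∈ J ∧ z.1.1.1.2 ∈ J ∧ z.1.1.2 ∈ J ∧ z.1.2 ∈ J ∧ z.2 ∈ J ∧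
        VertexStep θ K c α y₁ z.1.1.1.1 ∧ TubeStep θ K c β r P z.1.1.1.1 z.1.1.1.2 ∧
        VertexStep θ K c α z.1.1.1.2 z.1.1.2 ∧ TubeStep θ K c β r P z.1.1.2 z.1.2 ∧
        VertexStep θ K c α z.1.2 z.2 ∧
        commonDev (P x₁.1) (P z.1.1.1.2.1) ≤ commonDev (P y₁.1) (P z.1.2.1) := by
    intro z hz
    simp only [hF, Finset.mem_filter, Finset.mem_product] at hz
    tauto
  have hα0 : 0 < α := lt_of_lt_of_le (by positivity) hα
  have hβ0 : 0 < β := lt_of_lt_of_le (by positivity) hβ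
  set g : ℝ := c ^ 2 * α * β with hg
  have hg0 : 0 < g := by positivity
  have hg1 : g ≤ 1 := by
    have : (c * α) * (c * β) ≤ 1 * 1 := by gcongr
    rw [hg]; nlinarith
  -- the chains are sorted by the dyadic size of the common deviation of the planes of `q₁` and `q₃`
  choose! L hLn hLs hLs' using fun s (hs : 0 ≤ s ∧ s ≤ 1) => exists_dyadic_class hn hs.1 hs.2
  let lev : (((((CubeIdx × Fin B₁) × Tube) × ((CubeIdx × Fin B₁) × Tube)) ×
      ((CubeIdx × Fin B₁) × Tube)) × ((CubeIdx × Fin B₁) × Tube)) ×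
      ((CubeIdx × Fin B₁) × Tube) → ℕ := fun z => L (commonDev (P y₁.1) (P z.1.2.1))
  have hbound : ∀ Q : Submodule ℝ E4, 0 ≤ commonDev (P y₁.1) Q ∧ commonDev (P y₁.1) Q ≤ 1 :=
    fun Q => ⟨commonDev_nonneg _ _, commonDev_le_one _ _⟩
  refine card_le_mul_of_fibers F lev (by positivity) ?_ ?_
  · have : F.image lev ⊆ Finset.range (n + 1) := by
      intro l hl
      obtain ⟨z, -, rfl⟩ := Finset.mem_image.1 hl
      rw [Finset.mem_range, Nat.lt_succ_iff]
      exact hLn _ (hbound _)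
    have := Finset.card_le_card this
    rw [Finset.card_range] at this
    exact_mod_cast this
  intro l hl
  obtain ⟨zl, -, hzl⟩ := Finset.mem_image.1 hl
  have hln : l ≤ n := hzl ▸ hLn _ (hbound _)
  set F₀ := F.filter fun z => lev z = l with hF₀
  set s : ℝ := 4 * K * (1 / 2) ^ l with hs
  have hpow : (0 : ℝ) < (1 / 2) ^ l := by positivity
  have hs0 : 0 < s := by positivity
  have hpow' : (1 / 2 : ℝ) ^ n ≤ (1 / 2) ^ l :=
    pow_le_pow_of_le_one (by norm_num) (by norm_num) hln
  have hsθ : 2 * K * θ ≤ s := by rw [hs]; nlinarith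
  have hlev : ∀ z ∈ F₀, commonDev (P y₁.1) (P z.1.2.1) < s ∧
      s ≤ 8 * K * (commonDev (P y₁.1) (P z.1.2.1) + θ) := by
    intro z hz
    have hz' := (Finset.mem_filter.1 hz).2
    have h3 := hLs _ (hbound (P z.1.2.1))
    have h4 := hLs' _ (hbound (P z.1.2.1))
    simp only [lev] at hz'
    rw [hz'] at h3 h4
    rw [hs]
    constructor <;> nlinarith
  have hchain : ∀ z ∈ F₀, ∃ t₂ t₃ t₄, z.1.1.2.2.PointsIn t₃ ∧ z.2.2.PointsIn t₄ ∧
      ChainData (P x₁.1) (P y₁.1) (P z.1.1.1.2.1) (P z.1.2.1) x₁.2.dir t₂ t₃ t₄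
        (2 * K * θ) α β c s := by
    intro z hz
    obtain ⟨j1, j2, j3, j4, j5, s1, r2, s2, r3, s3, hW⟩ := hmem z (Finset.mem_filter.1 hz).1
    exact exists_chainData hJ h0 hK hα hβ hsθ hc0 hc1 hcα hx₁ hy₁ j1 j2 j3 j4 j5 r₁ s1 r2 s2 r3 s3
      hW (hlev z hz).1
  -- the last tube
  set U₁ : ℝ := 209952 * (5 * α * (18 * K * θ + 15 * (α * β)) * (10 ^ 7 * s / c ^ 4) / θ ^ 3) * m
    with hU₁
  have hc4 : c ^ 4 ≤ 1 := pow_le_one₀ hc0.le hc1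
  have hKθ : θ ≤ K * θ := by nlinarith
  have B1 : ((F₀.image fun z => z.2.2).card : ℝ) ≤ U₁ := by
    have hi11 : dev (P y₁.1) x₁.2.dir ≤ 2 * K * θ := by
      have := hJ.dev_le _ hy₁
      rw [← r₁.1] at this
      nlinarith
    obtain ⟨b, hb0, hb0Q, hb1Q, hb2, hb3, hb3'⟩ := exists_adapted_basis (hJ.rank _ hx₁)
      (hJ.rank _ hy₁) x₁.2.norm_dir (δ := 2 * K * θ)
      ((hJ.dev_le _ hx₁).trans (by nlinarith)) hi11
    have hsub : F₀.image (fun z => z.2.2) ⊆ 𝕋 := by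
      intro T hT
      obtain ⟨z, hz, rfl⟩ := Finset.mem_image.1 hT
      exact hJ.mem _ (hmem z (Finset.mem_filter.1 hz).1).2.2.2.2.1
    refine card_tubes_le h0 h1 hΩ (fun T hT => h𝕋 T (hsub hT)) hm0 ?_ b ?_ ?_ ?_ ?_
    · intro v hv
      refine le_trans (Nat.cast_le.2 (Finset.card_le_card ?_)) (hm v hv)
      exact Finset.filter_subset_filter _ hsub
    · nlinarith
    · have := mul_pos hα0 hβ0
      nlinarith
    · rw [le_div_iff₀ (by positivity)]
      nlinarith
    · intro T hT
      obtain ⟨z, hz, rfl⟩ := Finset.mem_image.1 hT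
      obtain ⟨t₂, t₃, t₄, -, hp₄, C⟩ := hchain z hz
      rw [← hp₄.abs_inner_eq, ← hp₄.abs_inner_eq, ← hp₄.abs_inner_eq]
      refine ⟨?_, ?_, ?_⟩
      · refine coeff_frame_le (e := b 0) (b.orthonormal.1 1)
          (b.orthonormal.2 (show (0 : Fin 4) ≠ 1 by decide)) ?_
        have h3 := norm_add₃_le (a := t₄ - t₃) (b := t₃ - t₂) (c := t₂ - x₁.2.dir)
        have h4 := norm_add_le (t₄ - x₁.2.dir) (x₁.2.dir - b 0)
        rw [show t₄ - t₃ + (t₃ - t₂) + (t₂ - x₁.2.dir) = t₄ - x₁.2.dir by abel,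
          norm_sub_rev t₄ t₃, norm_sub_rev t₃ t₂, norm_sub_rev t₂ x₁.2.dir] at h3
        rw [sub_add_sub_cancel] at h4
        linarith [C.a12, C.a23, C.a34]
      · have h3 := abs_inner_le_dev hb2 (b.orthonormal.1 2) t₄
        have h4 := C.dev_last_le
        linarith
      · rw [le_div_iff₀ (by positivity), mul_comm]
        exact C.abs_inner_last_le (b.orthonormal.1 3) hb3 hb3'
  -- the middle cube
  set U₃ : ℝ := 10 ^ 8 * K * (7 * K) ^ 4 / ((g + θ) * (s / (8 * K))) with hU₃
  set U₄ : ℝ := 10 ^ 13 * K ^ 2 / r with hU₄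
  have hU₃0 : 0 ≤ U₃ := by positivity
  have hU₄0 : 0 ≤ U₄ := by positivity
  have hfinal : U₁ * (D * (U₃ * (U₄ * (B₂ * U₄)))) ≤
      10 ^ 54 * K ^ 12 * m * D * B₂ / (c ^ 6 * θ ^ 3 * r ^ 2) :=
    chain_bound_le h0 hK hα0 hα4 hβ0 hc0 hc1 hr0 hm0 hD0 hB0 hs0
  refine le_trans ?_ hfinal
  refine card_le_mul_of_fibers F₀ (fun z => z.2.2) (by positivity) B1 fun T₄ _ => ?_
  set F₁ := F₀.filter fun z => z.2.2 = T₄ with hF₁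
  refine card_le_mul_of_fibers F₁ (fun z => z.2.1) (by positivity) ?_ fun q₃ hq₃ => ?_
  · refine le_trans (Nat.cast_le.2 (Finset.card_le_card_of_injOn (fun q => (q, T₄)) ?_ ?_)) (hD T₄)
    · intro q hq
      obtain ⟨z, hz, rfl⟩ := Finset.mem_image.1 (Finset.mem_coe.1 hq)
      rw [hF₁, Finset.mem_filter] at hz
      rw [Finset.mem_coe, Finset.mem_filter]
      refine ⟨?_, rfl⟩
      rw [← hz.2]
      exact (hmem z (Finset.mem_filter.1 hz.1).1).2.2.2.2.1
    · intro a _ b _ h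
      exact (Prod.mk.injEq _ _ _ _ ▸ h).1
  set F₂ := F₁.filter fun z => z.2.1 = q₃ with hF₂
  have hF₂F : ∀ z ∈ F₂, z ∈ F₀ ∧ z ∈ F ∧ z.2.2 = T₄ ∧ z.2.1 = q₃ := by
    intro z hz
    rw [hF₂, Finset.mem_filter, hF₁, Finset.mem_filter] at hz
    exact ⟨hz.1.1, (Finset.mem_filter.1 hz.1.1).1, hz.1.2, hz.2⟩
  -- facts on the elements of the fibre
  have hfib : ∀ z ∈ F₂, z.1.1.1.1.1 = y₁.1 ∧ z.1.1.1.1.2 = z.1.1.1.2.2 ∧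
      z.1.1.1.2.1 = z.1.1.2.1 ∧ z.1.1.2.2 = z.1.2.2 ∧ z.1.2.1 = q₃ := by
    intro z hz
    obtain ⟨-, hzF, -, hq⟩ := hF₂F z hz
    obtain ⟨-, -, -, -, -, s1, r2, s2, r3, s3, -⟩ := hmem z hzF
    exact ⟨s1.1.symm, r2.1, s2.1, r3.1, s3.1.trans hq⟩
  refine card_le_mul_of_fibers F₂ (fun z => z.1.1.1.2.1.1) (by positivity) ?_ fun Q₂ hQ₂ => ?_
  · rcases F₂.eq_empty_or_nonempty with hemp | ⟨z₀, hz₀⟩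
    · rw [hemp]; simpa using hU₃0
    obtain ⟨hz₀0, hz₀F, -, -⟩ := hF₂F z₀ hz₀
    obtain ⟨t₂, t₃, t₄, hp₃, -, C⟩ := hchain z₀ hz₀0
    obtain ⟨e1, e2, e3, e4, e5⟩ := hfib z₀ hz₀
    obtain ⟨j1, j2, j3, j4, j5, -⟩ := hmem z₀ hz₀F
    have hs' := (hlev z₀ hz₀0).2
    have hrank := hJ.rank _ j4
    have hdev := hJ.dev_le _ j4
    rw [e5] at hs' hrank hdev
    rw [← e4] at hdev
    have hT := C.transverse_third
    rw [hp₃.dev_eq] at hT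
    have h3 := card_cubes_two_planes_le (D := 7 * K) (g := g) h0 h1 hK (by linarith) hg0.le hg1
      (P := P y₁.1) (Q := P q₃) hrank (t := z₀.1.1.2.2.dir) z₀.1.1.2.2.norm_dir hdev
      (by rw [hg]; nlinarith) (F := F₂.image fun z => z.1.1.1.2.1.1) (x := corner θ y₁.1.1)
      (y := corner θ q₃.1) ?_ ?_ ?_
    · refine h3.trans ?_
      rw [hU₃]
      have hgθ : 0 < g + θ := by linarith
      have : s / (8 * K) ≤ commonDev (P y₁.1) (P q₃) + θ := by
        rw [div_le_iff₀ (by positivity)]; linarith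
      gcongr
    · intro k hk
      obtain ⟨z, hz, rfl⟩ := Finset.mem_image.1 hk
      obtain ⟨-, hzF, -, -⟩ := hF₂F z hz
      obtain ⟨e1, e2, e3, e4, e5⟩ := hfib z hz
      obtain ⟨j1, j2, j3, j4, j5, -⟩ := hmem z hzF
      have m1 := hJ.meets _ j1
      have m2 := hJ.meets _ j2
      have m3 := hJ.dev_le _ j1
      rw [e1] at m1 m3
      rw [← e2] at m2
      exact dev_displacement_le h0 hK m1 m2 m3
    · intro k hk
      obtain ⟨z, hz, rfl⟩ := Finset.mem_image.1 hk
      obtain ⟨-, hzF, -, -⟩ := hF₂F z hz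
      obtain ⟨e1, e2, e3, e4, e5⟩ := hfib z hz
      obtain ⟨j1, j2, j3, j4, j5, -⟩ := hmem z hzF
      have m1 := hJ.meets _ j3
      have m2 := hJ.meets _ j4
      have m3 := hJ.dev_le _ j4
      rw [e5] at m2 m3
      rw [← e3, e4] at m1
      exact dev_displacement_le h0 hK m2 m1 m3
    · intro k hk
      obtain ⟨z, hz, rfl⟩ := Finset.mem_image.1 hk
      obtain ⟨-, hzF, -, -⟩ := hF₂F z hz
      obtain ⟨e1, e2, e3, e4, e5⟩ := hfib z hz
      obtain ⟨j1, j2, j3, j4, j5, -⟩ := hmem z hzF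
      have m1 := hJ.meets _ j1
      have m2 := hJ.meets _ j2
      rw [e1] at m1
      rw [← e2] at m2
      have := norm_displacement_le h0 h1 m1 m2
      linarith
  -- the second tube
  set F₃ := F₂.filter fun z => z.1.1.1.2.1.1 = Q₂ with hF₃
  have hF₃F : ∀ z ∈ F₃, z ∈ F₂ ∧ z ∈ F ∧ z.1.1.1.2.1.1 = Q₂ := fun z hz =>
    ⟨(Finset.mem_filter.1 hz).1, (hF₂F z (Finset.mem_filter.1 hz).1).2.1,
      (Finset.mem_filter.1 hz).2⟩
  refine card_le_mul_of_fibers F₃ (fun z => z.1.1.1.1.2) (by positivity) ?_ fun T₂ hT₂ => ?_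
  · rcases F₃.eq_empty_or_nonempty with hemp | ⟨z₀, hz₀⟩
    · rw [hemp]; simpa using hU₄0
    have hsub : F₃.image (fun z => z.1.1.1.1.2) ⊆ 𝕋 := by
      intro T hT
      obtain ⟨z, hz, rfl⟩ := Finset.mem_image.1 hT
      exact hJ.mem _ (hmem z (hF₃F z hz).2.1).1
    refine card_tubes_two_cubes_le h0 h1 hK hr0 hr1 hΩ (fun T hT => h𝕋 T (hsub hT))
      (fun S hS T hT => hE S (hsub hS) T (hsub hT)) (k := y₁.1.1) (l := Q₂) (P := P y₁.1) ?_ ?_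
      (hJ.rank _ hy₁) ?_ ?_
    · intro T hT
      obtain ⟨z, hz, rfl⟩ := Finset.mem_image.1 hT
      have m1 := hJ.meets _ (hmem z (hF₃F z hz).2.1).1
      rwa [(hfib z (hF₃F z hz).1).1] at m1
    · intro T hT
      obtain ⟨z, hz, rfl⟩ := Finset.mem_image.1 hT
      have m1 := hJ.meets _ (hmem z (hF₃F z hz).2.1).2.1
      rwa [← (hfib z (hF₃F z hz).1).2.1, (hF₃F z hz).2.2] at m1
    · intro T hT
      obtain ⟨z, hz, rfl⟩ := Finset.mem_image.1 hT
      have m1 := hJ.dev_le _ (hmem z (hF₃F z hz).2.1).1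
      rwa [(hfib z (hF₃F z hz).1).1] at m1
    · have m1 := (hmem z₀ (hF₃F z₀ hz₀).2.1).2.2.2.2.2.2.1.2.2
      rwa [(hfib z₀ (hF₃F z₀ hz₀).1).1, (hF₃F z₀ hz₀).2.2] at m1
  -- the second vertex
  set F₄ := F₃.filter fun z => z.1.1.1.1.2 = T₂ with hF₄
  have hF₄F : ∀ z ∈ F₄, z ∈ F₃ ∧ z.1.1.1.1.2 = T₂ := fun z hz => Finset.mem_filter.1 hz
  refine card_le_mul_of_fibers F₄ (fun z => z.1.1.1.2.1) (by positivity) ?_ fun q₂ hq₂ => ?_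
  · refine le_trans (Nat.cast_le.2 (Finset.card_le_card_of_injOn (fun q => (q, T₂)) ?_ ?_))
      (hB T₂ Q₂)
    · intro q hq
      obtain ⟨z, hz, rfl⟩ := Finset.mem_image.1 (Finset.mem_coe.1 hq)
      obtain ⟨hz3, hzT⟩ := hF₄F z hz
      obtain ⟨hz2, hzF, hzQ⟩ := hF₃F z hz3
      have e2 := (hfib z hz2).2.1
      rw [Finset.mem_coe, Finset.mem_filter]
      refine ⟨?_, rfl, hzQ⟩
      rw [← hzT, e2]
      exact (hmem z hzF).2.1
    · intro a _ b _ h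
      exact (Prod.mk.injEq _ _ _ _ ▸ h).1
  -- the third tube
  set F₅ := F₄.filter fun z => z.1.1.1.2.1 = q₂ with hF₅
  have hF₅F : ∀ z ∈ F₅, z ∈ F₄ ∧ z.1.1.1.2.1 = q₂ := fun z hz => Finset.mem_filter.1 hz
  have hlast : ((F₅.image fun z => z.1.1.2.2).card : ℝ) ≤ U₄ := by
    rcases F₅.eq_empty_or_nonempty with hemp | ⟨z₀, hz₀⟩
    · rw [hemp]; simpa using hU₄0
    have hall : ∀ z ∈ F₅, z ∈ F₂ ∧ z ∈ F ∧ z.1.1.1.2.1.1 = Q₂ := fun z hz =>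
      hF₃F z (hF₄F z (hF₅F z hz).1).1
    have hsub : F₅.image (fun z => z.1.1.2.2) ⊆ 𝕋 := by
      intro T hT
      obtain ⟨z, hz, rfl⟩ := Finset.mem_image.1 hT
      exact hJ.mem _ (hmem z (hall z hz).2.1).2.2.1
    have hr3 := hJ.rank _ (hmem z₀ (hall z₀ hz₀).2.1).2.2.2.1
    rw [(hfib z₀ (hall z₀ hz₀).1).2.2.2.2] at hr3
    refine card_tubes_two_cubes_le h0 h1 hK hr0 hr1 hΩ (fun T hT => h𝕋 T (hsub hT))
      (fun S hS T hT => hE S (hsub hS) T (hsub hT)) (k := Q₂) (l := q₃.1) (P := P q₃) ?_ ?_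
      hr3 ?_ ?_
    · intro T hT
      obtain ⟨z, hz, rfl⟩ := Finset.mem_image.1 hT
      have m1 := hJ.meets _ (hmem z (hall z hz).2.1).2.2.1
      rwa [← (hfib z (hall z hz).1).2.2.1, (hall z hz).2.2] at m1
    · intro T hT
      obtain ⟨z, hz, rfl⟩ := Finset.mem_image.1 hT
      have m1 := hJ.meets _ (hmem z (hall z hz).2.1).2.2.2.1
      rwa [← (hfib z (hall z hz).1).2.2.2.1, (hfib z (hall z hz).1).2.2.2.2] at m1
    · intro T hT
      obtain ⟨z, hz, rfl⟩ := Finset.mem_image.1 hT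
      have m1 := hJ.dev_le _ (hmem z (hall z hz).2.1).2.2.2.1
      rwa [← (hfib z (hall z hz).1).2.2.2.1, (hfib z (hall z hz).1).2.2.2.2] at m1
    · have m1 := (hmem z₀ (hall z₀ hz₀).2.1).2.2.2.2.2.2.2.2.1.2.2
      rwa [← (hfib z₀ (hall z₀ hz₀).1).2.2.1, (hall z₀ hz₀).2.2,
        (hfib z₀ (hall z₀ hz₀).1).2.2.2.2] at m1
  refine le_trans (Nat.cast_le.2 ?_) hlast
  rw [Finset.card_image_of_injOn]
  intro z hz w hw hzw
  rw [Finset.mem_coe] at hz hw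
  obtain ⟨hz4, hzq⟩ := hF₅F z hz
  obtain ⟨hw4, hwq⟩ := hF₅F w hw
  obtain ⟨hz3, hzT⟩ := hF₄F z hz4
  obtain ⟨hw3, hwT⟩ := hF₄F w hw4
  obtain ⟨-, -, a4, a3⟩ := hF₂F z (hF₃F z hz3).1
  obtain ⟨-, -, b4, b3⟩ := hF₂F w (hF₃F w hw3).1
  obtain ⟨c1, c2, c3, c4, c5⟩ := hfib z (hF₃F z hz3).1
  obtain ⟨d1, d2, d3, d4, d5⟩ := hfib w (hF₃F w hw3).1
  simp only at hzw
  refine Prod.ext (Prod.ext (Prod.ext (Prod.ext ?_ ?_) ?_) ?_) ?_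
  · exact Prod.ext (c1.trans d1.symm) (hzT.trans hwT.symm)
  · exact Prod.ext (hzq.trans hwq.symm) (c2.symm.trans ((hzT.trans hwT.symm).trans d2))
  · exact Prod.ext (c3.symm.trans ((hzq.trans hwq.symm).trans d3)) hzw
  · exact Prod.ext (c5.trans d5.symm) (c4.symm.trans (hzw.trans d4))
  · exact Prod.ext (a3.trans b3.symm) (a4.trans b4.symm)

end

/-! ### Volumes and densities -/

lemma cube_eq_preimage (θ : ℝ) (k : CubeIdx) :
    cube θ k = (@WithLp.ofLp 2 (Fin 4 → ℝ)) ⁻¹'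
      Set.univ.pi fun i => Set.Ico (θ * (k i : ℝ)) (θ * ((k i : ℝ) + 1)) := by
  ext x
  simp [cube, Set.mem_pi]

lemma measurableSet_cube (θ : ℝ) (k : CubeIdx) : MeasurableSet (cube θ k) := by
  rw [cube_eq_preimage]
  exact (PiLp.volume_preserving_ofLp (Fin 4)).measurable
    (MeasurableSet.univ_pi fun _ => measurableSet_Ico)

lemma volume_cube (θ : ℝ) (k : CubeIdx) :
    volume (cube θ k) = ENNReal.ofReal θ ^ 4 := by
  rw [cube_eq_preimage, (PiLp.volume_preserving_ofLp (Fin 4)).measure_preimage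
    (MeasurableSet.univ_pi fun _ => measurableSet_Ico).nullMeasurableSet, Real.volume_pi_Ico]
  simp only [mul_add, mul_one, add_sub_cancel_left, Finset.prod_const, Finset.card_univ,
    Fintype.card_fin]

lemma volume_real_cube {θ : ℝ} (h0 : 0 < θ) (k : CubeIdx) : volume.real (cube θ k) = θ ^ 4 := by
  rw [measureReal_def, volume_cube, ENNReal.toReal_pow, ENNReal.toReal_ofReal h0.le]

lemma disjoint_cube {θ : ℝ} (h0 : 0 < θ) {k l : CubeIdx} (h : k ≠ l) :
    Disjoint (cube θ k) (cube θ l) := by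
  rw [Set.disjoint_left]
  intro x hx hy
  refine h (funext fun i => ?_)
  have h1 : (k i : ℝ) < l i + 1 := lt_of_mul_lt_mul_left ((hx i).1.trans_lt (hy i).2) h0.le
  have h2 : (l i : ℝ) < k i + 1 := lt_of_mul_lt_mul_left ((hy i).1.trans_lt (hx i).2) h0.le
  have h3 : k i < l i + 1 := by exact_mod_cast h1
  have h4 : l i < k i + 1 := by exact_mod_cast h2
  omega

lemma volume_real_region {θ : ℝ} (h0 : 0 < θ) (S : Finset CubeIdx) :
    volume.real (region θ S) = S.card * θ ^ 4 := by
  rw [region, measureReal_biUnion_finset (fun k _ l _ h => disjoint_cube h0 h)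
    (fun k _ => measurableSet_cube θ k) (fun k _ => by rw [volume_cube]; finiteness)]
  simp [volume_real_cube h0]

lemma shadedSet_eq_region (θ : ℝ) (𝕋 : Finset Tube) (Y : Tube → Finset CubeIdx) :
    shadedSet θ 𝕋 Y = region θ (cubesOf 𝕋 Y) := by
  ext x
  simp only [shadedSet, region, cubesOf, Set.mem_iUnion, Finset.mem_biUnion, exists_prop]
  constructor
  · rintro ⟨T, hT, k, hk, hx⟩; exact ⟨k, ⟨T, hT, hk⟩, hx⟩
  · rintro ⟨k, ⟨T, hT, hk⟩, hx⟩; exact ⟨T, hT, k, hk, hx⟩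

lemma le_volume_real_ball {θ : ℝ} (h0 : 0 < θ) (x : E4) :
    θ ^ 4 / 16 ≤ volume.real (Metric.ball x θ) := by
  have h1 : cube (θ / 2) 0 ⊆ Metric.ball (0 : E4) θ := by
    intro y hy
    have h2 := norm_sub_corner_lt (half_pos h0) hy
    have h3 : corner (θ / 2) 0 = 0 := by ext i; simp [corner_apply]
    rw [h3, sub_zero] at h2
    rw [mem_ball_zero_iff]; linarith
  have h2 := measureReal_mono (μ := volume) h1 measure_ball_lt_top.ne
  rw [volume_real_cube (half_pos h0)] at h2
  rw [measureReal_def, Measure.addHaar_ball_center, ← measureReal_def]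
  linarith

/-- A tube contains about `θ⁻¹` disjoint balls of radius `θ`. -/
lemma le_volume_real_carrier {θ : ℝ} (h0 : 0 < θ) (T : Tube) :
    θ ^ 3 / 32 ≤ volume.real (T.carrier θ) := by
  set n := ⌊1 / (2 * θ)⌋₊ + 1 with hn
  have hn1 : 1 / (2 * θ) ≤ n := by
    rw [hn]; push_cast; exact (Nat.lt_floor_add_one _).le
  let p : ℕ → E4 := fun i => T.start + (2 * θ * i) • T.dir
  have hsub : (⋃ i ∈ Finset.range n, Metric.ball (p i) θ) ⊆ T.carrier θ := by
    intro x hx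
    simp only [Set.mem_iUnion, Finset.mem_range, exists_prop] at hx
    obtain ⟨i, hi, hx⟩ := hx
    rw [mem_ball_iff_norm] at hx
    refine mem_carrier_iff.2 ⟨2 * θ * i, by positivity, ?_, hx⟩
    have h1 : (i : ℝ) ≤ 1 / (2 * θ) :=
      (Nat.cast_le.2 (Nat.lt_succ_iff.1 hi)).trans (Nat.floor_le (by positivity))
    rw [le_div_iff₀ (by positivity)] at h1
    linarith
  have hfin : volume (T.carrier θ) ≠ ⊤ := by
    have : Bornology.IsBounded (T.carrier θ) := by
      rw [Tube.carrier]
      refine Bornology.IsBounded.thickening ?_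
      rw [segment_eq_image]
      exact (isCompact_Icc.image (by fun_prop)).isBounded
    exact this.measure_lt_top.ne
  have h1 := measureReal_mono (μ := volume) hsub hfin
  rw [measureReal_biUnion_finset ?_ (fun i _ => measurableSet_ball)
    (fun i _ => measure_ball_lt_top.ne)] at h1
  · have h2 : ∑ i ∈ Finset.range n, θ ^ 4 / 16 ≤
        ∑ i ∈ Finset.range n, volume.real (Metric.ball (p i) θ) :=
      Finset.sum_le_sum fun i _ => le_volume_real_ball h0 _
    rw [Finset.sum_const, Finset.card_range, nsmul_eq_mul] at h2
    have h3 : 1 / (2 * θ) * (θ ^ 4 / 16) ≤ n * (θ ^ 4 / 16) := by gcongr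
    have h4 : 1 / (2 * θ) * (θ ^ 4 / 16) = θ ^ 3 / 32 := by field_simp; norm_num
    linarith
  · intro i _ j _ hij
    refine Metric.ball_disjoint_ball ?_
    have h2 : p i - p j = (2 * θ * ((i : ℝ) - j)) • T.dir := by
      simp only [p, mul_sub, sub_smul]; abel
    rw [dist_eq_norm, h2, norm_smul, T.norm_dir, mul_one, Real.norm_eq_abs, abs_mul,
      abs_of_pos (by positivity)]
    have h4 : (1 : ℝ) ≤ |(i : ℝ) - j| := by
      have : (1 : ℤ) ≤ |(i : ℤ) - j| := Int.one_le_abs (by omega)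
      exact_mod_cast this
    nlinarith

lemma avgDensity_nonneg (θ : ℝ) (𝕋 : Finset Tube) (Y : Tube → Finset CubeIdx) :
    0 ≤ avgDensity θ 𝕋 Y := by
  unfold avgDensity
  positivity

lemma avgDensity_mul_card_le {θ : ℝ} (h0 : 0 < θ) (𝕋 : Finset Tube) (Y : Tube → Finset CubeIdx) :
    avgDensity θ 𝕋 Y * 𝕋.card ≤ 32 * θ * ∑ T ∈ 𝕋, ((Y T).card : ℝ) := by
  rcases 𝕋.eq_empty_or_nonempty with rfl | hne
  · simp
  have hN : (0 : ℝ) < 𝕋.card := by exact_mod_cast hne.card_pos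
  rw [avgDensity, div_mul_cancel₀ _ hN.ne', Finset.mul_sum]
  refine Finset.sum_le_sum fun T _ => ?_
  have h1 := le_volume_real_carrier h0 T
  have h2 : 0 < θ ^ 3 / 32 := by positivity
  rw [volume_real_region h0, div_le_iff₀ (h2.trans_le h1)]
  have h3 : 32 * θ * (Y T).card * (θ ^ 3 / 32) ≤
      32 * θ * (Y T).card * volume.real (T.carrier θ) := by
    gcongr
  linarith

lemma exists_mem_of_avgDensity_pos {θ : ℝ} (h0 : 0 < θ) {𝕋 : Finset Tube}
    {Y : Tube → Finset CubeIdx} (h : 0 < avgDensity θ 𝕋 Y) : ∃ T ∈ 𝕋, (Y T).Nonempty := by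
  by_contra hne
  push Not at hne
  have h1 : avgDensity θ 𝕋 Y = 0 := by
    rw [avgDensity, Finset.sum_eq_zero, zero_div]
    intro T hT
    rw [hne T hT, volume_real_region h0]
    simp
  exact h.ne' h1

/-- The two-ends condition bounds the number of cubes of each shading. -/
lemma card_shading_le {θ ε₁ C₁ : ℝ} (h0 : 0 < θ) (h1 : θ < 1) (hC : 0 < C₁) {𝕋 : Finset Tube}
    {Y : Tube → Finset CubeIdx} (hY : IsShading θ 𝕋 Y) (h2 : TwoEnds θ 𝕋 Y ε₁ C₁)
    (hl : 0 < avgDensity θ 𝕋 Y) {T : Tube} (hT : T ∈ 𝕋) :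
    ((Y T).card : ℝ) ≤ 10 ^ 9 * (C₁ * avgDensity θ 𝕋 Y / θ) := by
  classical
  have hpos : 0 < C₁ * avgDensity θ 𝕋 Y / θ := by positivity
  have hone : ∀ T ∈ 𝕋, ∀ x, (((Y T).filter fun k => cube θ k ⊆ Metric.ball x 1).card : ℝ) ≤
      C₁ * avgDensity θ 𝕋 Y / θ := by
    intro T hT x
    have h3 := h2 T hT 1 h1.le le_rfl x
    rw [Real.one_rpow, one_mul, ← div_eq_mul_inv] at h3
    exact h3
  -- a thin tube lies in the unit ball around its centre; a thick one meets boundedly many cubes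
  by_cases hθ : θ < 1 / 10
  · have h3 := hone T hT T.center
    rw [Finset.filter_true_of_mem] at h3
    · linarith
    intro k hk x hx
    obtain ⟨t, ht0, ht1, ht⟩ := exists_near_core h0 (hY T hT k hk)
    have h4 := norm_sub_corner_lt h0 hx
    rw [mem_ball_iff_norm]
    have h5 : x - T.center = (x - corner θ k) + (corner θ k - (T.start + t • T.dir)) +
        (t - 1 / 2) • T.dir := by
      rw [Tube.center, sub_smul]; abel
    have h6 := norm_add₃_le (a := x - corner θ k) (b := corner θ k - (T.start + t • T.dir))
      (c := (t - 1 / 2) • T.dir)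
    have h7 : |t - 1 / 2| ≤ 1 / 2 := abs_le.2 ⟨by linarith, by linarith⟩
    rw [← h5, norm_smul, T.norm_dir, Real.norm_eq_abs] at h6
    linarith
  · push Not at hθ
    have h3 : 1 ≤ C₁ * avgDensity θ 𝕋 Y / θ := by
      obtain ⟨S, hS, k, hk⟩ := exists_mem_of_avgDensity_pos h0 hl
      let x : E4 := WithLp.toLp 2 fun i => θ * ((k i : ℝ) + 1 / 2)
      refine le_trans ?_ (hone S hS x)
      rw [Nat.one_le_cast, Nat.one_le_iff_ne_zero, ← Nat.pos_iff_ne_zero, Finset.card_pos]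
      refine ⟨k, Finset.mem_filter.2 ⟨hk, fun y hy => ?_⟩⟩
      rw [mem_ball_iff_norm]
      have h4 : ‖y - x‖ ≤ 2 * (θ / 2) := by
        refine norm_le_of_abs_le (by positivity) fun i => ?_
        have h5 := hy i
        rw [PiLp.sub_apply, show x i = θ * ((k i : ℝ) + 1 / 2) from rfl, abs_le]
        constructor <;> linarith [h5.1, h5.2]
      linarith
    have h4 := card_le_of_separated (Y T) (corner θ) (EuclideanSpace.basisFun (Fin 4) ℝ) h0
      (fun k _ l _ hkl => le_norm_corner_sub h0 hkl) T.start (fun _ => 4) (fun _ => by norm_num) ?_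
    · rw [Fin.prod_univ_four] at h4
      have h5 : 4 * 4 / θ + 2 ≤ 162 := by
        have : 4 * 4 / θ ≤ 160 := by rw [div_le_iff₀ h0]; linarith
        linarith
      have h6 : (4 * 4 / θ + 2) * (4 * 4 / θ + 2) * (4 * 4 / θ + 2) * (4 * 4 / θ + 2) ≤
          162 * 162 * 162 * 162 := by gcongr
      linarith
    · intro k hk i
      obtain ⟨t, ht0, ht1, ht⟩ := exists_near_core h0 (hY T hT k hk)
      have h5 := abs_real_inner_le_norm (EuclideanSpace.basisFun (Fin 4) ℝ i) (corner θ k - T.start)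
      rw [(EuclideanSpace.basisFun (Fin 4) ℝ).orthonormal.1 i, one_mul] at h5
      have h6 : corner θ k - T.start = (corner θ k - (T.start + t • T.dir)) + t • T.dir := by abel
      have h7 := norm_add_le (corner θ k - (T.start + t • T.dir)) (t • T.dir)
      rw [← h6, norm_smul, T.norm_dir, Real.norm_eq_abs, abs_of_nonneg ht0] at h7
      linarith

open Classical in
/-- The two-ends condition bounds the number of cubes of a shading that are close to a given one. -/
lemma card_near_cubes_le {θ ε₁ C₁ : ℝ} (h0 : 0 < θ) (hC : 0 < C₁) {𝕋 : Finset Tube}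
    {Y : Tube → Finset CubeIdx} (h2 : TwoEnds θ 𝕋 Y ε₁ C₁) {T : Tube} (hT : T ∈ 𝕋) {r : ℝ}
    (hr0 : 0 ≤ r) (hr : 2 * r ≤ 1) (l : CubeIdx) :
    (((Y T).filter fun k => ‖corner θ l - corner θ k‖ + θ < r).card : ℝ) ≤
      (2 * r) ^ ε₁ * (C₁ * avgDensity θ 𝕋 Y / θ) := by
  by_cases hrθ : r ≤ θ
  · rw [Finset.filter_false_of_mem]
    · have := avgDensity_nonneg θ 𝕋 Y
      rw [Finset.card_empty, Nat.cast_zero]; positivity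
    · intro k _ h
      linarith [norm_nonneg (corner θ l - corner θ k)]
  push Not at hrθ
  have h3 := h2 T hT (2 * r) (by linarith) hr (corner θ l)
  rw [show (2 * r) ^ ε₁ * C₁ * avgDensity θ 𝕋 Y * θ⁻¹ =
    (2 * r) ^ ε₁ * (C₁ * avgDensity θ 𝕋 Y / θ) by ring] at h3
  refine le_trans (Nat.cast_le.2 (Finset.card_le_card ?_)) h3
  intro k hk
  rw [Finset.mem_filter] at hk ⊢
  refine ⟨hk.1, fun x hx => ?_⟩
  rw [mem_ball_iff_norm]
  have h4 := norm_sub_corner_lt h0 hx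
  have h5 := norm_sub_le_norm_sub_add_norm_sub x (corner θ k) (corner θ l)
  rw [norm_sub_rev (corner θ k)] at h5
  linarith [hk.2]

lemma dev_le_of_planeAngle_le {P : Submodule ℝ E4} {v : E4} (hv : ‖v‖ = 1) {η : ℝ}
    (h : planeAngle v P ≤ η) : dev P v ≤ η := by
  refine le_trans ?_ h
  have h1 : ⟪v, P.starProjection v⟫_ℝ = ‖P.starProjection v‖ ^ 2 := by
    have := inner_sub_starProjection (P := P) (x := v) (P.starProjection_apply_mem v)
    rw [inner_sub_right, real_inner_self_eq_norm_sq, real_inner_comm] at this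
    linarith
  have h2 := sq_norm_eq P v
  rw [hv] at h2
  have h3 : Real.cos (planeAngle v P) = ‖P.starProjection v‖ := by
    rw [planeAngle, InnerProductGeometry.cos_angle, h1, hv, one_mul]
    by_cases h4 : ‖P.starProjection v‖ = 0
    · rw [h4]; simp
    · field_simp
  have h0 : 0 ≤ planeAngle v P := InnerProductGeometry.angle_nonneg _ _
  have h4 : dev P v ^ 2 = Real.sin (planeAngle v P) ^ 2 := by
    have := Real.sin_sq_add_cos_sq (planeAngle v P)
    rw [h3] at this
    linarith
  have h5 : 0 ≤ Real.sin (planeAngle v P) :=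
    Real.sin_nonneg_of_nonneg_of_le_pi h0 (InnerProductGeometry.angle_le_pi _ _)
  have h6 : dev P v = Real.sin (planeAngle v P) := by
    rwa [sq_eq_sq₀ (dev_nonneg _ _) h5] at h4
  rw [h6]
  exact Real.sin_le h0

/-! ### The incidence inequality -/

lemma lineDist_comm (S T : Tube) : lineDist S T = lineDist T S := by
  rw [lineDist, lineDist, norm_sub_rev, add_comm]

lemma lineDist_nonneg (S T : Tube) : 0 ≤ lineDist S T := le_min (norm_nonneg _) (norm_nonneg _)

lemma lineDist_le_two (S T : Tube) : lineDist S T ≤ 2 := by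
  refine (min_le_left _ _).trans ((norm_sub_le _ _).trans ?_)
  rw [S.norm_dir, T.norm_dir]; norm_num

lemma lineDist_triangle (S T U : Tube) : lineDist T U ≤ lineDist S T + lineDist S U := by
  have h1 : T.PointsIn T.dir := Or.inl rfl
  obtain ⟨s, hs, h2⟩ := exists_signed_dir h1 (lineDist_comm S T).ge
  obtain ⟨u, hu, h3⟩ := exists_signed_dir (T := U) hs le_rfl
  have h4 := (lineDist_le_of_pointsIn h1 hu).1
  have h5 := norm_sub_le_norm_sub_add_norm_sub T.dir s u
  linarith

lemma TubeStep.symm {B₁ : ℕ} {θ K c β r : ℝ} {P : CubeIdx × Fin B₁ → Submodule ℝ E4}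
    {x y : (CubeIdx × Fin B₁) × Tube} (h : TubeStep θ K c β r P x y) :
    TubeStep θ K c β r P y x :=
  ⟨h.1.symm, by rw [planeDist_comm]; exact h.2.1, by rw [norm_sub_rev]; exact h.2.2⟩

lemma VertexStep.symm {B₁ : ℕ} {θ K c α : ℝ} {x y : (CubeIdx × Fin B₁) × Tube}
    (h : VertexStep θ K c α x y) : VertexStep θ K c α y x :=
  ⟨h.1.symm, by rw [lineDist_comm]; exact h.2⟩

/-- The lower bound for the number of chains against the upper bound, as an inequality between real
numbers. -/
lemma chain_inequality {u a b K m D B₂ θ r X : ℝ} {n : ℕ} (hu0 : 0 < u) (hK : 1 ≤ K)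
    (hm : 0 ≤ m) (hD : 0 ≤ D) (hB : 0 ≤ B₂) (hθ : 0 < θ) (hr : 0 < r)
    (hn : (n + 1) * u ≤ 1)
    (h1 : 1 / 2 * (u * a / 2 * (u * b / 2)) ^ 2 * (u * b / 2) ≤ X)
    (h2 : X ≤ (n + 1) * (10 ^ 54 * K ^ 12 * m * D * B₂ / ((u / (4 * K)) ^ 6 * θ ^ 3 * r ^ 2))) :
    a ^ 2 * b ^ 3 * u ^ 12 * (4 * r ^ 2) ≤ 10 ^ 61 * K ^ 18 * (m * D * B₂ / θ ^ 3) := by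
  have h3 := h1.trans h2
  have h4 : (n + 1) * (10 ^ 54 * K ^ 12 * m * D * B₂ / ((u / (4 * K)) ^ 6 * θ ^ 3 * r ^ 2)) ≤
      1 / u * (10 ^ 54 * K ^ 12 * m * D * B₂ / ((u / (4 * K)) ^ 6 * θ ^ 3 * r ^ 2)) := by
    have : (n + 1 : ℝ) ≤ 1 / u := by rwa [le_div_iff₀ hu0]
    gcongr
  have h5 := h3.trans h4
  have h6 : 1 / u * (10 ^ 54 * K ^ 12 * m * D * B₂ / ((u / (4 * K)) ^ 6 * θ ^ 3 * r ^ 2)) =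
      (10 ^ 54 * 4 ^ 6 * K ^ 18 * (m * D * B₂ / θ ^ 3)) / (u ^ 7 * r ^ 2) := by
    field_simp
  rw [h6, le_div_iff₀ (by positivity)] at h5
  have h7 : 0 ≤ K ^ 18 * (m * D * B₂ / θ ^ 3) := by positivity
  linarith

set_option maxHeartbeats 1000000 in
open Classical in
/-- Let every tube carry about `a` incidences, at most `D` of them and few in each small ball, and
let every vertex carry about `b` incidences. After refining, double counting of the chains
of three tubes bounds `a² b³`. -/
lemma incidence_inequality {κ : ℝ} (hκ : 0 < κ) : ∃ c : ℝ, 0 < c ∧ c ≤ 1 ∧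
    ∀ (θ K ε₁ m D B₂ : ℝ) (B₁ : ℕ) (Ω : Finset E4) (𝕋 : Finset Tube)
      (P : CubeIdx × Fin B₁ → Submodule ℝ E4) (I : Finset ((CubeIdx × Fin B₁) × Tube))
      (V : Finset (CubeIdx × Fin B₁)), 0 < θ → θ < 1 → 1 ≤ K → 0 < ε₁ →
      SeparatedDirections θ Ω → (∀ T ∈ 𝕋, ∃ v ∈ Ω, T.PointsIn v) → EssentiallyDistinct θ 𝕋 →
      0 ≤ m → (∀ v ∈ Ω, ((𝕋.filter fun T => T.PointsIn v).card : ℝ) ≤ m) →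
      IncidenceData θ K 2 2 𝕋 P I → I.Nonempty → (∀ x ∈ I, x.1 ∈ V) →
      (∀ T, ((I.filter fun x => x.2 = T).card : ℝ) ≤ D) → 0 ≤ B₂ →
      (∀ T Q, ((I.filter fun x => x.2 = T ∧ x.1.1 = Q).card : ℝ) ≤ B₂) →
      (∀ T l r, 0 ≤ r → 2 * r ≤ 1 → ((I.filter fun x => x.2 = T ∧
        ‖corner θ l - corner θ x.1.1‖ + θ < r).card : ℝ) ≤ (2 * r) ^ ε₁ * D) →
      (I.card / 𝕋.card : ℝ) ^ 2 * (I.card / V.card : ℝ) ^ 3 * (c * θ ^ κ) ^ 12 *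
        (c * θ ^ κ * (I.card / 𝕋.card) / (4 * D)) ^ (2 / ε₁) ≤
        10 ^ 61 * K ^ 18 * (m * D * B₂ / θ ^ 3) := by
  obtain ⟨c, hc0, hc1, H⟩ := exists_refinement hκ
  refine ⟨c, hc0, hc1, ?_⟩
  intro θ K ε₁ m D B₂ B₁ Ω 𝕋 P I V h0 h1 hK hε hΩ h𝕋 hE hm0 hm hI hne hV hD hB0 hB hnear
  obtain ⟨n, hn, hn', hnu, H⟩ := H θ h0 h1
  have hIV : ∀ x ∈ I, x.1 ∈ V ∧ x.2 ∈ 𝕋 := fun x hx => ⟨hV x hx, hI.mem x hx⟩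
  obtain ⟨j, hj, k, hk, J, hJI, hJne, hplane, hline, hfarT, hfarV, hdegT, hdegV⟩ :=
    H _ _ I hne V 𝕋 hIV (fun p q => planeDist (P p) (P q) / 2)
    (fun S T => lineDist S T / 2) (fun x y => div_nonneg (planeDist_nonneg _ _) two_pos.le)
    (fun x y => by linarith [planeDist_le_two (P x) (P y)])
    (fun x y z => by
      have := planeDist_triangle (P y) (P x) (P z)
      rw [planeDist_comm (P y) (P x)] at this; linarith)
    (fun x y => div_nonneg (lineDist_nonneg _ _) two_pos.le)
    (fun x y => by linarith [lineDist_le_two x y])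
    (fun x y z => by linarith [lineDist_triangle x y z])
  have hu0 : 0 < c * θ ^ κ := by positivity
  have hu1 : c * θ ^ κ ≤ 1 := by
    have : θ ^ κ ≤ 1 := Real.rpow_le_one h0.le h1.le hκ.le
    calc c * θ ^ κ ≤ 1 * 1 := by gcongr
      _ = 1 := one_mul 1
  set u := c * θ ^ κ with hu
  obtain ⟨x₀, hx₀⟩ := hne
  have hN0 : (0 : ℝ) < 𝕋.card := by
    exact_mod_cast Finset.card_pos.2 ⟨_, hI.mem x₀ hx₀⟩
  have hV0 : (0 : ℝ) < V.card := by exact_mod_cast Finset.card_pos.2 ⟨_, hV x₀ hx₀⟩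
  have hI0 : (0 : ℝ) < I.card := by exact_mod_cast Finset.card_pos.2 ⟨_, hx₀⟩
  set a : ℝ := I.card / 𝕋.card with ha
  set b : ℝ := I.card / V.card with hb
  have ha0 : 0 < a := by positivity
  have hb0 : 0 < b := by positivity
  have huaD : u * a ≤ D := by
    obtain ⟨x, hx⟩ := hJne
    refine (hdegT x hx).trans (le_trans (Nat.cast_le.2 (Finset.card_le_card ?_)) (hD x.2))
    exact Finset.filter_subset_filter _ hJI
  have hD0 : 0 < D := (mul_pos hu0 ha0).trans_le huaD
  set ρ : ℝ := u * a / (4 * D) with hρ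
  have hρ0 : 0 < ρ := by positivity
  have hρ1 : ρ ≤ 1 := by rw [hρ, div_le_one (by positivity)]; linarith
  -- the scale at which the two-ends condition removes a quarter of the incidences of a tube
  set r : ℝ := 1 / 2 * ρ ^ (1 / ε₁) with hr
  have hr0 : 0 < r := by positivity
  have h2r : 2 * r = ρ ^ (1 / ε₁) := by rw [hr]; ring
  have h2r1 : 2 * r ≤ 1 := h2r ▸ Real.rpow_le_one hρ0.le hρ1 (by positivity)
  have hrε : (2 * r) ^ ε₁ * D = u * a / 4 := by
    rw [h2r, ← Real.rpow_mul hρ0.le, one_div_mul_cancel hε.ne', Real.rpow_one, hρ]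
    field_simp
  have hr4 : 4 * r ^ 2 = ρ ^ (2 / ε₁) := by
    rw [show 4 * r ^ 2 = (2 * r) ^ 2 by ring, h2r, ← Real.rpow_natCast, ← Real.rpow_mul hρ0.le]
    congr 1
    push_cast; ring
  set β : ℝ := 4 * K * (1 / 2) ^ j with hβ
  set α : ℝ := 4 * K * (1 / 2) ^ k with hα
  have hjn : (1 / 2 : ℝ) ^ n ≤ (1 / 2) ^ j :=
    pow_le_pow_of_le_one (by norm_num) (by norm_num) hj
  have hkn : (1 / 2 : ℝ) ^ n ≤ (1 / 2) ^ k :=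
    pow_le_pow_of_le_one (by norm_num) (by norm_num) hk
  have hj1 : (1 / 2 : ℝ) ^ j ≤ 1 := pow_le_one₀ (by norm_num) (by norm_num)
  have hk1 : (1 / 2 : ℝ) ^ k ≤ 1 := pow_le_one₀ (by norm_num) (by norm_num)
  have hj0 : (0 : ℝ) < (1 / 2) ^ j := by positivity
  have hk0 : (0 : ℝ) < (1 / 2) ^ k := by positivity
  have hβ4 : 4 * (1 / 2) ^ j ≤ β := by
    have := mul_le_mul_of_nonneg_right hK hj0.le
    rw [hβ]; linarith only [this]
  have hα4 : 4 * (1 / 2) ^ k ≤ α := by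
    have := mul_le_mul_of_nonneg_right hK hk0.le
    rw [hα]; linarith only [this]
  have hK0 : 0 ≤ K := zero_le_one.trans hK
  have hβθ : 2 * K * θ ≤ β := by
    have := mul_le_mul_of_nonneg_left (hn'.trans (mul_le_mul_of_nonneg_left hjn two_pos.le)) hK0
    rw [hβ]; linarith only [this]
  have hαθ : 2 * K * θ ≤ α := by
    have := mul_le_mul_of_nonneg_left (hn'.trans (mul_le_mul_of_nonneg_left hkn two_pos.le)) hK0
    rw [hα]; linarith only [this]
  have hαK : α ≤ 4 * K := mul_le_of_le_one_right (by positivity) hk1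
  have hcβ : u / (4 * K) * β = u * (1 / 2) ^ j := by rw [hβ]; field_simp
  have hcα : u / (4 * K) * α = u * (1 / 2) ^ k := by rw [hα]; field_simp
  have hJ : IncidenceData θ K α β 𝕋 P J :=
    { mem := fun x hx => hI.mem x (hJI hx)
      meets := fun x hx => hI.meets x (hJI hx)
      dev_le := fun x hx => hI.dev_le x (hJI hx)
      rank := fun x hx => hI.rank x (hJI hx)
      plane_le := fun x hx y hy h => by
        have := hplane x hx y hy h
        linarith only [this, hβ4]
      line_le := fun x hx y hy h => by
        have := hline x hx y hy h
        linarith only [this, hα4] }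
  have hθK : θ ≤ K * θ := le_mul_of_one_le_left h0.le hK
  have hRa : ∀ x ∈ J, u * a / 2 ≤
      ((J.filter fun y => TubeStep θ K (u / (4 * K)) β r P x y).card : ℝ) := by
    intro x hx
    have e1 := hdegT x hx
    have e2 := hfarT x hx
    have e3 := hnear x.2 x.1.1 r hr0.le h2r1
    rw [hrε] at e3
    have e4 : (J.filter fun z => z.2 = x.2) ⊆
        ((J.filter fun y => TubeStep θ K (u / (4 * K)) β r P x y) ∪
        ((J.filter fun z => z.2 = x.2).filter
          fun z => planeDist (P x.1) (P z.1) / 2 + θ ≤ u * (1 / 2) ^ j)) ∪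
        (I.filter fun z => z.2 = x.2 ∧ ‖corner θ x.1.1 - corner θ z.1.1‖ + θ < r) := by
      intro z hz
      obtain ⟨hzJ, hz2⟩ := Finset.mem_filter.1 hz
      simp only [Finset.mem_union, Finset.mem_filter]
      by_cases c1 : planeDist (P x.1) (P z.1) / 2 + θ ≤ u * (1 / 2) ^ j
      · exact Or.inl (Or.inr ⟨⟨hzJ, hz2⟩, c1⟩)
      by_cases c2 : ‖corner θ x.1.1 - corner θ z.1.1‖ + θ < r
      · exact Or.inr ⟨hJI hzJ, hz2, c2⟩
      refine Or.inl (Or.inl ⟨hzJ, hz2.symm, ?_, not_lt.1 c2⟩)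
      push Not at c1
      rw [hcβ]
      linarith only [planeDist_nonneg (P x.1) (P z.1), c1, hθK, h0]
    have e5 := (Finset.card_le_card e4).trans ((Finset.card_union_le _ _).trans
      (Nat.add_le_add_right (Finset.card_union_le _ _) _))
    have e6 : ((J.filter fun z => z.2 = x.2).card : ℝ) ≤
        (J.filter fun y => TubeStep θ K (u / (4 * K)) β r P x y).card +
        ((J.filter fun z => z.2 = x.2).filter
          fun z => planeDist (P x.1) (P z.1) / 2 + θ ≤ u * (1 / 2) ^ j).card +
        (I.filter fun z => z.2 = x.2 ∧ ‖corner θ x.1.1 - corner θ z.1.1‖ + θ < r).card := by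
      exact_mod_cast e5
    linarith only [e1, e2, e3, e6]
  have hSb : ∀ x ∈ J, u * b / 2 ≤
      ((J.filter fun y => VertexStep θ K (u / (4 * K)) α x y).card : ℝ) := by
    intro x hx
    have e1 : u * b ≤ ((J.filter fun z => z.1 = x.1).card : ℝ) := by convert hdegV x hx
    have e2 : (((J.filter fun z => z.1 = x.1).filter
        fun z => lineDist x.2 z.2 / 2 + θ ≤ u * (1 / 2) ^ k).card : ℝ) ≤
        ((J.filter fun z => z.1 = x.1).card : ℝ) / 4 := by convert hfarV x hx
    have e4 : (J.filter fun z => z.1 = x.1) ⊆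
        (J.filter fun y => VertexStep θ K (u / (4 * K)) α x y) ∪
        ((J.filter fun z => z.1 = x.1).filter
          fun z => lineDist x.2 z.2 / 2 + θ ≤ u * (1 / 2) ^ k) := by
      intro z hz
      obtain ⟨hzJ, hz2⟩ := Finset.mem_filter.1 hz
      simp only [Finset.mem_union, Finset.mem_filter]
      by_cases c1 : lineDist x.2 z.2 / 2 + θ ≤ u * (1 / 2) ^ k
      · exact Or.inr ⟨⟨hzJ, hz2⟩, c1⟩
      refine Or.inl ⟨hzJ, hz2.symm, ?_⟩
      push Not at c1
      rw [hcα]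
      linarith only [lineDist_nonneg x.2 z.2, c1, hθK, h0]
    have e5 := (Finset.card_le_card e4).trans (Finset.card_union_le _ _)
    have e6 : ((J.filter fun z => z.1 = x.1).card : ℝ) ≤
        (J.filter fun y => VertexStep θ K (u / (4 * K)) α x y).card +
        ((J.filter fun z => z.1 = x.1).filter
          fun z => lineDist x.2 z.2 / 2 + θ ≤ u * (1 / 2) ^ k).card := by
      exact_mod_cast e5
    have : 0 < u * b := by positivity
    linarith only [e1, e2, e6, this]
  obtain ⟨x₁, hx₁, y₁, hy₁, r₁, hlow⟩ := exists_start_many_chains J hJne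
    (TubeStep θ K (u / (4 * K)) β r P) (VertexStep θ K (u / (4 * K)) α)
    (fun _ _ h => h.symm) (fun _ _ h => h.symm) (fun x => x.1) (fun _ _ h => h.1)
    (fun p q => commonDev (P p) (P q)) (fun p q => commonDev_comm _ _)
    (a := u * a / 2) (b := u * b / 2) (by positivity) (by positivity) hRa hSb
  have hup := card_chains_le (c := u / (4 * K)) (r := r) (B₂ := B₂) (D := D) (n := n) hJ h0 h1 hK
    hαθ hβθ hαK (by positivity)
    (by rw [div_le_one (by positivity)]; linarith only [hu1, hK])
    (by rw [hcα]; exact mul_le_one₀ hu1 hk0.le hk1)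
    (by rw [hcβ]; exact mul_le_one₀ hu1 hj0.le hj1) hr0 (by linarith only [hr0, h2r1]) hΩ h𝕋
    hE hm0 hm hn hn' hD0.le
    (fun T => le_trans (Nat.cast_le.2 (Finset.card_le_card
      (Finset.filter_subset_filter _ hJI))) (hD T)) hB0
    (fun T Q => le_trans (Nat.cast_le.2 (Finset.card_le_card
      (Finset.filter_subset_filter _ hJI))) (hB T Q)) hx₁ hy₁ r₁
  rw [← hr4]
  exact chain_inequality hu0 hK hm0 hD0.le hB0 h0 hr0 hnu hlow hup

/-! ### The volume bound -/

/-- The incidence inequality in terms of the density `l`, with `q` cubes, `N` tubes, `o` directions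
and `E` incidences between cubes and tubes. -/
lemma numeric_bound {l N o q E B₁ B₂ C₁ A K u B θ ε₁ : ℝ} (hl : 0 < l) (hN : 0 < N) (ho : 0 < o)
    (hq : 0 < q) (hB₁ : 0 < B₁) (hB₂ : 0 < B₂) (hC : 0 < C₁) (hA : 0 < A) (hK : 0 < K)
    (hu : 0 < u) (hu1 : u ≤ 1) (hB : 0 < B) (hθ : 0 < θ) (hε : 0 < ε₁) (hε1 : ε₁ < 1)
    (hZ : 1 ≤ 10 ^ 12 * C₁) (hE : l * N ≤ 32 * θ * E) (hBB : B₁ ≤ B * B₂)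
    (h : (B₂ * E / N) ^ 2 * (B₂ * E / (q * B₁)) ^ 3 * u ^ 12 *
      (u * (B₂ * E / N) / (4 * (B₂ * (10 ^ 9 * (C₁ * l / θ))))) ^ (2 / ε₁) ≤
      10 ^ 61 * K ^ 18 * (A * (N / o) * (B₂ * (10 ^ 9 * (C₁ * l / θ))) * B₂ / θ ^ 3)) :
    l ^ 4 * N ^ 2 * o * u ^ (14 / ε₁) ≤
      10 ^ 78 * K ^ 18 * A * θ * (10 ^ 12 * C₁) ^ (3 / ε₁) * B ^ 3 * q ^ 3 := by
  set Z := 10 ^ 12 * C₁ with hZdef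
  have hZ0 : 0 < Z := by positivity
  have hE0 : 0 < E := by
    have : 0 < l * N := by positivity
    by_contra h
    have : 32 * θ * E ≤ 0 := mul_nonpos_of_nonneg_of_nonpos (by positivity) (not_lt.1 h)
    linarith
  have s1 : B₂ * l / (32 * θ) ≤ B₂ * E / N := by
    rw [div_le_div_iff₀ (by positivity) hN]
    have := mul_le_mul_of_nonneg_left hE hB₂.le
    linarith
  have s2 : l * N / (32 * θ * q * B) ≤ B₂ * E / (q * B₁) := by
    rw [div_le_div_iff₀ (by positivity) (by positivity)]
    have e1 : l * N * (q * B₁) ≤ l * N * (q * (B * B₂)) := by gcongr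
    have e2 : l * N * (q * (B * B₂)) ≤ 32 * θ * E * (q * (B * B₂)) := by gcongr
    linarith
  have s3 : u / Z ≤ u * (B₂ * E / N) / (4 * (B₂ * (10 ^ 9 * (C₁ * l / θ)))) := by
    have e1 : u * (B₂ * l / (32 * θ)) / (4 * (B₂ * (10 ^ 9 * (C₁ * l / θ)))) ≤
        u * (B₂ * E / N) / (4 * (B₂ * (10 ^ 9 * (C₁ * l / θ)))) := by gcongr
    refine le_trans ?_ e1
    have e2 : u * (B₂ * l / (32 * θ)) / (4 * (B₂ * (10 ^ 9 * (C₁ * l / θ)))) =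
        u / (128 * 10 ^ 9 * C₁) := by field_simp; norm_num
    rw [e2, hZdef]
    gcongr
    norm_num
  have hp : 0 < 2 / ε₁ := by positivity
  have h2 : (B₂ * l / (32 * θ)) ^ 2 * (l * N / (32 * θ * q * B)) ^ 3 * u ^ 12 *
      (u / Z) ^ (2 / ε₁) ≤
      10 ^ 61 * K ^ 18 * (A * (N / o) * (B₂ * (10 ^ 9 * (C₁ * l / θ))) * B₂ / θ ^ 3) := by
    refine le_trans ?_ h
    gcongr
  have s4 : u ^ (14 / ε₁) ≤ u ^ 12 * u ^ (2 / ε₁) := by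
    rw [← Real.rpow_natCast, ← Real.rpow_add hu]
    refine Real.rpow_le_rpow_of_exponent_ge hu hu1 ?_
    have : 12 ≤ 12 / ε₁ := by rw [le_div_iff₀ hε]; linarith
    rw [show 14 / ε₁ = 12 / ε₁ + 2 / ε₁ by ring]
    push_cast
    linarith
  have s5 : Z * Z ^ (2 / ε₁) ≤ Z ^ (3 / ε₁) := by
    nth_rewrite 1 [← Real.rpow_one Z]
    rw [← Real.rpow_add hZ0]
    refine Real.rpow_le_rpow_of_exponent_le hZ ?_
    have : 1 ≤ 1 / ε₁ := by rw [le_div_iff₀ hε]; linarith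
    rw [show 3 / ε₁ = 1 / ε₁ + 2 / ε₁ by ring]
    linarith
  rw [Real.div_rpow hu.le hZ0.le] at h2
  set Up := u ^ (2 / ε₁)
  set Zp := Z ^ (2 / ε₁)
  have hZp : 0 < Zp := Real.rpow_pos_of_pos hZ0 _
  have hUp : 0 < Up := Real.rpow_pos_of_pos hu _
  have hC1 : C₁ = Z / 10 ^ 12 := by rw [hZdef]; field_simp
  rw [hC1] at h2
  have e1 : (B₂ * l / (32 * θ)) ^ 2 * (l * N / (32 * θ * q * B)) ^ 3 * u ^ 12 * (Up / Zp) =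
      (l ^ 4 * N ^ 2 * o * (u ^ 12 * Up)) *
        (B₂ ^ 2 * l * N / (33554432 * θ ^ 5 * q ^ 3 * B ^ 3 * Zp * o)) := by
    field_simp; norm_num
  have e2 : 10 ^ 61 * K ^ 18 * (A * (N / o) * (B₂ * (10 ^ 9 * (Z / 10 ^ 12 * l / θ))) * B₂ / θ ^ 3)
      = (33554432 * 10 ^ 58 * K ^ 18 * A * θ * (Z * Zp) * B ^ 3 * q ^ 3) *
        (B₂ ^ 2 * l * N / (33554432 * θ ^ 5 * q ^ 3 * B ^ 3 * Zp * o)) := by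
    field_simp
  rw [e1, e2] at h2
  have h3 := le_of_mul_le_mul_right h2 (by positivity)
  calc l ^ 4 * N ^ 2 * o * u ^ (14 / ε₁) ≤ l ^ 4 * N ^ 2 * o * (u ^ 12 * Up) := by gcongr
    _ ≤ 33554432 * 10 ^ 58 * K ^ 18 * A * θ * (Z * Zp) * B ^ 3 * q ^ 3 := h3
    _ ≤ 10 ^ 78 * K ^ 18 * A * θ * Z ^ (3 / ε₁) * B ^ 3 * q ^ 3 := by
      gcongr
      norm_num

lemma mainTerm_nonneg {θ : ℝ} (h0 : 0 < θ) (Ω : Finset E4) (𝕋 : Finset Tube)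
    (Y : Tube → Finset CubeIdx) : 0 ≤ mainTerm θ Ω 𝕋 Y := by
  have := avgDensity_nonneg θ 𝕋 Y
  unfold mainTerm
  positivity

lemma mainTerm_eq_zero {θ : ℝ} {Ω : Finset E4} {𝕋 : Finset Tube} {Y : Tube → Finset CubeIdx}
    (h : avgDensity θ 𝕋 Y = 0) : mainTerm θ Ω 𝕋 Y = 0 := by
  unfold mainTerm
  rw [h, Real.zero_rpow (by norm_num)]; simp

lemma mainTerm_pow_three {θ : ℝ} (h0 : 0 < θ) (Ω : Finset E4) (𝕋 : Finset Tube)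
    (Y : Tube → Finset CubeIdx) : mainTerm θ Ω 𝕋 Y ^ 3 =
      θ ^ 11 * (avgDensity θ 𝕋 Y ^ 4 * (𝕋.card : ℝ) ^ 2 * Ω.card) := by
  have hl := avgDensity_nonneg θ 𝕋 Y
  have key : ∀ {x : ℝ}, 0 ≤ x → ∀ (n : ℕ) (p : ℝ), p * 3 = n → (x ^ p) ^ 3 = x ^ n := by
    intro x hx n p hp
    rw [← Real.rpow_natCast, ← Real.rpow_mul hx, ← Real.rpow_natCast, ← hp]
    norm_num
  unfold mainTerm
  rw [mul_pow, mul_pow, mul_pow, key hl 4 _ (by norm_num), key h0.le 2 _ (by norm_num),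
    key (by positivity) 1 _ (by norm_num), key (by positivity) 2 _ (by norm_num)]
  ring

section
variable {B₁ B₂ : ℕ} {𝕋 : Finset Tube} {Y : Tube → Finset CubeIdx}
  {S : CubeIdx → Fin B₁ → Finset Tube}

open Classical in
/-- The incidences `((Q, i), T)` with `T ∈ S Q i`. -/
def incidences (𝕋 : Finset Tube) (Y : Tube → Finset CubeIdx) (S : CubeIdx → Fin B₁ → Finset Tube) :
    Finset ((CubeIdx × Fin B₁) × Tube) :=
  ((cubesOf 𝕋 Y ×ˢ Finset.univ) ×ˢ 𝕋).filter fun x => x.2 ∈ S x.1.1 x.1.2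

lemma mem_incidences {x : (CubeIdx × Fin B₁) × Tube} :
    x ∈ incidences 𝕋 Y S ↔ x.1.1 ∈ cubesOf 𝕋 Y ∧ x.2 ∈ 𝕋 ∧ x.2 ∈ S x.1.1 x.1.2 := by
  classical
  simp [incidences, and_assoc]

lemma mem_cubesOf {T : Tube} (hT : T ∈ 𝕋) {Q : CubeIdx} (hQ : Q ∈ Y T) : Q ∈ cubesOf 𝕋 Y :=
  Finset.mem_biUnion.2 ⟨T, hT, hQ⟩

open Classical in
/-- If every tube through a cube lies in exactly `B₂` of the collections, then the incidences of a
tube count its cubes with multiplicity `B₂`. -/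
lemma card_filter_incidences (hS : ∀ Q ∈ cubesOf 𝕋 Y, ∀ i, S Q i ⊆ tubesThrough 𝕋 Y Q)
    (hB : ∀ Q ∈ cubesOf 𝕋 Y, ∀ T ∈ tubesThrough 𝕋 Y Q,
      (Finset.univ.filter fun i => T ∈ S Q i).card = B₂) {T : Tube} (hT : T ∈ 𝕋)
    (p : CubeIdx → Prop) :
    ((incidences 𝕋 Y S).filter fun x => x.2 = T ∧ p x.1.1).card =
      B₂ * ((Y T).filter p).card := by
  have hmaps : ∀ x ∈ (incidences 𝕋 Y S).filter fun x => x.2 = T ∧ p x.1.1,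
      x.1.1 ∈ (Y T).filter p := by
    intro x hx
    obtain ⟨h1, h2, h3⟩ := Finset.mem_filter.1 hx
    obtain ⟨h4, h5, h6⟩ := mem_incidences.1 h1
    have h7 := (Finset.mem_filter.1 (hS _ h4 _ h6)).2
    rw [h2] at h7
    exact Finset.mem_filter.2 ⟨h7, h3⟩
  rw [Finset.card_eq_sum_card_fiberwise hmaps, mul_comm, ← smul_eq_mul, ← Finset.sum_const]
  refine Finset.sum_congr rfl fun Q hQ => ?_
  obtain ⟨hQT, hQp⟩ := Finset.mem_filter.1 hQ
  rw [← hB Q (mem_cubesOf hT hQT) T (Finset.mem_filter.2 ⟨hT, hQT⟩)]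
  symm
  refine Finset.card_bij (fun i _ => ((Q, i), T)) ?_ ?_ ?_
  · intro i hi
    exact Finset.mem_filter.2 ⟨Finset.mem_filter.2 ⟨mem_incidences.2
      ⟨mem_cubesOf hT hQT, hT, (Finset.mem_filter.1 hi).2⟩, rfl, hQp⟩, rfl⟩
  · intro i _ j _ hij
    simpa using hij
  · rintro ⟨⟨Q', i⟩, T'⟩ hx
    simp only [Finset.mem_filter, mem_incidences] at hx
    obtain ⟨⟨⟨h1, h2, h3⟩, rfl, h5⟩, rfl⟩ := hx
    exact ⟨i, Finset.mem_filter.2 ⟨Finset.mem_univ _, h3⟩, rfl⟩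

open Classical in
lemma card_incidences (hS : ∀ Q ∈ cubesOf 𝕋 Y, ∀ i, S Q i ⊆ tubesThrough 𝕋 Y Q)
    (hB : ∀ Q ∈ cubesOf 𝕋 Y, ∀ T ∈ tubesThrough 𝕋 Y Q,
      (Finset.univ.filter fun i => T ∈ S Q i).card = B₂) :
    (incidences 𝕋 Y S).card = B₂ * ∑ T ∈ 𝕋, (Y T).card := by
  rw [Finset.card_eq_sum_card_fiberwise (f := fun x => x.2) (t := 𝕋)
    (fun x hx => (mem_incidences.1 hx).2.1), Finset.mul_sum]
  refine Finset.sum_congr rfl fun T hT => ?_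
  have h := card_filter_incidences hS hB hT fun _ => True
  simpa using h

end

set_option maxHeartbeats 1000000 in
open Classical in
/-- The volume bound for tubes that lie in planes at each of their cubes. No transversality is
assumed. -/
lemma volume_shadedSet_bound {ε ε₁ A K : ℝ} (hε : 0 < ε) (hε₁ : 0 < ε₁) (hε₁' : ε₁ < 1)
    (hA : 1 ≤ A) (hK : 1 ≤ K) : ∃ c : ℝ, 0 < c ∧
    ∀ (θ C₁ B : ℝ) (B₁ B₂ : ℕ) (Ω : Finset E4) (𝕋 : Finset Tube) (Y : Tube → Finset CubeIdx)
      (P : CubeIdx → Fin B₁ → Submodule ℝ E4) (S : CubeIdx → Fin B₁ → Finset Tube),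
      0 < θ → θ < 1 → 0 < C₁ → 1 ≤ B₂ → B₂ ≤ B₁ → (B₁ : ℝ) / (B₂ : ℝ) ≤ B →
      SeparatedDirections θ Ω → EssentiallyDistinct θ 𝕋 → IsShading θ 𝕋 Y →
      UniformDirections A Ω 𝕋 → TwoEnds θ 𝕋 Y ε₁ C₁ →
      (∀ Q ∈ cubesOf 𝕋 Y, ∀ i, Module.finrank ℝ (P Q i) = 2) →
      (∀ Q ∈ cubesOf 𝕋 Y, ∀ i, S Q i ⊆ tubesThrough 𝕋 Y Q) →
      (∀ Q ∈ cubesOf 𝕋 Y, ∀ i, ∀ T ∈ S Q i, planeAngle T.dir (P Q i) ≤ K * θ) →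
      (∀ Q ∈ cubesOf 𝕋 Y, ∀ T ∈ tubesThrough 𝕋 Y Q,
        (Finset.univ.filter fun i => T ∈ S Q i).card = B₂) →
      c * C₁ ^ (-(1 / ε₁)) * θ ^ ε * B⁻¹ * mainTerm θ Ω 𝕋 Y ≤ volume.real (shadedSet θ 𝕋 Y) := by
  have hA0 : 0 < A := by linarith
  have hK0 : 0 < K := by linarith
  -- the loss `θ ^ κ` enters with the power `14 / ε₁` in the bound for the cube of the main term
  obtain ⟨c, hc0, hc1, H⟩ := incidence_inequality (κ := 3 * ε * ε₁ / 14) (by positivity)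
  set c' : ℝ := c ^ (14 / ε₁) / (10 ^ 78 * K ^ 18 * A * (10 ^ 12) ^ (3 / ε₁)) with hc'
  have hc'0 : 0 < c' := by positivity
  refine ⟨c' ^ (1 / 3 : ℝ), by positivity, ?_⟩
  intro θ C₁ B B₁ B₂ Ω 𝕋 Y P S h0 h1 hC hB₂ hB₂₁ hBB hΩ hE hY hU h2 hrank hS hang hcount
  have hB₂0 : (0 : ℝ) < B₂ := by exact_mod_cast hB₂
  have hB₁0 : (0 : ℝ) < B₁ := by exact_mod_cast hB₂.trans hB₂₁
  have hB0 : 0 < B := lt_of_lt_of_le (by positivity) hBB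
  rcases (avgDensity_nonneg θ 𝕋 Y).eq_or_lt with hl | hl
  · rw [mainTerm_eq_zero hl.symm, mul_zero]
    exact measureReal_nonneg
  obtain ⟨T₀, hT₀, k₀, hk₀⟩ := exists_mem_of_avgDensity_pos h0 hl
  have hN : (0 : ℝ) < 𝕋.card := by exact_mod_cast Finset.card_pos.2 ⟨T₀, hT₀⟩
  have ho : (0 : ℝ) < Ω.card := by
    obtain ⟨v, hv, -⟩ := hU.1 T₀ hT₀
    exact_mod_cast Finset.card_pos.2 ⟨v, hv⟩
  have hq : (0 : ℝ) < (cubesOf 𝕋 Y).card := by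
    exact_mod_cast Finset.card_pos.2 ⟨k₀, mem_cubesOf hT₀ hk₀⟩
  set I := incidences 𝕋 Y S with hI
  have hcard : (I.card : ℝ) = B₂ * ∑ T ∈ 𝕋, ((Y T).card : ℝ) := by
    rw [hI, card_incidences hS hcount]; push_cast; rfl
  set l := avgDensity θ 𝕋 Y with hldef
  set E : ℝ := ∑ T ∈ 𝕋, ((Y T).card : ℝ) with hEdef
  have hlE : l * 𝕋.card ≤ 32 * θ * E := avgDensity_mul_card_le h0 𝕋 Y
  have hdeg : ∀ T ∈ 𝕋, ((Y T).card : ℝ) ≤ 10 ^ 9 * (C₁ * l / θ) := fun T hT =>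
    card_shading_le h0 h1 hC hY h2 hl hT
  have hΛ0 : 0 < C₁ * l / θ := by positivity
  have hZ : 1 ≤ 10 ^ 12 * C₁ := by
    have e1 : E ≤ 𝕋.card * (10 ^ 9 * (C₁ * l / θ)) := by
      rw [← nsmul_eq_mul]; exact Finset.sum_le_card_nsmul _ _ _ hdeg
    have e2 : 32 * θ * E ≤ 32 * θ * (𝕋.card * (10 ^ 9 * (C₁ * l / θ))) := by gcongr
    have e3 : 32 * θ * (𝕋.card * (10 ^ 9 * (C₁ * l / θ))) = l * 𝕋.card * (32 * 10 ^ 9 * C₁) := by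
      field_simp
    have e4 : 0 < l * 𝕋.card := mul_pos hl hN
    have e5 : l * 𝕋.card * 1 ≤ l * 𝕋.card * (32 * 10 ^ 9 * C₁) := by linarith
    have := le_of_mul_le_mul_left e5 e4
    linarith
  have hIpos : 0 < I.card := by
    have e1 : 0 < E :=
      pos_of_mul_pos_right ((mul_pos hl hN).trans_le hlE) (mul_pos (by norm_num) h0).le
    have : (0 : ℝ) < I.card := hcard ▸ mul_pos hB₂0 e1
    exact_mod_cast this
  have hempty : ∀ T ∉ 𝕋, ∀ p : (CubeIdx × Fin B₁) × Tube → Prop,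
      (I.filter fun x => x.2 = T ∧ p x) = ∅ := by
    intro T hT p
    rw [Finset.filter_eq_empty_iff]
    rintro x hx ⟨rfl, -⟩
    exact hT (mem_incidences.1 hx).2.1
  have hdata : IncidenceData θ K 2 2 𝕋 (fun q => P q.1 q.2) I :=
    { mem := fun x hx => (mem_incidences.1 hx).2.1
      meets := fun x hx => by
        obtain ⟨e1, e2, e3⟩ := mem_incidences.1 hx
        exact hY _ e2 _ (Finset.mem_filter.1 (hS _ e1 _ e3)).2
      dev_le := fun x hx => by
        obtain ⟨e1, e2, e3⟩ := mem_incidences.1 hx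
        exact dev_le_of_planeAngle_le x.2.norm_dir (hang _ e1 _ _ e3)
      rank := fun x hx => hrank _ (mem_incidences.1 hx).1 _
      plane_le := fun x _ y _ _ => planeDist_le_two _ _
      line_le := fun x _ y _ _ => lineDist_le_two _ _ }
  have key := H θ K ε₁ (A * (𝕋.card / Ω.card)) (B₂ * (10 ^ 9 * (C₁ * l / θ))) B₂ B₁ Ω 𝕋
    (fun q => P q.1 q.2) I (cubesOf 𝕋 Y ×ˢ Finset.univ) h0 h1 hK hε₁ hΩ hU.1 hE (by positivity)
    (fun v hv => (hU.2 v hv).2) hdata (Finset.card_pos.1 hIpos)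
    (fun x hx => Finset.mem_product.2 ⟨(mem_incidences.1 hx).1, Finset.mem_univ _⟩) ?_ hB₂0.le ?_ ?_
  · rw [hcard, Finset.card_product, Finset.card_univ, Fintype.card_fin, Nat.cast_mul] at key
    have hu1 : c * θ ^ (3 * ε * ε₁ / 14) ≤ 1 := by
      have : θ ^ (3 * ε * ε₁ / 14) ≤ 1 := Real.rpow_le_one h0.le h1.le (by positivity)
      exact mul_le_one₀ hc1 (by positivity) this
    have hnum := numeric_bound hl hN ho hq hB₁0 hB₂0 hC hA0 hK0 (by positivity) hu1 hB0 h0 hε₁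
      hε₁' hZ hlE (by rwa [div_le_iff₀ hB₂0] at hBB) key
    have hupow : (c * θ ^ (3 * ε * ε₁ / 14)) ^ (14 / ε₁) = c ^ (14 / ε₁) * (θ ^ ε) ^ 3 := by
      rw [Real.mul_rpow hc0.le (by positivity), ← Real.rpow_mul h0.le, ← Real.rpow_natCast,
        ← Real.rpow_mul h0.le]
      congr 2
      push_cast
      field_simp
    have hCpow : (10 ^ 12 * C₁) ^ (3 / ε₁) = (10 ^ 12) ^ (3 / ε₁) * (C₁ ^ (1 / ε₁)) ^ 3 := by
      rw [Real.mul_rpow (by positivity) hC.le]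
      congr 1
      rw [← Real.rpow_natCast, ← Real.rpow_mul hC.le]
      congr 1
      push_cast; ring
    rw [hupow, hCpow] at hnum
    have hcc : (c' ^ (1 / 3 : ℝ)) ^ 3 = c' := by
      rw [← Real.rpow_natCast, ← Real.rpow_mul hc'0.le]; norm_num
    have hCinv : C₁ ^ (-(1 / ε₁)) = (C₁ ^ (1 / ε₁))⁻¹ := Real.rpow_neg hC.le _
    have hX0 : 0 < C₁ ^ (1 / ε₁) := Real.rpow_pos_of_pos hC _
    have hW0 : (0 : ℝ) < (10 ^ 12) ^ (3 / ε₁) := by positivity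
    refine le_of_pow_le_pow_left₀ (n := 3) (by norm_num) measureReal_nonneg ?_
    rw [shadedSet_eq_region, volume_real_region h0, mul_pow, mul_pow, mul_pow, mul_pow, hcc,
      mainTerm_pow_three h0, hCinv, hc']
    set X := C₁ ^ (1 / ε₁)
    set W : ℝ := (10 ^ 12) ^ (3 / ε₁)
    set U := c ^ (14 / ε₁)
    set t := θ ^ ε
    set q : ℝ := ((cubesOf 𝕋 Y).card : ℝ)
    set N : ℝ := (𝕋.card : ℝ)
    set o : ℝ := (Ω.card : ℝ)
    have e1 : U / (10 ^ 78 * K ^ 18 * A * W) * X⁻¹ ^ 3 * t ^ 3 * B⁻¹ ^ 3 *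
        (θ ^ 11 * (l ^ 4 * N ^ 2 * o)) = (l ^ 4 * N ^ 2 * o * (U * t ^ 3)) *
          (θ ^ 11 / (10 ^ 78 * K ^ 18 * A * W * X ^ 3 * B ^ 3)) := by
      field_simp
    have e2 : (q * θ ^ 4) ^ 3 = 10 ^ 78 * K ^ 18 * A * θ * (W * X ^ 3) * B ^ 3 * q ^ 3 *
          (θ ^ 11 / (10 ^ 78 * K ^ 18 * A * W * X ^ 3 * B ^ 3)) := by
      field_simp
    rw [e1, e2]
    exact mul_le_mul_of_nonneg_right hnum (by positivity)
  · intro T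
    by_cases hT : T ∈ 𝕋
    · have e1 := card_filter_incidences hS hcount hT fun _ => True
      have e2 : (I.filter fun x => x.2 = T).card = B₂ * (Y T).card := by simpa using e1
      rw [e2]; push_cast
      exact mul_le_mul_of_nonneg_left (hdeg T hT) hB₂0.le
    · have e1 := hempty T hT fun _ => True
      have e2 : (I.filter fun x => x.2 = T) = ∅ := by simpa using e1
      rw [e2, Finset.card_empty, Nat.cast_zero]; positivity
  · intro T Q
    by_cases hT : T ∈ 𝕋
    · have e1 := card_filter_incidences hS hcount hT fun k => k = Q
      have e2 : ((Y T).filter fun k => k = Q).card ≤ 1 := by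
        rw [Finset.card_le_one]
        intro a ha b hb
        rw [(Finset.mem_filter.1 ha).2, (Finset.mem_filter.1 hb).2]
      have e3 : (I.filter fun x => x.2 = T ∧ x.1.1 = Q).card ≤ B₂ := by
        refine le_trans (le_of_eq ?_) ((Nat.mul_le_mul_left B₂ e2).trans_eq (mul_one _))
        convert e1
      exact_mod_cast e3
    · have e1 := hempty T hT fun x => x.1.1 = Q
      have e2 : (I.filter fun x => x.2 = T ∧ x.1.1 = Q) = ∅ := by convert e1
      rw [e2, Finset.card_empty, Nat.cast_zero]; positivity
  · intro T k r hr0 hr1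
    by_cases hT : T ∈ 𝕋
    · have e1 := card_filter_incidences hS hcount hT fun j => ‖corner θ k - corner θ j‖ + θ < r
      have e2 := card_near_cubes_le h0 hC h2 hT hr0 hr1 k
      have e3 : (0 : ℝ) ≤ (2 * r) ^ ε₁ := by positivity
      rw [e1]; push_cast
      calc (B₂ : ℝ) * _ ≤ B₂ * ((2 * r) ^ ε₁ * (C₁ * l / θ)) :=
            mul_le_mul_of_nonneg_left e2 hB₂0.le
        _ ≤ B₂ * ((2 * r) ^ ε₁ * (10 ^ 9 * (C₁ * l / θ))) := by gcongr; linarith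
        _ = _ := by ring
    · rw [hempty T hT, Finset.card_empty, Nat.cast_zero]; positivity

/-! ### Transversality constants and the three cases -/

/-- Robust transversality cannot hold with a small constant, since finitely many caps of angle
`1 / 2` cover the sphere. -/
lemma exists_le_of_robustlyTransverse : ∃ n : ℝ, 0 < n ∧ ∀ (θ ε₂ C₂ : ℝ) (𝕋 : Finset Tube)
    (Y : Tube → Finset CubeIdx), 0 < θ → θ < 1 → 0 < ε₂ → 0 < C₂ → (cubesOf 𝕋 Y).Nonempty →
    RobustlyTransverse θ 𝕋 Y ε₂ C₂ → 1 ≤ n * C₂ := by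
  classical
  have hcomp : IsCompact (Metric.sphere (0 : E4) 1) := isCompact_sphere _ _
  obtain ⟨t, ht, hcov⟩ := hcomp.elim_nhds_subcover
    (fun w => {v : E4 | InnerProductGeometry.angle v w < 1 / 2}) fun w hw => by
      have hw0 : w ≠ 0 := by rintro rfl; simp at hw
      have hc : ContinuousAt (fun v : E4 => InnerProductGeometry.angle v w) w := by
        have h1 := InnerProductGeometry.continuousAt_angle (x := (w, w)) hw0 hw0
        exact h1.comp (f := fun v : E4 => (v, w)) (by fun_prop)
      refine hc.eventually_lt continuousAt_const ?_
      rw [InnerProductGeometry.angle_self hw0]; norm_num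
  refine ⟨t.card + 1, by positivity, ?_⟩
  intro θ ε₂ C₂ 𝕋 Y h0 h1 hε hC hne hR
  have hq : (0 : ℝ) < (cubesOf 𝕋 Y).card := by exact_mod_cast hne.card_pos
  have hμ : 0 < avgMult 𝕋 Y := by
    refine div_pos (Finset.sum_pos (fun Q hQ => ?_) hne) hq
    obtain ⟨T, hT, hQT⟩ := Finset.mem_biUnion.1 hQ
    exact_mod_cast Finset.card_pos.2 ⟨T, Finset.mem_filter.2 ⟨hT, hQT⟩⟩
  set r := (1 + θ) / 2 with hr
  have hcube : ∀ Q, ((tubesThrough 𝕋 Y Q).card : ℝ) ≤ t.card * (C₂ * avgMult 𝕋 Y) := by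
    intro Q
    have hsub : tubesThrough 𝕋 Y Q ⊆
        t.biUnion fun w => (tubesThrough 𝕋 Y Q).filter fun T => lineAngle T.dir w ≤ r := by
      intro T hT
      have h3 : T.dir ∈ Metric.sphere (0 : E4) 1 := by
        rw [mem_sphere_zero_iff_norm]; exact T.norm_dir
      obtain ⟨w, hw, h4⟩ := Set.mem_iUnion₂.1 (hcov h3)
      refine Finset.mem_biUnion.2 ⟨w, hw, Finset.mem_filter.2 ⟨hT, (min_le_left _ _).trans ?_⟩⟩
      have h5 : InnerProductGeometry.angle T.dir w < 1 / 2 := h4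
      linarith
    have h3 : ((tubesThrough 𝕋 Y Q).card : ℝ) ≤ ∑ w ∈ t,
        (((tubesThrough 𝕋 Y Q).filter fun T => lineAngle T.dir w ≤ r).card : ℝ) := by
      exact_mod_cast (Finset.card_le_card hsub).trans Finset.card_biUnion_le
    refine h3.trans ?_
    rw [← nsmul_eq_mul]
    refine Finset.sum_le_card_nsmul _ _ _ fun w _ => ?_
    refine (hR Q w r (by linarith) (by linarith)).trans ?_
    have h4 : r ^ ε₂ ≤ 1 := Real.rpow_le_one (by linarith) (by linarith) hε.le
    calc r ^ ε₂ * C₂ * avgMult 𝕋 Y ≤ 1 * C₂ * avgMult 𝕋 Y := by gcongr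
      _ = _ := by rw [one_mul]
  have hsum : avgMult 𝕋 Y ≤ t.card * (C₂ * avgMult 𝕋 Y) := by
    nth_rewrite 1 [avgMult]
    rw [div_le_iff₀ hq, mul_comm, ← nsmul_eq_mul]
    exact Finset.sum_le_card_nsmul _ _ _ fun Q _ => hcube Q
  have h3 : 1 * avgMult 𝕋 Y ≤ (t.card * C₂) * avgMult 𝕋 Y := by linarith
  have := le_of_mul_le_mul_right h3 hμ
  linarith

/-- The volume bound for tubes that lie in a single plane at each cube. -/
lemma volume_shadedSet_bound_of_plany {ε ε₁ A K : ℝ} (hε : 0 < ε) (hε₁ : 0 < ε₁) (hε₁' : ε₁ < 1)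
    (hA : 1 ≤ A) (hK : 1 ≤ K) : ∃ c : ℝ, 0 < c ∧
    ∀ (θ C₁ : ℝ) (Ω : Finset E4) (𝕋 : Finset Tube) (Y : Tube → Finset CubeIdx),
      0 < θ → θ < 1 → 0 < C₁ → SeparatedDirections θ Ω → EssentiallyDistinct θ 𝕋 →
      IsShading θ 𝕋 Y → UniformDirections A Ω 𝕋 → TwoEnds θ 𝕋 Y ε₁ C₁ → Plany K θ 𝕋 Y →
      c * C₁ ^ (-(1 / ε₁)) * θ ^ ε * mainTerm θ Ω 𝕋 Y ≤ volume.real (shadedSet θ 𝕋 Y) := by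
  obtain ⟨c, hc, H⟩ := volume_shadedSet_bound hε hε₁ hε₁' hA hK
  refine ⟨c, hc, ?_⟩
  intro θ C₁ Ω 𝕋 Y h0 h1 hC hΩ hE hY hU h2 hP
  choose P hP2 hPa using hP
  have h := H θ C₁ 1 1 1 Ω 𝕋 Y (fun Q _ => P Q) (fun Q _ => tubesThrough 𝕋 Y Q) h0 h1 hC le_rfl
    le_rfl (by norm_num) hΩ hE hY hU h2 (fun Q _ _ => hP2 Q) (fun Q _ _ => subset_rfl)
    (fun Q _ _ T hT => hPa Q T hT) (fun Q _ T hT => by simp [hT])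
  simpa using h

end Planebrush

end

theorem mainTheorem2 :
    -- weakly plany tubes: the planebrush estimate with covering parameter `B`
    (∃ C : ℝ, 0 < C ∧ ∀ ε ε₁ A : ℝ, 0 < ε → 0 < ε₁ → ε₁ < 1 → 1 ≤ A →
      ∃ c : ℝ, 0 < c ∧
        ∀ (θ C₁ B : ℝ) (B₁ B₂ : ℕ) (Ω : Finset Planebrush.E4) (𝕋 : Finset Planebrush.Tube)
          (Y : Planebrush.Tube → Finset Planebrush.CubeIdx),
          0 < θ → θ < 1 → 0 < C₁ → 1 ≤ B₂ → B₂ ≤ B₁ → (B₁ : ℝ) / (B₂ : ℝ) ≤ B →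
          Planebrush.SeparatedDirections θ Ω →
          Planebrush.EssentiallyDistinct θ 𝕋 →
          Planebrush.IsShading θ 𝕋 Y →
          Planebrush.UniformDirections A Ω 𝕋 →
          Planebrush.TwoEnds θ 𝕋 Y ε₁ C₁ →
          Planebrush.WeaklyPlany A θ 𝕋 Y B B₁ B₂ →
          c * C₁ ^ (-(C / ε₁)) * θ ^ ε * B ^ (-(4 / 3 : ℝ)) * Planebrush.mainTerm θ Ω 𝕋 Y
            ≤ MeasureTheory.volume.real (Planebrush.shadedSet θ 𝕋 Y)) ∧
    -- strongly plany tubes, the case `B = 1`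
    (∃ C : ℝ, 0 < C ∧ ∀ ε ε₁ A : ℝ, 0 < ε → 0 < ε₁ → ε₁ < 1 → 1 ≤ A →
      ∃ c : ℝ, 0 < c ∧
        ∀ (θ C₁ : ℝ) (Ω : Finset Planebrush.E4) (𝕋 : Finset Planebrush.Tube)
          (Y : Planebrush.Tube → Finset Planebrush.CubeIdx),
          0 < θ → θ < 1 → 0 < C₁ →
          Planebrush.SeparatedDirections θ Ω →
          Planebrush.EssentiallyDistinct θ 𝕋 →
          Planebrush.IsShading θ 𝕋 Y →
          Planebrush.UniformDirections A Ω 𝕋 →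
          Planebrush.TwoEnds θ 𝕋 Y ε₁ C₁ →
          Planebrush.Plany 1 θ 𝕋 Y →
          c * C₁ ^ (-(C / ε₁)) * θ ^ ε * Planebrush.mainTerm θ Ω 𝕋 Y
            ≤ MeasureTheory.volume.real (Planebrush.shadedSet θ 𝕋 Y)) ∧
    -- plany and robustly transverse tubes, with explicit exponents
    (∀ ε ε₁ ε₂ A K : ℝ, 0 < ε → 0 < ε₂ → ε₂ < ε₁ → ε₁ < 1 → 1 ≤ A → 1 ≤ K →
      ∃ c : ℝ, 0 < c ∧
        ∀ (θ C₁ C₂ : ℝ) (Ω : Finset Planebrush.E4) (𝕋 : Finset Planebrush.Tube)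
          (Y : Planebrush.Tube → Finset Planebrush.CubeIdx),
          0 < θ → θ < 1 → 0 < C₁ → 0 < C₂ →
          Planebrush.SeparatedDirections θ Ω →
          Planebrush.EssentiallyDistinct θ 𝕋 →
          Planebrush.IsShading θ 𝕋 Y →
          Planebrush.UniformDirections A Ω 𝕋 →
          Planebrush.TwoEnds θ 𝕋 Y ε₁ C₁ →
          Planebrush.RobustlyTransverse θ 𝕋 Y ε₂ C₂ →
          Planebrush.Plany K θ 𝕋 Y →
          c * C₁ ^ (-(1 / ε₁)) * C₂ ^ (-(2 / ε₂)) * θ ^ ε * Planebrush.mainTerm θ Ω 𝕋 Y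
            ≤ MeasureTheory.volume.real (Planebrush.shadedSet θ 𝕋 Y)) := by
  refine ⟨⟨1, one_pos, ?_⟩, ⟨1, one_pos, ?_⟩, ?_⟩
  · intro ε ε₁ A hε hε₁ hε₁' hA
    obtain ⟨c, hc, H⟩ := Planebrush.volume_shadedSet_bound hε hε₁ hε₁' hA le_rfl
    refine ⟨c, hc, ?_⟩
    intro θ C₁ B B₁ B₂ Ω 𝕋 Y h0 h1 hC hB₂ hB₂₁ hBB hΩ hE hY hU h2 hW
    choose! P S hrank hS hang _ hcount using hW
    have h := H θ C₁ B B₁ B₂ Ω 𝕋 Y P S h0 h1 hC hB₂ hB₂₁ hBB hΩ hE hY hU h2 hrank hS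
      (fun Q hQ i T hT => by rw [one_mul]; exact hang Q hQ i T hT) hcount
    refine le_trans ?_ h
    have hB : 1 ≤ B := by
      refine le_trans ?_ hBB
      have h3 : (0 : ℝ) < B₂ := by exact_mod_cast hB₂
      rw [one_le_div h3]
      exact_mod_cast hB₂₁
    have h4 : B ^ (-(4 / 3 : ℝ)) ≤ B⁻¹ := by
      rw [← Real.rpow_neg_one]
      exact Real.rpow_le_rpow_of_exponent_le hB (by norm_num)
    have h5 := Planebrush.mainTerm_nonneg h0 Ω 𝕋 Y
    gcongr
  · intro ε ε₁ A hε hε₁ hε₁' hA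
    exact Planebrush.volume_shadedSet_bound_of_plany hε hε₁ hε₁' hA le_rfl
  · intro ε ε₁ ε₂ A K hε hε₂ hε₂₁ hε₁' hA hK
    obtain ⟨c, hc, H⟩ :=
      Planebrush.volume_shadedSet_bound_of_plany hε (hε₂.trans hε₂₁) hε₁' hA hK
    obtain ⟨n, hn, hR⟩ := Planebrush.exists_le_of_robustlyTransverse
    refine ⟨c / n ^ (2 / ε₂), by positivity, ?_⟩
    intro θ C₁ C₂ Ω 𝕋 Y h0 h1 hC hC₂ hΩ hE hY hU h2 hT hP
    rcases (Planebrush.avgDensity_nonneg θ 𝕋 Y).eq_or_lt with hl | hl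
    · rw [Planebrush.mainTerm_eq_zero hl.symm, mul_zero]
      exact measureReal_nonneg
    obtain ⟨T, hT𝕋, Q, hQ⟩ := Planebrush.exists_mem_of_avgDensity_pos h0 hl
    -- the factor `C₂ ^ (-(2 / ε₂))` is bounded
    have h3 := hR θ ε₂ C₂ 𝕋 Y h0 h1 hε₂ hC₂ ⟨Q, Planebrush.mem_cubesOf hT𝕋 hQ⟩ hT
    have h4 : C₂ ^ (-(2 / ε₂)) ≤ n ^ (2 / ε₂) := by
      rw [Real.rpow_neg hC₂.le, ← Real.inv_rpow hC₂.le]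
      have h6 : C₂⁻¹ ≤ n := by rwa [inv_le_iff_one_le_mul₀ hC₂]
      gcongr
    have h5 := Planebrush.mainTerm_nonneg h0 Ω 𝕋 Y
    refine le_trans ?_ (H θ C₁ Ω 𝕋 Y h0 h1 hC hΩ hE hY hU h2 hP)
    have h7 : c / n ^ (2 / ε₂) * C₂ ^ (-(2 / ε₂)) ≤ c := by
      rw [div_mul_eq_mul_div, div_le_iff₀ (by positivity)]
      gcongr
    calc _ = c / n ^ (2 / ε₂) * C₂ ^ (-(2 / ε₂)) *
          (C₁ ^ (-(1 / ε₁)) * θ ^ ε * Planebrush.mainTerm θ Ω 𝕋 Y) := by ring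
      _ ≤ c * (C₁ ^ (-(1 / ε₁)) * θ ^ ε * Planebrush.mainTerm θ Ω 𝕋 Y) := by gcongr
      _ = _ := by ring
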